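/- **Setting.** For $n\ge 0$ let $\mathrm{OPol}_n=\mathbb Z\langle x_1,\dots,x_n\rangle/(x_ix_j+x_jx_i : i\neq j)$ and $\widetilde x_i=(-1)^{i-1}x_i$. The symmetric group $S_n$ acts on $\mathrm{OPol}_n$ by ring automorphisms, the simple transposition $s_i$ by $s_i(x_j)=-x_{s_i(j)}$ for all $j$; write $f^{w}$ for the result of acting by $w$ on $f$, and let $w_0$ be the longest element ($i\mapsto n+1-i$). For $1\le i\le n-1$ the odd divided difference $\partial_i:\mathrm{OPol}_n\to\mathrm{OPol}_n$ is the $\mathbb Z$-linear map with $\partial_i(x_i)=\partial_i(x_{i+1})=1$, $\partial_i(x_j)=0$ for $j\ne i,i+1$, and $\partial_i(fg)=\partial_i(f)g+s_i(f)\partial_i(g)$. Put $\partial_{w_0}=\partial_1(\partial_2\partial_1)\cdots(\partial_{n-1}\cdots\partial_1)$ (composition of operators). The ring of odd symmetric polynomials is $\mathrm{O}\Lambda_n=\bigcap_i\ker\partial_i\subset\mathrm{OPol}_n$. The ring of odd symmetric functions $\mathrm{O}\Lambda$ is the inverse limit of the $\mathrm{O}\Lambda_n$, in the category of graded rings, along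 the maps $x_{n+1}\mapsto 0$, $x_i\mapsto x_i$ ($i\le n$). Let $$h_k=\sum_{1\le i_1\le\dots\le i_k\le n}\widetilde x_{i_1}\cdots\widetilde x_{i_k},\qquad h_0=1,\qquad h_\mu=h_{\mu_1}\cdots h_{\mu_r}\ \text{ for a partition }\mu=(\mu_1\ge\dots\ge\mu_r\geq 1);$$ the $h_k$ for varying $n$ also define $h_k$, and hence $h_\mu$, in $\mathrm{O}\Lambda$. **Tableaux.** A partition $\lambda$ is identified with its Young diagram (row lengths $\lambda_1\ge\lambda_2\ge\cdots$, first row on top). Semistandard tableaux weakly increase along rows (left to right) and strictly increase down columns. The row word $w_r(T)$ of a semistandard tableau $T$ reads the entries of each row from left to right, with the rows taken from bottom to top; $\mathrm{sign}(T)$ is the sign of the minimal length permutation that sorts $w_r(T)$ into non-decreasing order. $T_\lambda$ is the semistandard tableau of shape and content $\lambda$. Let $N(\lambda)$ be the sum over all boxes $B$ of $\lambda$ of the number of boxes in rows above that of $B$, and $dN(\lambda)$ the sum over all boxes $B$ of the number of boxes above $B$ in its column. For a word $w=i_1\cdots i_r$ write $\widetilde x^{w}=\widetilde x_{i_1}\cdots\widetilde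 x_{i_r}$. **Three odd Schur functions.** 1. (Kostka) For partitions $\lambda,\mu$ of the same integer put $K_{\lambda\mu}=\mathrm{sign}(T_\lambda)\sum_T\mathrm{sign}(T)$, the sum over semistandard tableaux $T$ of shape $\lambda$ and content $\mu$. The $s^K_\lambda$ are defined by the change of basis relations $h_\mu=\sum_{\lambda\vdash k}K_{\lambda\mu}s^K_\lambda$ for all $\mu\vdash k$, that is, $s^K_\lambda=\sum_{\mu\vdash k}(K^{-1})_{\mu\lambda}h_\mu$ for the matrix $K=(K_{\lambda\mu})_{\lambda,\mu\vdash k}$. 2. (plactic) $s^p_\lambda=(-1)^{dN(\lambda)+N(\lambda)}\sum_T\widetilde x^{w_r(T)}$, the sum over semistandard tableaux $T$ of shape $\lambda$ with entries in $\{1,\dots,n\}$. 3. (odd-symmetrized) If $\lambda$ has at most $n$ rows, $s^s_\lambda=(-1)^{\binom n3}\bigl(\partial_{w_0}(x_1^{\lambda_1}\cdots x_n^{\lambda_n}\,x_1^{n-1}x_2^{n-2}\cdots x_{n-1})\bigr)^{w_0}$. In $\mathrm{O}\Lambda$, $s^K_\lambda$ is defined by the same change of basis relations, $s^p_\lambda$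 is the sequence of the polynomials in (2) for all $n$, and $s^s_\lambda$ is the sequence whose $n$-th term is the polynomial in (3) if $\lambda$ has at most $n$ rows, and otherwise the image in $\mathrm{OPol}_n$, under setting $x_i=0$ for $i>n$, of the polynomial in (3) in as many variables as $\lambda$ has rows. **Theorem.** Let $\lambda$ be a partition of $k$. The integer matrix $(K_{\nu\mu})_{\nu,\mu\vdash k}$ is unimodular, so the $s^K$ are well defined, and the three notions of odd Schur function coincide: * for every $n$, in $\mathrm{O}\Lambda_n\subset\mathrm{OPol}_n$, $s^K_\lambda=s^p_\lambda$, and $s^p_\lambda=s^s_\lambda$ whenever $\lambda$ has at most $n$ rows; * in $\mathrm{O}\Lambda$, $s^K_\lambda=s^p_\lambda=s^s_\lambda$. -/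

import Mathlib

/-! Odd symmetric functions and the three families of odd Schur functions.
All indices are shifted to start from zero: the variables are `x_0, …, x_{n-1}`, the tableau
entries and the rows of a Young diagram are counted from `0`. -/

noncomputable section

namespace OddSchur

/-! ### Skew polynomials -/

/-- The relations `x_i x_j + x_j x_i = 0` for `i ≠ j`. -/
inductive SkewRel (n : ℕ) : FreeAlgebra ℤ (Fin n) → FreeAlgebra ℤ (Fin n) → Prop
  | anticomm (i j : Fin n) (h : i ≠ j) :
      SkewRel n (FreeAlgebra.ι ℤ i * FreeAlgebra.ι ℤ j + FreeAlgebra.ι ℤ j * FreeAlgebra.ι ℤ i) 0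

/-- The ring of skew polynomials in `n` variables. -/
def OPol (n : ℕ) : Type := RingQuot (SkewRel n)

instance (n : ℕ) : Ring (OPol n) := inferInstanceAs (Ring (RingQuot (SkewRel n)))

/-- The quotient map from the free ring. -/
def mkHom (n : ℕ) : FreeAlgebra ℤ (Fin n) →+* OPol n := RingQuot.mkRingHom (SkewRel n)

theorem mkHom_surjective (n : ℕ) : Function.Surjective (mkHom n) :=
  RingQuot.mkRingHom_surjective (SkewRel n)

/-- The variable `x_i`. -/
def X {n : ℕ} (i : Fin n) : OPol n :=
  mkHom n (FreeAlgebra.ι ℤ i)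

theorem X_anticomm {n : ℕ} {i j : Fin n} (h : i ≠ j) : X i * X j + X j * X i = 0 := by
  have : mkHom n _ = mkHom n _ := RingQuot.mkRingHom_rel (SkewRel.anticomm i j h)
  simpa [X] using this

/-- The universal property: pairwise anticommuting elements define a ring homomorphism. -/
def lift {n : ℕ} {B : Type} [Ring B] (f : Fin n → B)
    (hf : ∀ i j, i ≠ j → f i * f j + f j * f i = 0) : OPol n →+* B :=
  RingQuot.lift ⟨(FreeAlgebra.lift ℤ f : FreeAlgebra ℤ (Fin n) →ₐ[ℤ] B).toRingHom, by
    rintro _ _ ⟨i, j, h⟩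
    simpa using hf i j h⟩

@[simp]
theorem lift_X {n : ℕ} {B : Type} [Ring B] (f : Fin n → B)
    (hf : ∀ i j, i ≠ j → f i * f j + f j * f i = 0) (i : Fin n) : lift f hf (X i) = f i := by
  rw [lift, X, mkHom]
  erw [RingQuot.lift_mkRingHom_apply]
  simp

theorem hom_ext {n : ℕ} {B : Type} [Ring B] {f g : OPol n →+* B}
    (h : ∀ i, f (X i) = g (X i)) : f = g := by
  have e : (f.comp (mkHom n)).toIntAlgHom = (g.comp (mkHom n)).toIntAlgHom := by
    apply FreeAlgebra.hom_ext
    funext i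
    exact h i
  ext y
  obtain ⟨y, rfl⟩ := mkHom_surjective n y
  exact DFunLike.congr_fun e y

/-- `x_a` for a natural number `a`, read as `0` when there is no such variable. -/
def x (n a : ℕ) : OPol n := if h : a < n then X ⟨a, h⟩ else 0

/-- The signed variable `(-1)^a x_a` (that is `(-1)^{i-1} x_i` with indices counted from `1`). -/
def xt (n a : ℕ) : OPol n := (-1) ^ a * x n a

/-- The monomial in the signed variables spelled by a word. -/
def xtWord (n : ℕ) (w : List ℕ) : OPol n := (w.map (xt n)).prod

theorem x_anticomm (n : ℕ) {a b : ℕ} (h : a ≠ b) : x n a * x n b + x n b * x n a = 0 := by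
  unfold x
  split_ifs
  · exact X_anticomm (by simpa using h)
  all_goals simp

/-- The map `OPol N → OPol n` with `x_i ↦ x_i` for `i < n` and `x_i ↦ 0` for `i ≥ n`. -/
def trunc (N n : ℕ) : OPol N →+* OPol n :=
  lift (fun i => x n i) fun _ _ h => x_anticomm n (fun e => h (Fin.ext e))

/-! ### The action of the symmetric group and the odd divided differences -/

/-- The action of a permutation: the ring endomorphism `x_j ↦ sign(σ) x_{σ(j)}`. -/
def permAct {n : ℕ} (σ : Equiv.Perm (Fin n)) : OPol n →+* OPol n :=
  lift (fun j => (Equiv.Perm.sign σ : ℤ) • X (σ j)) fun i j h => by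
    have := X_anticomm (fun e => h (σ.injective e) : σ i ≠ σ j)
    simp only [smul_mul_smul_comm, ← smul_add, this, smul_zero]

theorem permAct_X {n : ℕ} (σ : Equiv.Perm (Fin n)) (j : Fin n) :
    permAct σ (X j) = (Equiv.Perm.sign σ : ℤ) • X (σ j) := lift_X _ _ _

/-- `permAct` is a left action of the symmetric group. -/
theorem permAct_mul {n : ℕ} (σ τ : Equiv.Perm (Fin n)) (f : OPol n) :
    permAct (σ * τ) f = permAct σ (permAct τ f) := by
  have : permAct (σ * τ) = (permAct σ).comp (permAct τ) := by
    apply hom_ext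
    intro i
    simp only [RingHom.comp_apply, permAct_X, map_zsmul, smul_smul, map_mul, Units.val_mul,
      Equiv.Perm.mul_apply, mul_comm]
  rw [this]; rfl

/-- The first of the two indices exchanged by the `i`-th simple transposition. -/
def lo {n : ℕ} (i : Fin (n - 1)) : Fin n := ⟨i, by omega⟩

/-- The second of the two indices exchanged by the `i`-th simple transposition. -/
def hi {n : ℕ} (i : Fin (n - 1)) : Fin n := ⟨i + 1, by omega⟩

theorem lo_ne_hi {n : ℕ} (i : Fin (n - 1)) : lo i ≠ hi i := by
  simp [lo, hi, Fin.ext_iff]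

/-- The simple transposition `s_i`, acting on skew polynomials. -/
def simpleAct {n : ℕ} (i : Fin (n - 1)) : OPol n →+* OPol n :=
  permAct (Equiv.swap (lo i) (hi i))

theorem simpleAct_X {n : ℕ} (i : Fin (n - 1)) (j : Fin n) :
    simpleAct i (X j) = -X (Equiv.swap (lo i) (hi i) j) := by
  simp [simpleAct, permAct_X, Equiv.Perm.sign_swap (lo_ne_hi i)]

/-- The value of the `i`-th odd divided difference on the variable `x_j`. -/
def divVar {n : ℕ} (i : Fin (n - 1)) (j : Fin n) : OPol n :=
  if j = lo i ∨ j = hi i then 1 else 0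

theorem divVar_rel {n : ℕ} (i : Fin (n - 1)) (j k : Fin n) (h : j ≠ k) :
    (divVar i j * X k + simpleAct i (X j) * divVar i k) +
      (divVar i k * X j + simpleAct i (X k) * divVar i j) = 0 := by
  simp only [simpleAct_X, divVar]
  by_cases h1 : j = lo i
  · subst h1
    by_cases h2 : k = hi i
    · subst h2; simp
    · have : k ≠ lo i := fun e => h e.symm
      simp [h2, this, Equiv.swap_apply_of_ne_of_ne this h2]
  · by_cases h1' : j = hi i
    · subst h1'
      by_cases h2 : k = lo i
      · subst h2; simp
      · have : k ≠ hi i := fun e => h e.symm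
        simp [h2, this, Equiv.swap_apply_of_ne_of_ne h2 this]
    · rw [Equiv.swap_apply_of_ne_of_ne h1 h1']
      by_cases h2 : k = lo i
      · subst h2; simp [h1, h1']
      · by_cases h2' : k = hi i
        · subst h2'; simp [h1, h1']
        · simp [h1, h1', h2, h2']

/-- The twisted Leibniz rule, packaged as the multiplicativity of
`f ↦ !![s_i f, ∂_i f; 0, f]`. -/
def divMatrix {n : ℕ} (i : Fin (n - 1)) : OPol n →+* Matrix (Fin 2) (Fin 2) (OPol n) :=
  lift (fun j => !![simpleAct i (X j), divVar i j; 0, X j]) fun j k h => by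
    have h1 : simpleAct i (X j) * simpleAct i (X k) + simpleAct i (X k) * simpleAct i (X j) = 0 := by
      rw [← map_mul, ← map_mul, ← map_add, X_anticomm h, map_zero]
    have h2 := divVar_rel i j k h
    have h3 := X_anticomm h
    ext a b
    fin_cases a <;> fin_cases b <;> simp [h1, h3]
    rw [← h2]; abel

/-- The `i`-th odd divided difference operator; it is determined by the two rules
`oddDiv_X` and `oddDiv_mul` below. -/
def oddDiv {n : ℕ} (i : Fin (n - 1)) : OPol n →ₗ[ℤ] OPol n where
  toFun f := divMatrix i f 0 1
  map_add' f g := by simp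
  map_smul' c f := by rw [map_zsmul]; rfl

theorem oddDiv_X {n : ℕ} (i : Fin (n - 1)) (j : Fin n) :
    oddDiv i (X j) = if j = lo i ∨ j = hi i then 1 else 0 := by
  simp [oddDiv, divMatrix, divVar]

theorem oddDiv_one {n : ℕ} (i : Fin (n - 1)) : oddDiv i (1 : OPol n) = 0 := by
  simp [oddDiv]

theorem divMatrix_entries {n : ℕ} (i : Fin (n - 1)) (f : OPol n) :
    divMatrix i f 0 0 = simpleAct i f ∧ divMatrix i f 1 0 = 0 ∧ divMatrix i f 1 1 = f := by
  obtain ⟨f, rfl⟩ := mkHom_surjective n f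
  induction f using FreeAlgebra.induction with
  | grade0 c => simp [← Matrix.diagonal_intCast]
  | grade1 j =>
    change divMatrix i (X j) 0 0 = simpleAct i (X j) ∧ divMatrix i (X j) 1 0 = 0 ∧
      divMatrix i (X j) 1 1 = X j
    simp [divMatrix]
  | mul g h hg hh => simp [Matrix.mul_apply, Fin.sum_univ_two, hg, hh]
  | add g h hg hh => simp [hg, hh]

theorem oddDiv_mul {n : ℕ} (i : Fin (n - 1)) (f g : OPol n) :
    oddDiv i (f * g) = oddDiv i f * g + simpleAct i f * oddDiv i g := by
  simp only [oddDiv, LinearMap.coe_mk, AddHom.coe_mk, map_mul, Matrix.mul_apply, Fin.sum_univ_two,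
    (divMatrix_entries i f).1, (divMatrix_entries i g).2.2]
  rw [add_comm]

/-- The longest odd divided difference operator
`∂_1 (∂_2 ∂_1) ⋯ (∂_{n-1} ⋯ ∂_1)` (a composition of operators). -/
def oddDivLongest (n : ℕ) : Module.End ℤ (OPol n) :=
  (((List.finRange (n - 1)).flatMap fun k =>
    ((List.finRange (n - 1)).filter fun i => decide (i ≤ k)).reverse).map
      fun i => (oddDiv i : Module.End ℤ (OPol n))).prod

/-! ### Odd symmetric polynomials and odd symmetric functions -/

/-- The ring of odd symmetric polynomials: the intersection of the kernels of the odd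
divided differences. -/
def OddSym (n : ℕ) : Subring (OPol n) where
  carrier := {f | ∀ i : Fin (n - 1), oddDiv i f = 0}
  mul_mem' hf hg i := by simp [oddDiv_mul, hf i, hg i]
  one_mem' i := oddDiv_one i
  add_mem' hf hg i := by simp [hf i, hg i]
  zero_mem' i := map_zero _
  neg_mem' hf i := by simp [hf i]

/-- The skew polynomials of word length at most `d`. -/
def degLE (n d : ℕ) : Submodule ℤ (OPol n) :=
  Submodule.span ℤ {f | ∃ w : List (Fin n), w.length ≤ d ∧ f = (w.map X).prod}

theorem degLE_mono (n : ℕ) {d e : ℕ} (h : d ≤ e) : degLE n d ≤ degLE n e :=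
  Submodule.span_mono fun _ ⟨w, hw, hf⟩ => ⟨w, hw.trans h, hf⟩

theorem degLE_mul {n d e : ℕ} {f g : OPol n} (hf : f ∈ degLE n d) (hg : g ∈ degLE n e) :
    f * g ∈ degLE n (d + e) := by
  have := Submodule.mul_mem_mul hf hg
  rw [degLE, degLE, Submodule.span_mul_span] at this
  refine Submodule.span_mono ?_ this
  rintro _ ⟨_, ⟨w, hw, rfl⟩, _, ⟨v, hv, rfl⟩, rfl⟩
  exact ⟨w ++ v, by simp; omega, by simp⟩

theorem degLE_one (n : ℕ) : (1 : OPol n) ∈ degLE n 0 :=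
  Submodule.subset_span ⟨[], by simp, by simp⟩

/-- The ring of odd symmetric functions: the inverse limit, in graded rings, of the rings of odd
symmetric polynomials along `x_n ↦ 0`. Its elements are the compatible sequences of odd symmetric
polynomials of bounded degree. -/
def OddSymFun : Subring (∀ n : ℕ, OPol n) where
  carrier := {f | (∀ n, f n ∈ OddSym n) ∧ (∀ n, trunc (n + 1) n (f (n + 1)) = f n) ∧
    ∃ d, ∀ n, f n ∈ degLE n d}
  mul_mem' := by
    rintro f g ⟨hf, hf', d, hd⟩ ⟨hg, hg', e, he⟩
    exact ⟨fun n => mul_mem (hf n) (hg n), fun n => by simp [hf', hg'],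
      d + e, fun n => degLE_mul (hd n) (he n)⟩
  one_mem' := ⟨fun n => one_mem _, fun n => by simp, 0, degLE_one⟩
  add_mem' := by
    rintro f g ⟨hf, hf', d, hd⟩ ⟨hg, hg', e, he⟩
    exact ⟨fun n => add_mem (hf n) (hg n), fun n => by simp [hf', hg'], max d e, fun n =>
      add_mem (degLE_mono n (le_max_left d e) (hd n)) (degLE_mono n (le_max_right d e) (he n))⟩
  zero_mem' := ⟨fun n => zero_mem _, fun n => by simp, 0, fun n => zero_mem _⟩
  neg_mem' := by
    rintro f ⟨hf, hf', d, hd⟩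
    exact ⟨fun n => neg_mem (hf n), fun n => by simp [hf'], d, fun n => neg_mem (hd n)⟩

open Classical in
/-- The odd complete symmetric polynomial `h_k` in `n` variables: the sum over all weakly
increasing sequences `i_1 ≤ ⋯ ≤ i_k` of the monomials in the signed variables. -/
def hsym (n k : ℕ) : OPol n :=
  ∑ i ∈ (Finset.univ : Finset (Fin k → Fin n)).filter Monotone,
    (List.ofFn fun p => xt n (i p)).prod

/-- The odd complete symmetric function `h_k`, as a sequence of polynomials. -/
def hsymFun (k : ℕ) : ∀ n : ℕ, OPol n := fun n => hsym n k

/-! ### Tableaux, signs and odd Kostka numbers -/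

/-- The row word of a tableau: rows from bottom to top, each row from left to right. -/
def rowWord {lam : YoungDiagram} (T : SemistandardYoungTableau lam) : List ℕ :=
  (List.range (lam.colLen 0)).reverse.flatMap fun i => (List.range (lam.rowLen i)).map (T i)

/-- The sign of a tableau: the sign of the permutation of minimal length (the stable sort) that
sorts its row word into non-decreasing order. -/
def tabSign {lam : YoungDiagram} (T : SemistandardYoungTableau lam) : ℤ :=
  (Equiv.Perm.sign (Tuple.sort (rowWord T).get) : ℤ)

/-- `dN`: for each box, the number of boxes in higher rows of the same column; summed up. -/
def dN (lam : YoungDiagram) : ℕ :=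
  ∑ c ∈ lam.cells, (lam.cells.filter fun b => b.1 < c.1 ∧ b.2 = c.2).card

/-- `N`: for each box, the number of boxes in higher rows; summed up. -/
def bigN (lam : YoungDiagram) : ℕ :=
  ∑ c ∈ lam.cells, (lam.cells.filter fun b => b.1 < c.1).card

/-- Semistandard tableaux of shape `lam` with entries in an alphabet of `n` letters. -/
def SSYT (lam : YoungDiagram) (n : ℕ) : Type :=
  {T : SemistandardYoungTableau lam // ∀ i j, (i, j) ∈ lam → T i j < n}

instance (lam : YoungDiagram) (n : ℕ) : Finite (SSYT lam n) := by
  let F : SSYT lam n → (lam.cells → Fin n) := fun T c =>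
    ⟨T.1 c.1.1 c.1.2, T.2 _ _ ((YoungDiagram.mem_cells _).1 c.2)⟩
  apply Finite.of_injective F
  intro T T' h
  apply Subtype.ext
  apply SemistandardYoungTableau.ext
  intro i j
  by_cases hij : (i, j) ∈ lam
  · have := congrFun h ⟨(i, j), (YoungDiagram.mem_cells _).2 hij⟩
    simpa [F] using this
  · rw [T.1.zeros hij, T'.1.zeros hij]

instance (lam : YoungDiagram) (n : ℕ) : Fintype (SSYT lam n) := Fintype.ofFinite _

/-- Semistandard tableaux of shape `lam` and content `mu`: the number of entries equal to the
`i`-th letter is the length of the `i`-th row of `mu`. -/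
def SSYTContent (lam mu : YoungDiagram) : Type :=
  {T : SemistandardYoungTableau lam //
    ∀ i, (lam.cells.filter fun c => T c.1 c.2 = i).card = mu.rowLen i}

instance (lam mu : YoungDiagram) : Finite (SSYTContent lam mu) := by
  have key : ∀ T : SSYTContent lam mu, ∀ i j, (i, j) ∈ lam → T.1 i j < mu.colLen 0 := by
    intro T i j hij
    rw [← YoungDiagram.mem_iff_lt_colLen, YoungDiagram.mem_iff_lt_rowLen, ← T.2, Finset.card_pos]
    exact ⟨(i, j), by simp [hij]⟩
  let F : SSYTContent lam mu → SSYT lam (mu.colLen 0) := fun T => ⟨T.1, key T⟩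
  apply Finite.of_injective F
  intro T T' h
  have h' := congrArg Subtype.val h
  exact Subtype.ext h'

instance (lam mu : YoungDiagram) : Fintype (SSYTContent lam mu) := Fintype.ofFinite _

/-- The odd Kostka number `K_{lam,mu}`. Here `highestWeight lam` is the tableau whose shape and
content are both equal to `lam` (all boxes in the `i`-th row contain the `i`-th letter). -/
def oddKostka (lam mu : YoungDiagram) : ℤ :=
  tabSign (SemistandardYoungTableau.highestWeight lam) *
    ∑ T : SSYTContent lam mu, tabSign T.1

/-- Partitions of `k`, as Young diagrams with `k` boxes. -/
abbrev Part (k : ℕ) : Type := {lam : YoungDiagram // lam.card = k}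

instance (k : ℕ) : Finite (Part k) := by
  let F : Part k → (Finset.range k ×ˢ Finset.range k).powerset := fun lam =>
    ⟨lam.1.cells, by
      rw [Finset.mem_powerset]
      rintro ⟨i, j⟩ hc
      have hc' : (i, j) ∈ lam.1 := (YoungDiagram.mem_cells _).1 hc
      have h0 := lam.2
      have h1 : lam.1.colLen j ≤ k := by
        rw [YoungDiagram.colLen_eq_card]; exact (Finset.card_filter_le _ _).trans h0.le
      have h2 : lam.1.rowLen i ≤ k := by
        rw [YoungDiagram.rowLen_eq_card]; exact (Finset.card_filter_le _ _).trans h0.le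
      have h3 := YoungDiagram.mem_iff_lt_colLen.1 hc'
      have h4 := YoungDiagram.mem_iff_lt_rowLen.1 hc'
      simp only [Finset.mem_product, Finset.mem_range]
      omega⟩
  apply Finite.of_injective F
  intro a b h
  have h' : a.1.cells = b.1.cells := congrArg Subtype.val h
  exact Subtype.ext (YoungDiagram.ext h')

instance (k : ℕ) : Fintype (Part k) := Fintype.ofFinite _

instance (k : ℕ) : DecidableEq (Part k) := Classical.decEq _

/-- The matrix of odd Kostka numbers of partitions of `k`. -/
def kostkaMatrix (k : ℕ) : Matrix (Part k) (Part k) ℤ :=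
  Matrix.of fun lam mu => oddKostka lam.1 mu.1

/-- `h_mu = h_{mu_1} ⋯ h_{mu_r}` for a sequence `h` of elements of a ring. -/
def hPart {R : Type} [Ring R] (h : ℕ → R) (mu : YoungDiagram) : R := (mu.rowLens.map h).prod

/-! ### The three odd Schur functions -/

/-- The combinatorial (Kostka) odd Schur functions: the solution
`s_lam = ∑_mu (K⁻¹)_{mu,lam} h_mu` of the change of basis relation
`h_mu = ∑_lam K_{lam,mu} s_lam`, see `kostkaSchur_unique`. -/
def kostkaSchur {R : Type} [Ring R] (h : ℕ → R) (lam : YoungDiagram) : R :=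
  ∑ mu : Part lam.card, (kostkaMatrix lam.card)⁻¹ mu ⟨lam, rfl⟩ • hPart h mu.1

/-- If the matrix of odd Kostka numbers is unimodular, then the combinatorial odd Schur functions
are the one and only solution of the change of basis relation. -/
theorem kostkaSchur_unique {R : Type} [Ring R] (h : ℕ → R) (k : ℕ)
    (hK : IsUnit (kostkaMatrix k).det) (s : Part k → R) :
    (∀ mu : Part k, hPart h mu.1 = ∑ lam : Part k, oddKostka lam.1 mu.1 • s lam) ↔
      ∀ lam : Part k, s lam = kostkaSchur h lam.1 := by
  have e : ∀ lam : Part k, kostkaSchur h lam.1 =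
      ∑ mu : Part k, (kostkaMatrix k)⁻¹ mu lam • hPart h mu.1 := by
    rintro ⟨lam, rfl⟩; rfl
  simp only [e]
  constructor
  · intro H lam
    simp only [H, Finset.smul_sum, smul_smul]
    rw [Finset.sum_comm]
    have h1 := Matrix.mul_nonsing_inv _ hK
    have h2 : ∀ nu : Part k, ∑ mu : Part k, ((kostkaMatrix k)⁻¹ mu lam * oddKostka nu.1 mu.1) • s nu
        = (if nu = lam then (1 : ℤ) else 0) • s nu := by
      intro nu
      rw [← Finset.sum_smul]
      have := congrFun (congrFun h1 nu) lam
      rw [Matrix.mul_apply, Matrix.one_apply] at this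
      rw [← this]
      congr 1
      exact Finset.sum_congr rfl fun _ _ => mul_comm _ _
    simp only [← Finset.sum_smul] at h2 ⊢
    simp only [h2, ite_smul, one_smul, zero_smul, Finset.sum_ite_eq', Finset.mem_univ, if_true]
  · intro H mu
    simp only [H, Finset.smul_sum, smul_smul]
    rw [Finset.sum_comm]
    have h1 := Matrix.nonsing_inv_mul _ hK
    have h2 : ∀ nu : Part k,
        ∑ lam : Part k, (oddKostka lam.1 mu.1 * (kostkaMatrix k)⁻¹ nu lam) • hPart h nu.1
        = (if nu = mu then (1 : ℤ) else 0) • hPart h nu.1 := by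
      intro nu
      rw [← Finset.sum_smul]
      have := congrFun (congrFun h1 nu) mu
      rw [Matrix.mul_apply, Matrix.one_apply] at this
      rw [← this]
      congr 1
      exact Finset.sum_congr rfl fun _ _ => mul_comm _ _
    simp only [← Finset.sum_smul] at h2 ⊢
    simp only [h2, ite_smul, one_smul, zero_smul, Finset.sum_ite_eq', Finset.mem_univ, if_true]

/-- The combinatorial odd Schur polynomial in `n` variables. -/
def schurK (n : ℕ) (lam : YoungDiagram) : OPol n := kostkaSchur (hsym n) lam

/-- The plactic odd Schur polynomial in `n` variables. -/
def schurP (n : ℕ) (lam : YoungDiagram) : OPol n :=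
  (-1) ^ (dN lam + bigN lam) * ∑ T : SSYT lam n, xtWord n (rowWord T.1)

/-- The odd-symmetrized Schur polynomial in `n` variables
`(-1)^{n choose 3} (∂_{w_0} (x_1^{λ_1} ⋯ x_n^{λ_n} x_1^{n-1} x_2^{n-2} ⋯ x_{n-1}))^{w_0}`,
for partitions with at most `n` rows. -/
def schurS (n : ℕ) (lam : YoungDiagram) : OPol n :=
  (-1) ^ (n.choose 3) * permAct Fin.revPerm (oddDivLongest n
    ((List.ofFn fun i : Fin n => X i ^ lam.rowLen i).prod *
      (List.ofFn fun i : Fin n => X i ^ (n - 1 - (i : ℕ))).prod))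

/-- The combinatorial odd Schur function, as a sequence of polynomials. -/
def schurKFun (lam : YoungDiagram) : ∀ n : ℕ, OPol n := kostkaSchur hsymFun lam

/-- The plactic odd Schur function, as a sequence of polynomials. -/
def schurPFun (lam : YoungDiagram) : ∀ n : ℕ, OPol n := fun n => schurP n lam

/-- The odd-symmetrized Schur function, as a sequence of polynomials. In fewer variables than
`lam` has rows, it is the image of the polynomial in as many variables as `lam` has rows. -/
def schurSFun (lam : YoungDiagram) : ∀ n : ℕ, OPol n := fun n =>
  if lam.colLen 0 ≤ n then schurS n lam else trunc (lam.colLen 0) n (schurS (lam.colLen 0) lam)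

end OddSchur

end

noncomputable section

namespace OddSchur

open Finset

/-! ### Signs -/

/-! The proof rests on two Pieri rules for the polynomials P_l (`tabPoly`) that sum the row words of
the tableaux of shape l. In anticommuting letters a row word equals the sign of its tableau times an
ordered monomial in the content. Hence P_l and the odd Kostka numbers are both signed sums over
chains of horizontal strips (`patternSum`, `sum_SSYT_eq_patternSum`).

Kostka equals plactic. The product P_l h_d expands over the horizontal strips on l
(`tabPoly_mul_complSym`). The proof is an induction on the number of variables: the two ways of
removing the largest letter are matched by the local growth rule of the RSK correspondence, and all
signs are settled by one telescoping parity identity (`growth_parity_aux`). Iterating the rule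
expands h_mu in the normalized P_l with the odd Kostka numbers as coefficients (`hPart_eq_sum`). The
Kostka matrix is unitriangular for the lexicographic order (`isUnit_det_kostkaMatrix`), so this
expansion determines the family (`kostkaSchur_unique`).

Plactic equals symmetrized. The relation between elementary and complete polynomials turns the first
Pieri rule, by a sign-reversing involution, into a rule for P_l e_k (`tabPoly_mul_elemSym`). On the
other side, the longest divided difference is right linear over odd symmetric polynomials, and the
longest permutation multiplies e_k by a sign. So e_k times a symmetrized monomial is computed by
multiplying the monomial itself by e_k; the terms that are not partitions have two equal adjacent
exponents and are annihilated. After normalization both families satisfy the same `PieriRule` and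
equal 1 on the empty partition, and such a family is unique (`PieriRule.unique`).

For odd symmetric functions, the Kostka version is a fixed integral combination of products of the
h_k, so it inherits from them odd symmetry, bounded degree and compatibility with truncation; the
other two versions are identified with it in each number of variables. -/

theorem neg_one_pow_eq_of_natCast_eq {a b : ℕ} (h : (a : ZMod 2) = b) :
    (-1 : ℤ) ^ a = (-1) ^ b := by
  have h1 : a % 2 = b % 2 := (ZMod.natCast_eq_natCast_iff' a b 2).1 h
  rw [neg_one_pow_eq_pow_mod_two, h1, ← neg_one_pow_eq_pow_mod_two]

theorem neg_one_pow_eq_of_natCast_eq_add_one {a b : ℕ} (h : (a : ZMod 2) = b + 1) :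
    (-1 : ℤ) ^ a = -(-1) ^ b := by
  rw [neg_one_pow_eq_of_natCast_eq (b := b + 1) (by simpa using h), pow_succ]
  simp

theorem neg_one_pow_mul_self (a : ℕ) : (-1 : ℤ) ^ a * (-1) ^ a = 1 := by
  rw [← mul_pow]; simp

/-! ### Finitely supported sequences as (generalized) partitions -/

/-- The sequence with its first term removed. -/
def tail (l : ℕ →₀ ℕ) : ℕ →₀ ℕ := l.comapDomain Nat.succ Nat.succ_injective.injOn

@[simp] theorem tail_apply (l : ℕ →₀ ℕ) (i : ℕ) : tail l i = l (i + 1) := rfl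

/-- The sequence with a new first term. -/
def cons (a : ℕ) (l : ℕ →₀ ℕ) : ℕ →₀ ℕ :=
  Finsupp.onFinset (insert 0 (l.support.image Nat.succ)) (fun i => Nat.casesOn i a l) (by
    rintro (_ | i) h
    · simp
    · simpa using h)

@[simp] theorem cons_zero (a : ℕ) (l : ℕ →₀ ℕ) : cons a l 0 = a := rfl

@[simp] theorem cons_succ (a : ℕ) (l : ℕ →₀ ℕ) (i : ℕ) : cons a l (i + 1) = l i := rfl

theorem cons_tail (l : ℕ →₀ ℕ) : cons (l 0) (tail l) = l := by
  ext i; cases i <;> simp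

theorem exists_bound (l : ℕ →₀ ℕ) : ∃ L, ∀ i, L ≤ i → l i = 0 := by
  refine ⟨l.support.sup id + 1, fun i hi => ?_⟩
  by_contra h
  have := Finset.le_sup (f := id) (Finsupp.mem_support_iff.2 h)
  simp only [id] at this
  omega

theorem sum_eq_sum_range_of_bound {M : Type*} [AddCommMonoid M] (s : Finset ℕ) (f : ℕ → M) (L : ℕ)
    (h1 : ∀ i ∉ s, f i = 0) (h2 : ∀ i, L ≤ i → f i = 0) : ∑ i ∈ s, f i = ∑ i ∈ range L, f i := by
  have a : ∑ i ∈ s, f i = ∑ i ∈ s ∪ range L, f i :=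
    sum_subset subset_union_left fun i _ hi => h1 i hi
  have b : ∑ i ∈ range L, f i = ∑ i ∈ s ∪ range L, f i :=
    sum_subset subset_union_right fun i _ hi => h2 i (by simpa using hi)
  rw [a, b]

theorem degree_eq_sum_range {l : ℕ →₀ ℕ} {L : ℕ} (h : ∀ i, L ≤ i → l i = 0) :
    l.degree = ∑ i ∈ range L, l i := by
  rw [Finsupp.degree_apply]
  exact sum_eq_sum_range_of_bound _ _ _ (fun i hi => by simpa using hi) h

theorem degree_cons (a : ℕ) (l : ℕ →₀ ℕ) : (cons a l).degree = a + l.degree := by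
  obtain ⟨L, hL⟩ := exists_bound l
  rw [degree_eq_sum_range hL, degree_eq_sum_range (L := L + 1), sum_range_succ', add_comm]
  · simp
  · rintro (_ | i) hi
    · omega
    · exact hL i (by omega)

theorem degree_tail (l : ℕ →₀ ℕ) : l.degree = l 0 + (tail l).degree := by
  rw [← degree_cons, cons_tail]

theorem degree_sup_add_inf (l k : ℕ →₀ ℕ) :
    (l ⊔ k).degree + (l ⊓ k).degree = l.degree + k.degree := by
  rw [← map_add, ← map_add]
  congr 1
  ext i
  simp only [Finsupp.add_apply, Finsupp.sup_apply, Finsupp.inf_apply]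
  omega

theorem degree_sub {l k : ℕ →₀ ℕ} (h : k ≤ l) : (l - k).degree + k.degree = l.degree := by
  rw [← map_add, tsub_add_cancel_of_le h]

theorem degree_le {l k : ℕ →₀ ℕ} (h : k ≤ l) : k.degree ≤ l.degree := by
  have := degree_sub h
  omega

/-- The sum of the row indices of the boxes. -/
def rowStat (l : ℕ →₀ ℕ) : ℕ := ∑ i ∈ l.support, i * l i

theorem rowStat_eq_sum_range {l : ℕ →₀ ℕ} {L : ℕ} (h : ∀ i, L ≤ i → l i = 0) :
    rowStat l = ∑ i ∈ range L, i * l i :=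
  sum_eq_sum_range_of_bound _ _ _ (fun i hi => by simp at hi; simp [hi]) fun i hi =>
    by simp [h i hi]

/-- For a skew shape, a number with the parity of the number of pairs of a box of the skew shape
`k / l` and a box of `l` in a higher row. -/
def crossings (k l : ℕ →₀ ℕ) : ℕ :=
  ∑ i ∈ k.support ∪ l.support, (k i + l i) * ∑ j ∈ range i, l j

theorem crossings_eq_sum_range {k l : ℕ →₀ ℕ} {L : ℕ} (hk : ∀ i, L ≤ i → k i = 0)
    (hl : ∀ i, L ≤ i → l i = 0) :
    crossings k l = ∑ i ∈ range L, (k i + l i) * ∑ j ∈ range i, l j :=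
  sum_eq_sum_range_of_bound _ _ _
    (fun i hi => by simp only [mem_union, not_or, Finsupp.notMem_support_iff] at hi; simp [hi])
    fun i hi => by simp [hk i hi, hl i hi]

theorem crossings_self_zero (l : ℕ →₀ ℕ) : crossings l 0 = 0 := by
  simp [crossings]

/-- The parity count behind the local growth rule. -/
theorem growth_parity_aux (l v u k p q : ℕ → ZMod 2) (hs : ∀ i, l i + v i = p i + q i)
    (hp : ∀ i, l i * v i = p i * q i) (hk : ∀ i, k (i + 1) = q (i + 1) + p i + u i) (L : ℕ) :
    (∑ i ∈ range (L + 1), ((i : ZMod 2) * (l i + v i + u i + k i)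
      + (l i + u i) * ∑ j ∈ range i, u j + (v i + u i) * ∑ j ∈ range i, u j
      + (k i + l i) * ∑ j ∈ range i, l j + (k i + v i) * ∑ j ∈ range i, v j))
      + (∑ i ∈ range (L + 1), (l i + u i)) * ∑ i ∈ range (L + 1), (v i + u i)
    = (p L + u L) * (L + 1 + ∑ i ∈ range (L + 1), (l i + v i)) := by
  have two : (2 : ZMod 2) = 0 := rfl
  have sq : ∀ a : ZMod 2, a * a = a := by decide
  -- The right-hand side is the truncation defect: row L contributes p L + u L to k (L + 1), which
  -- lies beyond the cut. The value k 0 is unconstrained because it only occurs with coefficient 0.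
  induction L with
  | zero =>
    simp only [zero_add, sum_range_one, range_zero, sum_empty]
    push_cast
    have hq : q 0 = l 0 + v 0 - p 0 := by linear_combination -hs 0
    have h3 := hp 0
    rw [hq] at h3
    linear_combination h3 - sq (p 0) + sq (u 0) - p 0 * two
  | succ L ih =>
    rw [sum_range_succ, sum_range_succ (fun i => l i + u i), sum_range_succ (fun i => v i + u i),
      sum_range_succ (fun i => l i + v i)]
    simp only [sum_add_distrib (f := l), sum_add_distrib (f := v)] at ih ⊢
    push_cast
    generalize (∑ i ∈ range (L + 1), _ : ZMod 2) = E at *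
    generalize ∑ i ∈ range (L + 1), l i = Λ at *
    generalize ∑ i ∈ range (L + 1), v i = N at *
    generalize ∑ i ∈ range (L + 1), u i = U at *
    have h1 := hk L
    have h2 := hs (L + 1)
    have h3 := hp (L + 1)
    have hq : q (L + 1) = l (L + 1) + v (L + 1) - p (L + 1) := by linear_combination -h2
    rw [hq] at h1 h3
    rw [h1]
    linear_combination ih + h3 - sq (p (L + 1)) + sq (u (L + 1)) +
      ((L + 1 + Λ + N) * (l (L + 1) + v (L + 1) - p (L + 1) + p L + u L)
        + U * (l (L + 1) + v (L + 1) + 2 * u (L + 1)) - p (L + 1)) * two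


/-! ### Anticommuting variables -/

section AntiComm

variable {R : Type*} [Ring R]

/-- The ordered monomial `y_0 ^ c_0 ⋯ y_{m-1} ^ c_{m-1}`. -/
def monomial (y : ℕ → R) : ℕ → (ℕ → ℕ) → R
  | 0, _ => 1
  | m + 1, c => monomial y m c * y m ^ c m

/-- The elementary polynomial: the sum of all strictly increasing words of length `k` in
`y_0, …, y_{m-1}`. -/
def elemSym (y : ℕ → R) : ℕ → ℕ → R
  | _, 0 => 1
  | 0, _ + 1 => 0
  | m + 1, k + 1 => elemSym y m (k + 1) + elemSym y m k * y m

/-- The sum of all strictly decreasing words of length `k` in `y_0, …, y_{m-1}`. -/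
def elemSymRev (y : ℕ → R) : ℕ → ℕ → R
  | _, 0 => 1
  | 0, _ + 1 => 0
  | m + 1, k + 1 => elemSymRev y m (k + 1) + y m * elemSymRev y m k

/-- The complete polynomial: the sum of all weakly increasing words of length `k` in
`y_0, …, y_{m-1}`. -/
def complSym (y : ℕ → R) : ℕ → ℕ → R
  | _, 0 => 1
  | 0, _ + 1 => 0
  | m + 1, k + 1 => complSym y m (k + 1) + complSym y (m + 1) k * y m

@[simp] theorem elemSym_zero_right (y : ℕ → R) (m : ℕ) : elemSym y m 0 = 1 := by
  cases m <;> rfl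

@[simp] theorem elemSymRev_zero_right (y : ℕ → R) (m : ℕ) : elemSymRev y m 0 = 1 := by
  cases m <;> rfl

@[simp] theorem complSym_zero_right (y : ℕ → R) (m : ℕ) : complSym y m 0 = 1 := by
  cases m <;> rw [complSym]

theorem complSym_zero_left (y : ℕ → R) (k : ℕ) : complSym y 0 k = if k = 0 then 1 else 0 := by
  cases k <;> simp [complSym]

theorem elemSymRev_zero_left (y : ℕ → R) (k : ℕ) :
    elemSymRev y 0 k = if k = 0 then 1 else 0 := by
  cases k <;> simp [elemSymRev]

theorem complSym_succ_left (y : ℕ → R) (m k : ℕ) :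
    complSym y (m + 1) k = ∑ p ∈ antidiagonal k, complSym y m p.1 * y m ^ p.2 := by
  induction k with
  | zero => simp
  | succ k ih =>
    rw [complSym, ih, Nat.sum_antidiagonal_succ', sum_mul]
    simp [pow_succ, mul_assoc]

/-- The words in `y_0, …, y_{m-1}` decreasing up to a point and weakly increasing afterwards
cancel in pairs. -/
theorem sum_elemSymRev_mul_complSym (y : ℕ → R) (m k : ℕ) :
    ∑ p ∈ antidiagonal k, (-1 : ℤ) ^ p.1 • (elemSymRev y m p.1 * complSym y m p.2) =
      if k = 0 then 1 else 0 := by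
  induction m generalizing k with
  | zero =>
    cases k with
    | zero => simp
    | succ k =>
      rw [if_neg (by omega)]
      refine sum_eq_zero fun p hp => ?_
      rw [HasAntidiagonal.mem_antidiagonal] at hp
      rw [elemSymRev_zero_left, complSym_zero_left]
      split_ifs <;> first | omega | simp
  | succ m ih =>
    -- In generating functions: H_{m+1}(t) = H_m(t) (1 - y_m t)⁻¹, so E_m(-t) H_m(t) = 1 yields
    -- E_m(-t) H_{m+1}(t) = (1 - y_m t)⁻¹. The new factor 1 - y_m t of E_{m+1}(-t) stands on the
    -- left and cancels this. No commutation of the variables is needed.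
    have key : ∀ k, ∑ p ∈ antidiagonal k,
        (-1 : ℤ) ^ p.1 • (elemSymRev y m p.1 * complSym y (m + 1) p.2) = y m ^ k := by
      intro k
      induction k with
      | zero => simp
      | succ k ihk =>
        have h := ih (k + 1)
        rw [Nat.sum_antidiagonal_succ'] at h ⊢
        simp only [complSym_zero_right, complSym, mul_add, smul_add, sum_add_distrib] at h ⊢
        rw [if_neg (by omega)] at h
        rw [← add_assoc, h, zero_add, pow_succ, ← ihk, sum_mul]
        simp [mul_assoc]
    cases k with
    | zero => simp
    | succ k =>
      have h := key (k + 1)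
      rw [Nat.sum_antidiagonal_succ] at h ⊢
      simp only [elemSymRev_zero_right, elemSymRev, add_mul, smul_add, sum_add_distrib] at h ⊢
      rw [← add_assoc, h, if_neg (by omega), pow_succ', ← key, mul_sum, ← sum_add_distrib]
      refine sum_eq_zero fun p _ => ?_
      rw [mul_smul_comm, pow_succ, mul_neg_one, neg_smul, mul_assoc, add_neg_cancel]

variable {y : ℕ → R}

theorem pow_anticomm_aux {a b : R} (h : a * b = -(b * a)) (k : ℕ) :
    b ^ k * a = (-1 : ℤ) ^ k • (a * b ^ k) := by
  induction k with
  | zero => simp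
  | succ k ih =>
    have h' : b * a = -(a * b) := by rw [h, neg_neg]
    rw [pow_succ, mul_assoc, h', mul_neg, ← mul_assoc, ih]
    simp [pow_succ, mul_assoc]

/-- If `a` anticommutes with the first `m` variables, it moves past a monomial. -/
theorem monomial_mul_of_anticomm {a : R} {m : ℕ} (h : ∀ i < m, y i * a = -(a * y i))
    (c : ℕ → ℕ) :
    monomial y m c * a = (-1 : ℤ) ^ (∑ i ∈ range m, c i) • (a * monomial y m c) := by
  induction m with
  | zero => simp [monomial]
  | succ m ih =>
    have h' : a * y m = -(y m * a) := by rw [h m (by omega), neg_neg]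
    rw [monomial, mul_assoc, pow_anticomm_aux h', mul_smul_comm, ← mul_assoc,
      ih fun i hi => h i (by omega), sum_range_succ, pow_add, smul_mul_assoc, smul_smul, mul_assoc,
      mul_comm ((-1 : ℤ) ^ _)]

theorem elemSym_mul_of_anticomm {a : R} {m : ℕ} (h : ∀ i < m, y i * a = -(a * y i)) (k : ℕ) :
    elemSym y m k * a = (-1 : ℤ) ^ k • (a * elemSym y m k) := by
  induction m generalizing k with
  | zero => cases k <;> simp [elemSym]
  | succ m ih =>
    cases k with
    | zero => simp
    | succ k =>
      rw [elemSym, add_mul, mul_assoc, h m (by omega), mul_neg, ← mul_assoc,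
        ih (fun i hi => h i (by omega)), ih (fun i hi => h i (by omega)), mul_add, smul_add,
          pow_succ]
      simp [mul_assoc]

theorem complSym_mul_of_anticomm {a : R} {m : ℕ} (h : ∀ i < m, y i * a = -(a * y i)) (k : ℕ) :
    complSym y m k * a = (-1 : ℤ) ^ k • (a * complSym y m k) := by
  induction m generalizing k with
  | zero => cases k <;> simp [complSym]
  | succ m ih =>
    induction k with
    | zero => simp
    | succ k ihk =>
      rw [complSym, add_mul, mul_assoc, h m (by omega), mul_neg, ← mul_assoc,
        ih (fun i hi => h i (by omega)), ihk, mul_add, smul_add, pow_succ]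
      simp [mul_assoc]

/-- Reversing a word of k distinct anticommuting letters costs one sign for each of its k(k-1)/2
pairs. -/
theorem elemSymRev_eq (hy : ∀ a b, a ≠ b → y a * y b = -(y b * y a)) (m k : ℕ) :
    elemSymRev y m k = (-1 : ℤ) ^ k.choose 2 • elemSym y m k := by
  induction m generalizing k with
  | zero => cases k <;> simp [elemSym, elemSymRev]
  | succ m ih =>
    cases k with
    | zero => simp
    | succ k =>
      rw [elemSymRev, elemSym, ih, ih, elemSym_mul_of_anticomm fun i hi => hy _ _ (by omega),
        smul_add, Nat.choose_succ_succ' k 1, Nat.choose_one_right, add_comm k, pow_add,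
          mul_smul_comm,
        smul_smul, mul_assoc, neg_one_pow_mul_self, mul_one]

/-- Moving a variable into a monomial from the left. -/
theorem mul_monomial (hy : ∀ a b, a ≠ b → y a * y b = -(y b * y a)) {m a : ℕ} (ha : a < m)
    (c : ℕ → ℕ) :
    y a * monomial y m c =
      (-1 : ℤ) ^ (∑ i ∈ range a, c i) • monomial y m (Function.update c a (c a + 1)) := by
  induction m with
  | zero => omega
  | succ m ih =>
    have hc : ∀ n ≤ a, monomial y n (Function.update c a (c a + 1)) = monomial y n c := by
      intro n
      induction n with
      | zero => intro _; rfl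
      | succ n ihn => intro hn; rw [monomial, monomial, ihn (by omega),
        Function.update_of_ne (by omega)]
    rcases Nat.lt_succ_iff_lt_or_eq.1 ha with h | rfl
    · rw [monomial, ← mul_assoc, ih h, monomial, Function.update_of_ne (by omega), smul_mul_assoc]
    · rw [monomial, monomial, hc a le_rfl, Function.update_self, pow_succ', ← mul_assoc,
        ← mul_assoc,
        monomial_mul_of_anticomm fun i hi => hy _ _ (by omega), smul_mul_assoc, smul_smul,
        neg_one_pow_mul_self, one_smul]

/-- Moving a variable into a monomial from the right. -/
theorem monomial_mul (hy : ∀ a b, a ≠ b → y a * y b = -(y b * y a)) {m a : ℕ} (ha : a < m)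
    (c : ℕ → ℕ) :
    monomial y m c * y a =
      (-1 : ℤ) ^ (∑ i ∈ Ico (a + 1) m, c i) • monomial y m (Function.update c a (c a + 1)) := by
  induction m with
  | zero => omega
  | succ m ih =>
    have hc : ∀ n ≤ a, monomial y n (Function.update c a (c a + 1)) = monomial y n c := by
      intro n
      induction n with
      | zero => intro _; rfl
      | succ n ihn => intro hn; rw [monomial, monomial, ihn (by omega),
        Function.update_of_ne (by omega)]
    rcases Nat.lt_succ_iff_lt_or_eq.1 ha with h | rfl
    · rw [monomial, mul_assoc, pow_anticomm_aux (hy _ _ (by omega)), mul_smul_comm, ← mul_assoc,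
        ih h,
        monomial, Function.update_of_ne (by omega), smul_mul_assoc, smul_smul,
        sum_Ico_succ_top (by omega), pow_add, mul_comm]
    · rw [monomial, monomial, hc a le_rfl, Function.update_self, pow_succ, ← mul_assoc]
      simp

end AntiComm

/-! ### Sums over Gelfand–Tsetlin patterns -/

/-- The signed sum over chains of partitions ending in `l`, each a horizontal strip over the
preceding one, of the values of `f` at the sizes of the strips. -/
def patternSum {M : Type*} [AddCommGroup M] : ℕ → (ℕ →₀ ℕ) → ((ℕ → ℕ) → M) → M
  | 0, l, f => if l = 0 then f 0 else 0
  | m + 1, l, f => ∑ u ∈ Icc (tail l) l, (-1 : ℤ) ^ crossings l u •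
      patternSum m u fun c => f (Function.update c m (l.degree - u.degree))

theorem patternSum_map {M N : Type*} [AddCommGroup M] [AddCommGroup N] (g : M →+ N) (m : ℕ)
    (l : ℕ →₀ ℕ) (f : (ℕ → ℕ) → M) :
    patternSum m l (fun c => g (f c)) = g (patternSum m l f) := by
  induction m generalizing l f with
  | zero => simp only [patternSum]; split_ifs <;> simp
  | succ m ih => simp only [patternSum, map_sum, map_zsmul, ih]

section Tableau

variable {R : Type*} [Ring R]

/-- The sum of the row words of the tableaux of shape `l` in `m` anticommuting letters. -/
def tabPoly (y : ℕ → R) (m : ℕ) (l : ℕ →₀ ℕ) : R := patternSum m l (monomial y m)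

theorem monomial_congr (y : ℕ → R) {m : ℕ} {c d : ℕ → ℕ} (h : ∀ i < m, c i = d i) :
    monomial y m c = monomial y m d := by
  induction m with
  | zero => rfl
  | succ m ih => rw [monomial, monomial, ih fun i hi => h i (by omega), h m (by omega)]

theorem tabPoly_zero (y : ℕ → R) (l : ℕ →₀ ℕ) : tabPoly y 0 l = if l = 0 then 1 else 0 := rfl

/-- The branching rule. The entries below the largest letter form a shape u with `tail l ≤ u ≤ l`,
which says that l / u is a horizontal strip. In the row word each largest letter is followed by the
smaller letters of the rows above it, and moving it to the right end past them gives the sign with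
exponent `crossings l u`. -/
theorem tabPoly_succ (y : ℕ → R) (m : ℕ) (l : ℕ →₀ ℕ) :
    tabPoly y (m + 1) l = ∑ u ∈ Icc (tail l) l,
      (-1 : ℤ) ^ crossings l u • (tabPoly y m u * y m ^ (l.degree - u.degree)) := by
  rw [tabPoly, patternSum]
  refine sum_congr rfl fun u _ => ?_
  congr 1
  have : (fun c => monomial y (m + 1) (Function.update c m (l.degree - u.degree))) =
      fun c => AddMonoidHom.mulRight (y m ^ (l.degree - u.degree)) (monomial y m c) := by
    funext c
    rw [monomial, Function.update_self, monomial_congr y (d := c)]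
    · rfl
    · intro i hi
      rw [Function.update_of_ne (by omega)]
  rw [this, patternSum_map]
  rfl

/-! ### The Pieri rule for complete polynomials -/

/-- The sequences `k` such that `k / l` is a horizontal strip with `d` boxes. -/
def horizStrips (l : ℕ →₀ ℕ) (d : ℕ) : Finset (ℕ →₀ ℕ) :=
  (Icc l (cons (l 0 + d) l)).filter fun k => k.degree = l.degree + d

/-- The upper bound in the definition only serves to make the set finite: since no row shrinks, the
first row gains at most d boxes. -/
theorem mem_horizStrips {l k : ℕ →₀ ℕ} {d : ℕ} :
    k ∈ horizStrips l d ↔ l ≤ k ∧ tail k ≤ l ∧ k.degree = l.degree + d := by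
  simp only [horizStrips, mem_filter, mem_Icc]
  constructor
  · rintro ⟨⟨h1, h2⟩, h3⟩
    exact ⟨h1, fun i => h2 (i + 1), h3⟩
  · rintro ⟨h1, h2, h3⟩
    refine ⟨⟨h1, ?_⟩, h3⟩
    rintro (_ | i)
    · have a := degree_tail k
      have b := degree_tail l
      have c : (tail l).degree ≤ (tail k).degree := degree_le fun i => h1 (i + 1)
      rw [cons_zero]
      omega
    · exact h2 i

/-- The local growth rule: from `u` with horizontal strips `l / u`, `v / u` and a number `j`
to the partition completing the square. -/
def growth (l v u : ℕ →₀ ℕ) (j : ℕ) : ℕ →₀ ℕ := (l ⊔ v) + cons j (l ⊓ v - u)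

/-- The inverse of the local growth rule. -/
def shrink (l v k : ℕ →₀ ℕ) : ℕ →₀ ℕ := l ⊓ v - (tail k - tail (l ⊔ v))

theorem growth_zero (l v u : ℕ →₀ ℕ) (j : ℕ) : growth l v u j 0 = max (l 0) (v 0) + j := rfl

theorem growth_succ (l v u : ℕ →₀ ℕ) (j i : ℕ) :
    growth l v u j (i + 1) = max (l (i + 1)) (v (i + 1)) + (min (l i) (v i) - u i) := rfl

theorem shrink_apply (l v k : ℕ →₀ ℕ) (i : ℕ) :
    shrink l v k i = min (l i) (v i) - (k (i + 1) - max (l (i + 1)) (v (i + 1))) := rfl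

theorem degree_growth {l v u : ℕ →₀ ℕ} (j : ℕ) (h : u ≤ l ⊓ v) :
    (growth l v u j).degree + u.degree = l.degree + v.degree + j := by
  have a := degree_sub h
  have b := degree_sup_add_inf l v
  rw [growth, map_add, degree_cons]
  omega

/-- Compares the signs on the two sides of the inductive step of the Pieri rule. On the left:
removing the largest letters of l, moving them past a complete polynomial of degree |v / u|, and
applying the rule in one variable less to u and v. On the right: applying the rule to l and k =
`growth l v u j`, then removing the largest letters of k to reach v. The number j only affects the
first row of k, which contributes to none of these parities. -/
theorem growth_sign {l v u : ℕ →₀ ℕ} (j : ℕ) (hl : u ≤ l) (hv : u ≤ v) :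
    (-1 : ℤ) ^ (crossings l u + (l.degree - u.degree) * (v.degree - u.degree) +
      (crossings v u + rowStat v + rowStat u)) =
    (-1) ^ (crossings (growth l v u j) l + rowStat (growth l v u j) + rowStat l +
      crossings (growth l v u j) v) := by
  have two : (2 : ZMod 2) = 0 := rfl
  set k := growth l v u j with hk
  obtain ⟨L1, h1⟩ := exists_bound l
  obtain ⟨L2, h2⟩ := exists_bound v
  obtain ⟨L3, h3⟩ := exists_bound k
  obtain ⟨L, hL⟩ : ∃ L, L = L1 + L2 + L3 := ⟨_, rfl⟩
  have hlz : ∀ i, L ≤ i → l i = 0 := fun i hi => h1 i (by omega)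
  have hvz : ∀ i, L ≤ i → v i = 0 := fun i hi => h2 i (by omega)
  have hkz : ∀ i, L ≤ i → k i = 0 := fun i hi => h3 i (by omega)
  have huz : ∀ i, L ≤ i → u i = 0 := fun i hi => by have := hl i; have := hlz i hi; omega
  have up : ∀ {w : ℕ →₀ ℕ}, (∀ i, L ≤ i → w i = 0) → ∀ i, L + 1 ≤ i → w i = 0 :=
    fun h i hi => h i (by omega)
  have key := growth_parity_aux (fun i => (l i : ZMod 2)) (fun i => v i) (fun i => u i)
    (fun i => k i) (fun i => (min (l i) (v i) : ℕ)) (fun i => (max (l i) (v i) : ℕ))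
    (fun i => by
      rw [← Nat.cast_add, ← Nat.cast_add]
      congr 1
      omega)
    (fun i => by
      rw [← Nat.cast_mul, ← Nat.cast_mul, min_mul_max])
    (fun i => by
      have a := hl i
      have b := hv i
      have e : k (i + 1) + u i = max (l (i + 1)) (v (i + 1)) + min (l i) (v i) := by
        rw [hk, growth_succ]; omega
      have e' := congrArg (Nat.cast (R := ZMod 2)) e
      push_cast at e' ⊢
      linear_combination e' - (u i : ZMod 2) * two) L
  -- All sequences vanish from L on, so the truncation defect of the parity identity is zero.
  simp only [hlz L le_rfl, hvz L le_rfl, huz L le_rfl, min_self, Nat.cast_zero, add_zero,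
    zero_mul] at key
  apply neg_one_pow_eq_of_natCast_eq
  have sub : ∀ {a b : ℕ}, b ≤ a → ((a - b : ℕ) : ZMod 2) = a + b := by
    intro a b h
    rw [Nat.cast_sub h]
    linear_combination -(b : ZMod 2) * two
  push_cast
  rw [sub (degree_le hl), sub (degree_le hv), degree_eq_sum_range (up hlz),
    degree_eq_sum_range (up hvz), degree_eq_sum_range (up huz),
    crossings_eq_sum_range (up hlz) (up huz), crossings_eq_sum_range (up hvz) (up huz),
    crossings_eq_sum_range (up hkz) (up hlz), crossings_eq_sum_range (up hkz) (up hvz),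
    rowStat_eq_sum_range (up hlz), rowStat_eq_sum_range (up hvz), rowStat_eq_sum_range (up huz),
    rowStat_eq_sum_range (up hkz)]
  push_cast
  simp only [mul_add, sum_add_distrib] at key ⊢
  generalize ∑ i ∈ range (L + 1), (i : ZMod 2) * (l i : ZMod 2) = a1 at *
  generalize ∑ i ∈ range (L + 1), (i : ZMod 2) * (k i : ZMod 2) = a2 at *
  generalize ∑ i ∈ range (L + 1), ((k i : ZMod 2) + l i) * ∑ j ∈ range i, (l j : ZMod 2) = a3 at *
  generalize ∑ i ∈ range (L + 1), ((k i : ZMod 2) + v i) * ∑ j ∈ range i, (v j : ZMod 2) = a4 at *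
  linear_combination key - (a1 + a2 + a3 + a4) * two

/-- The Pieri rule for the complete polynomials. -/
theorem tabPoly_mul_complSym {y : ℕ → R} (hy : ∀ a b, a ≠ b → y a * y b = -(y b * y a)) (m : ℕ)
    (l : ℕ →₀ ℕ) (d : ℕ) :
    tabPoly y m l * complSym y m d = ∑ k ∈ horizStrips l d,
      (-1 : ℤ) ^ (crossings k l + rowStat k + rowStat l) • tabPoly y m k := by
  induction m generalizing l d with
  | zero =>
    simp only [tabPoly_zero, complSym_zero_left]
    by_cases h : l = 0 ∧ d = 0
    · obtain ⟨rfl, rfl⟩ := h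
      have : horizStrips 0 0 = {0} := by
        ext k
        rw [mem_horizStrips, mem_singleton]
        constructor
        · rintro ⟨-, -, h⟩
          simpa [Finsupp.degree_eq_zero_iff] using h
        · rintro rfl
          exact ⟨le_rfl, fun i => by simp, by simp⟩
      rw [this]
      simp [crossings_self_zero, rowStat]
    · rw [sum_eq_zero]
      · by_cases hl : l = 0 <;> simp_all
      · intro k hk
        rw [mem_horizStrips] at hk
        rw [if_neg, smul_zero]
        rintro rfl
        apply h
        have h1 := hk.2.2
        rw [map_zero] at h1
        have h2 : l.degree = 0 := by omega
        exact ⟨by simpa [Finsupp.degree_eq_zero_iff] using h2, by omega⟩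
  | succ m ih =>
    -- The power of the last variable moves past the complete polynomial in the remaining ones; then
    -- the induction hypothesis applies to u.
    have h1 : ∀ (u : ℕ →₀ ℕ) (e : ℕ) (p : ℕ × ℕ),
        tabPoly y m u * y m ^ e * (complSym y m p.1 * y m ^ p.2) =
          ∑ v ∈ horizStrips u p.1, (-1 : ℤ) ^ (e * p.1 + (crossings v u + rowStat v + rowStat u)) •
            (tabPoly y m v * y m ^ (e + p.2)) := by
      intro u e p
      have h2 : y m ^ e * complSym y m p.1 =
        (-1 : ℤ) ^ (e * p.1) • (complSym y m p.1 * y m ^ e) := by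
        induction e with
        | zero => simp
        | succ e ihe =>
          rw [pow_succ', mul_assoc, ihe, mul_smul_comm, ← mul_assoc]
          have := complSym_mul_of_anticomm (y := y) (a := y m) (m := m)
            (fun i hi => hy _ _ (by omega)) p.1
          have h3 : y m * complSym y m p.1 = (-1 : ℤ) ^ p.1 • (complSym y m p.1 * y m) := by
            rw [this, smul_smul, neg_one_pow_mul_self, one_smul]
          rw [h3, smul_mul_assoc, smul_smul, ← pow_add, mul_assoc]
          congr 2
          ring
      rw [mul_assoc, ← mul_assoc (y m ^ e), h2, smul_mul_assoc, mul_smul_comm, mul_assoc,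
        ← pow_add, ← mul_assoc, ih, sum_mul, smul_sum]
      refine sum_congr rfl fun v _ => ?_
      rw [smul_mul_assoc, smul_smul, ← pow_add]
    rw [tabPoly_succ, complSym_succ_left]
    simp only [tabPoly_succ y m, sum_mul, mul_sum, smul_mul_assoc, h1, smul_sum, smul_smul,
      ← pow_add]
    simp only [sum_sigma']
    -- For fixed l and v, local growth matches the pairs (u, j) with the shapes k. Above the first
    -- row, k has rows max(l, v) enlarged by the boxes of min(l, v) not in u, moved down one row,
    -- and its first row exceeds max(l 0, v 0) by j. Since min(l i, v i) bounds row i + 1 of k from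
    -- above, u and j can be read off again from k.
    refine sum_bij'
      (fun s _ => ⟨growth l s.2.2 s.2.1 s.1.2, s.2.2⟩)
      (fun s _ =>
        ⟨(d - (s.1 0 - max (l 0) (s.2 0)), s.1 0 - max (l 0) (s.2 0)), ⟨shrink l s.2 s.1, s.2⟩⟩)
      ?_ ?_ ?_ ?_ ?_
    · rintro ⟨⟨a, j⟩, ⟨u, v⟩⟩ h
      simp only [mem_sigma, mem_Icc, HasAntidiagonal.mem_antidiagonal, mem_horizStrips] at h ⊢
      obtain ⟨h3, ⟨h1, h2⟩, h4, h5, h6⟩ := h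
      have h7 := degree_growth j (le_inf h2 h4)
      refine ⟨⟨?_, ?_, by omega⟩, ?_, ?_⟩
      · rintro (_ | i)
        · rw [growth_zero]; omega
        · rw [growth_succ]; omega
      · intro i
        have := h1 i; have := h5 i
        simp only [tail_apply] at *
        rw [growth_succ]; have := h2 i; have := h4 i; omega
      · intro i
        have := h1 i; have := h5 i
        simp only [tail_apply] at *
        rw [growth_succ]; have := h2 i; have := h4 i; omega
      · rintro (_ | i)
        · rw [growth_zero]; omega
        · rw [growth_succ]; omega
    · rintro ⟨k, v⟩ h
      simp only [mem_sigma, mem_Icc, HasAntidiagonal.mem_antidiagonal, mem_horizStrips] at h ⊢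
      obtain ⟨⟨h1, h2, h3⟩, h4, h5⟩ := h
      have e : growth l v (shrink l v k) (k 0 - max (l 0) (v 0)) = k := by
        ext i
        cases i with
        | zero => rw [growth_zero]; have := h1 0; have := h5 0; omega
        | succ i =>
          rw [growth_succ, shrink_apply]
          have := h1 (i + 1); have := h5 (i + 1); have := h2 i; have := h4 i
          simp only [tail_apply] at *
          omega
      have h6 : shrink l v k ≤ l ⊓ v := tsub_le_self
      have h7 := degree_growth (k 0 - max (l 0) (v 0)) h6
      have h8 := degree_le (h6.trans inf_le_right)
      rw [e] at h7
      refine ⟨by omega, ⟨?_, h6.trans inf_le_left⟩, h6.trans inf_le_right, ?_, by omega⟩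
      · intro i
        have := h1 (i + 1); have := h5 (i + 1); have := h2 i; have := h4 i
        simp only [tail_apply] at *
        rw [shrink_apply]
        omega
      · intro i
        have := h1 (i + 1); have := h5 (i + 1); have := h2 i; have := h4 i
        simp only [tail_apply] at *
        rw [shrink_apply]
        omega
    · rintro ⟨⟨a, j⟩, ⟨u, v⟩⟩ h
      simp only [mem_sigma, mem_Icc, HasAntidiagonal.mem_antidiagonal, mem_horizStrips] at h
      obtain ⟨h3, ⟨h1, h2⟩, h4, h5, h6⟩ := h
      have e1 : shrink l v (growth l v u j) = u := by
        ext i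
        rw [shrink_apply, growth_succ]
        have := h2 i; have := h4 i
        omega
      have e2 : growth l v u j 0 - max (l 0) (v 0) = j := by rw [growth_zero]; omega
      have e3 : d - j = a := by omega
      simp only [e1, e2, e3]
    · rintro ⟨k, v⟩ h
      simp only [mem_sigma, mem_Icc, mem_horizStrips] at h
      obtain ⟨⟨h1, h2, h3⟩, h4, h5⟩ := h
      have e : growth l v (shrink l v k) (k 0 - max (l 0) (v 0)) = k := by
        ext i
        cases i with
        | zero => rw [growth_zero]; have := h1 0; have := h5 0; omega
        | succ i =>
          rw [growth_succ, shrink_apply]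
          have := h1 (i + 1); have := h5 (i + 1); have := h2 i; have := h4 i
          simp only [tail_apply] at *
          omega
      simp only [e]
    · rintro ⟨⟨a, j⟩, ⟨u, v⟩⟩ h
      simp only [mem_sigma, mem_Icc, HasAntidiagonal.mem_antidiagonal, mem_horizStrips] at h ⊢
      obtain ⟨h3, ⟨h1, h2⟩, h4, h5, h6⟩ := h
      have h7 := degree_growth j (le_inf h2 h4)
      have h8 := degree_le h2
      have h9 : v.degree - u.degree = a := by omega
      rw [← growth_sign j h2 h4, h9]
      congr 2
      · ring
      · congr 1
        omega

end Tableau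

/-! ### Young diagrams and their row lengths -/

/-- The row lengths of a Young diagram as a finitely supported sequence. -/
def rows (lam : YoungDiagram) : ℕ →₀ ℕ :=
  Finsupp.onFinset (range (lam.colLen 0)) lam.rowLen fun i hi => by
    rw [mem_range, ← YoungDiagram.mem_iff_lt_colLen, YoungDiagram.mem_iff_lt_rowLen]
    omega

@[simp] theorem rows_apply (lam : YoungDiagram) (i : ℕ) : rows lam i = lam.rowLen i := rfl

theorem mem_iff_lt_rows {lam : YoungDiagram} {i j : ℕ} : (i, j) ∈ lam ↔ j < rows lam i :=
  YoungDiagram.mem_iff_lt_rowLen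

theorem rowLen_eq_zero_iff {lam : YoungDiagram} {i : ℕ} : lam.rowLen i = 0 ↔ lam.colLen 0 ≤ i := by
  rw [← not_lt, ← YoungDiagram.mem_iff_lt_colLen, YoungDiagram.mem_iff_lt_rowLen]
  omega

theorem rows_antitone (lam : YoungDiagram) : Antitone (rows lam) := fun i j h =>
  lam.rowLen_anti i j h

theorem rows_injective : Function.Injective rows := by
  intro a b h
  apply YoungDiagram.ext
  ext ⟨i, j⟩
  rw [YoungDiagram.mem_cells, YoungDiagram.mem_cells, mem_iff_lt_rows, mem_iff_lt_rows, h]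

/-- The Young diagram with given weakly decreasing row lengths. -/
def ofRows (l : ℕ →₀ ℕ) (hl : Antitone l) : YoungDiagram where
  cells := (l.support ×ˢ range (l 0)).filter fun p => p.2 < l p.1
  isLowerSet := by
    rintro ⟨i, j⟩ ⟨i', j'⟩ ⟨h1, h2⟩ h
    simp only [coe_filter, mem_product, Finsupp.mem_support_iff, mem_range,
      Set.mem_ofPred_eq] at h ⊢
    have a : l i ≤ l i' := hl h1
    have b := hl (Nat.zero_le i')
    simp only at h2
    omega

theorem mem_ofRows {l : ℕ →₀ ℕ} (hl : Antitone l) {i j : ℕ} : (i, j) ∈ ofRows l hl ↔ j < l i := by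
  rw [← YoungDiagram.mem_cells]
  simp only [ofRows, mem_filter, mem_product, Finsupp.mem_support_iff, mem_range]
  have b := hl (Nat.zero_le i)
  omega

@[simp] theorem rows_ofRows (l : ℕ →₀ ℕ) (hl : Antitone l) : rows (ofRows l hl) = l := by
  ext i
  apply eq_of_forall_lt_iff
  intro j
  rw [← mem_iff_lt_rows, mem_ofRows]

theorem rows_le_rows_iff {lam mu : YoungDiagram} : rows mu ≤ rows lam ↔ mu ≤ lam := by
  rw [← YoungDiagram.cells_subset_iff]
  constructor
  · rintro h ⟨i, j⟩ hc
    rw [YoungDiagram.mem_cells, mem_iff_lt_rows] at hc ⊢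
    exact hc.trans_le (h i)
  · intro h i
    apply le_of_forall_lt
    intro j hj
    rw [← mem_iff_lt_rows, ← YoungDiagram.mem_cells] at hj ⊢
    exact h hj

theorem sum_cells {M : Type*} [AddCommMonoid M] (lam : YoungDiagram) (F : ℕ → ℕ → M) {L : ℕ}
    (hL : lam.colLen 0 ≤ L) :
    ∑ c ∈ lam.cells, F c.1 c.2 = ∑ i ∈ range L, ∑ j ∈ range (lam.rowLen i), F i j := by
  refine Finset.sum_finset_product' lam.cells (range L) (fun i => range (lam.rowLen i)) ?_
  rintro ⟨i, j⟩
  rw [YoungDiagram.mem_cells, mem_range, mem_range, ← YoungDiagram.mem_iff_lt_rowLen]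
  refine ⟨fun h => ⟨?_, h⟩, fun h => h.2⟩
  have := YoungDiagram.mem_iff_lt_colLen.1 h
  have := lam.colLen_anti 0 j (Nat.zero_le _)
  simp only
  omega

theorem rows_bound {lam : YoungDiagram} {L : ℕ} (hL : lam.colLen 0 ≤ L) (i : ℕ) (hi : L ≤ i) :
    rows lam i = 0 := by
  rw [rows_apply, rowLen_eq_zero_iff]; omega

theorem degree_rows (lam : YoungDiagram) : (rows lam).degree = lam.card := by
  rw [degree_eq_sum_range (rows_bound le_rfl), YoungDiagram.card, card_eq_sum_ones,
    sum_cells lam (fun _ _ => 1) le_rfl]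
  simp

theorem rows_eq_zero_iff {lam : YoungDiagram} : rows lam = 0 ↔ lam.cells = ∅ := by
  rw [← Finset.card_eq_zero]
  change _ ↔ lam.card = 0
  rw [← degree_rows, Finsupp.degree_eq_zero_iff]

/-! ### Tableaux as chains of horizontal strips -/

/-- The number of boxes with a given entry. -/
def content {lam : YoungDiagram} (T : SemistandardYoungTableau lam) (a : ℕ) : ℕ :=
  (lam.cells.filter fun c => T c.1 c.2 = a).card

/-- The number of pairs of boxes, the second one in a higher row and with a smaller entry. -/
def inversions {lam : YoungDiagram} (T : SemistandardYoungTableau lam) : ℕ :=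
  ∑ c ∈ lam.cells, ∑ b ∈ lam.cells, if b.1 < c.1 ∧ T b.1 b.2 < T c.1 c.2 then 1 else 0

/-- The subtableau of a given shape. -/
def SSYT.restrict {lam : YoungDiagram} {n : ℕ} (T : SSYT lam n) (mu : YoungDiagram) (m : ℕ)
    (h : ∀ i j, (i, j) ∈ mu → (i, j) ∈ lam ∧ T.1 i j < m) : SSYT mu m where
  val :=
    { entry := fun i j => if (i, j) ∈ mu then T.1 i j else 0
      row_weak' := fun {i j1 j2} hj hc => by
        rw [if_pos hc, if_pos (mu.up_left_mem le_rfl hj.le hc)]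
        exact T.1.row_weak hj (h _ _ hc).1
      col_strict' := fun {i1 i2 j} hi hc => by
        rw [if_pos hc, if_pos (mu.up_left_mem hi.le le_rfl hc)]
        exact T.1.col_strict hi (h _ _ hc).1
      zeros' := fun hc => if_neg hc }
  property i j hc := by
    change (if (i, j) ∈ mu then T.1 i j else 0) < m
    rw [if_pos hc]
    exact (h i j hc).2

theorem SSYT.restrict_apply {lam : YoungDiagram} {n : ℕ} (T : SSYT lam n) (mu : YoungDiagram)
    (m : ℕ)
    (h : ∀ i j, (i, j) ∈ mu → (i, j) ∈ lam ∧ T.1 i j < m) (i j : ℕ) :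
    (T.restrict mu m h).1 i j = if (i, j) ∈ mu then T.1 i j else 0 := rfl

/-- Filling the boxes of a horizontal strip with a new largest letter. -/
def SSYT.extend {lam mu : YoungDiagram} {m : ℕ} (T : SSYT mu m)
    (h : ∀ i j, (i + 1, j) ∈ lam → (i, j) ∈ mu) : SSYT lam (m + 1) where
  val :=
    { entry := fun i j => if (i, j) ∈ lam then if (i, j) ∈ mu then T.1 i j else m else 0
      row_weak' := fun {i j1 j2} hj hc => by
        rw [if_pos hc, if_pos (lam.up_left_mem le_rfl hj.le hc)]
        by_cases h2 : (i, j2) ∈ mu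
        · rw [if_pos h2, if_pos (mu.up_left_mem le_rfl hj.le h2)]
          exact T.1.row_weak hj h2
        · rw [if_neg h2]
          split_ifs with h1
          · exact (T.2 _ _ h1).le
          · exact le_rfl
      col_strict' := fun {i1 i2 j} hi hc => by
        have h1 : (i1, j) ∈ mu := by
          obtain ⟨i, rfl⟩ : ∃ i, i2 = i + 1 := ⟨i2 - 1, by omega⟩
          exact mu.up_left_mem (by omega) le_rfl (h i j hc)
        rw [if_pos hc, if_pos (lam.up_left_mem hi.le le_rfl hc), if_pos h1]
        split_ifs with h2
        · exact T.1.col_strict hi h2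
        · exact T.2 _ _ h1
      zeros' := fun hc => if_neg hc }
  property i j hc := by
    change (if (i, j) ∈ lam then if (i, j) ∈ mu then T.1 i j else m else 0) < m + 1
    rw [if_pos hc]
    split_ifs with h1
    · exact (T.2 _ _ h1).trans (Nat.lt_succ_self m)
    · exact Nat.lt_succ_self m

theorem SSYT.extend_apply {lam mu : YoungDiagram} {m : ℕ} (T : SSYT mu m)
    (h : ∀ i j, (i + 1, j) ∈ lam → (i, j) ∈ mu) (i j : ℕ) :
    (T.extend h).1 i j = if (i, j) ∈ lam then if (i, j) ∈ mu then T.1 i j else m else 0 := rfl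

/-- The shape of the subtableau of entries smaller than `m`. -/
def shapeBelow {lam : YoungDiagram} (T : SemistandardYoungTableau lam) (m : ℕ) : YoungDiagram where
  cells := lam.cells.filter fun c => T c.1 c.2 < m
  isLowerSet := by
    rintro ⟨i, j⟩ ⟨i', j'⟩ ⟨h1, h2⟩ h
    simp only [coe_filter, YoungDiagram.mem_cells, Set.mem_ofPred_eq] at h ⊢
    refine ⟨lam.up_left_mem h1 h2 h.1, lt_of_le_of_lt ?_ h.2⟩
    exact (T.row_weak_of_le h2 (lam.up_left_mem h1 le_rfl h.1)).trans (T.col_weak h1 h.1)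

theorem mem_shapeBelow {lam : YoungDiagram} {T : SemistandardYoungTableau lam} {m i j : ℕ} :
    (i, j) ∈ shapeBelow T m ↔ (i, j) ∈ lam ∧ T i j < m := by
  rw [← YoungDiagram.mem_cells]
  simp [shapeBelow]

theorem rows_shapeBelow_mem {lam : YoungDiagram} {m : ℕ} (T : SSYT lam (m + 1)) :
    rows (shapeBelow T.1 m) ∈ Icc (tail (rows lam)) (rows lam) := by
  rw [mem_Icc]
  constructor
  · intro i
    apply le_of_forall_lt
    intro j hj
    rw [tail_apply, ← mem_iff_lt_rows] at hj
    rw [← mem_iff_lt_rows, mem_shapeBelow]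
    refine ⟨lam.up_left_mem (Nat.le_succ i) le_rfl hj, ?_⟩
    have h1 := T.1.col_strict (Nat.lt_add_one i) hj
    have h2 := T.2 _ _ hj
    omega
  · intro i
    apply le_of_forall_lt
    intro j hj
    rw [← mem_iff_lt_rows, mem_shapeBelow] at hj
    rw [← mem_iff_lt_rows]
    exact hj.1

/-- The count over lam minus mu is a difference of two counts; modulo 2 the difference is a sum,
which explains the factor `k i + l i` in `crossings`. -/
theorem sum_sdiff_cells_above {lam mu : YoungDiagram} (h : mu ≤ lam) :
    (((∑ c ∈ lam.cells \ mu.cells, ∑ b ∈ mu.cells, if b.1 < c.1 then 1 else 0 : ℕ)) : ZMod 2) =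
      (crossings (rows lam) (rows mu) : ℕ) := by
  have two : (2 : ZMod 2) = 0 := rfl
  have hL : mu.colLen 0 ≤ lam.colLen 0 := by
    have a := rows_le_rows_iff.2 h (lam.colLen 0)
    rw [rows_apply, rows_apply, rowLen_eq_zero_iff.2 le_rfl] at a
    exact rowLen_eq_zero_iff.1 (by omega)
  set G : ℕ → ℕ := fun i => ∑ b ∈ mu.cells, if b.1 < i then 1 else 0 with hG
  have e1 : ∑ c ∈ lam.cells \ mu.cells, G c.1 + ∑ c ∈ mu.cells, G c.1 = ∑ c ∈ lam.cells, G c.1 :=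
    sum_sdiff (YoungDiagram.cells_subset_iff.2 h)
  rw [sum_cells lam (fun i _ => G i) le_rfl, sum_cells mu (fun i _ => G i) hL] at e1
  have e2 := congrArg (Nat.cast (R := ZMod 2)) e1
  rw [crossings_eq_sum_range (rows_bound le_rfl) (rows_bound hL)]
  have e3 : ∀ i ∈ range (lam.colLen 0), ∑ j ∈ range i, rows mu j = G i := by
    intro i hi
    rw [mem_range] at hi
    simp only [hG]
    rw [sum_cells mu (fun j _ => if j < i then 1 else 0) hL]
    simp only [sum_const, card_range, smul_eq_mul, mul_ite, mul_one, mul_zero]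
    rw [← sum_filter]
    congr 1
    ext j
    simp only [mem_range, mem_filter]
    omega
  have e4 : ∑ i ∈ range (lam.colLen 0), (rows lam i + rows mu i) * ∑ j ∈ range i, rows mu j =
      ∑ i ∈ range (lam.colLen 0), (rows lam i + rows mu i) * G i :=
    sum_congr rfl fun i hi => by rw [e3 i hi]
  rw [e4]
  change ((∑ c ∈ lam.cells \ mu.cells, G c.1 : ℕ) : ZMod 2) = _
  simp only [sum_const, card_range, smul_eq_mul] at e2
  push_cast at e2 ⊢
  simp only [rows_apply, add_mul, sum_add_distrib]
  linear_combination e2 - (∑ i ∈ range (lam.colLen 0), (mu.rowLen i : ZMod 2) * (G i : ZMod 2)) *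
    two

/-- Every box of the strip carries the new largest letter, so the new inversions are exactly the
pairs of a strip box and a box of mu in a higher row; two strip boxes never form one. -/
theorem inversions_extend {lam mu : YoungDiagram} {m : ℕ} (T : SSYT mu m)
    (h : ∀ i j, (i + 1, j) ∈ lam → (i, j) ∈ mu) (hle : mu ≤ lam) :
    (-1 : ℤ) ^ inversions (T.extend h).1 =
      (-1) ^ crossings (rows lam) (rows mu) * (-1) ^ inversions T.1 := by
  have hsub := YoungDiagram.cells_subset_iff.2 hle
  have e1 : ∀ c ∈ mu.cells, (T.extend h).1 c.1 c.2 = T.1 c.1 c.2 := by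
    rintro ⟨i, j⟩ hc
    have hc' : (i, j) ∈ mu := hc
    have hc'' : (i, j) ∈ lam := hsub hc
    rw [T.extend_apply, if_pos hc'', if_pos hc']
  have e2 : ∀ c ∈ lam.cells \ mu.cells, (T.extend h).1 c.1 c.2 = m := by
    rintro ⟨i, j⟩ hc
    rw [mem_sdiff, YoungDiagram.mem_cells, YoungDiagram.mem_cells] at hc
    rw [T.extend_apply, if_pos hc.1, if_neg hc.2]
  have e3 : ∀ c ∈ mu.cells, T.1 c.1 c.2 < m := fun c hc => T.2 _ _ hc
  have key : inversions (T.extend h).1 =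
      (∑ c ∈ lam.cells \ mu.cells, ∑ b ∈ mu.cells, if b.1 < c.1 then 1 else 0) +
      inversions T.1 := by
    rw [inversions, ← sum_sdiff hsub]
    congr 1
    · refine sum_congr rfl fun c hc => ?_
      rw [← sum_sdiff hsub, sum_eq_zero, zero_add]
      · refine sum_congr rfl fun b hb => ?_
        rw [e2 c hc, e1 b hb]
        simp only [e3 b hb, and_true]
      · intro b hb
        rw [e2 c hc, e2 b hb, if_neg (by simp)]
    · rw [inversions]
      refine sum_congr rfl fun c hc => ?_
      rw [← sum_sdiff hsub, sum_eq_zero, zero_add]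
      · refine sum_congr rfl fun b hb => ?_
        rw [e1 c hc, e1 b hb]
      · intro b hb
        rw [e1 c hc, e2 b hb, if_neg]
        have := e3 c hc
        omega
  rw [← pow_add]
  apply neg_one_pow_eq_of_natCast_eq
  rw [key, Nat.cast_add, sum_sdiff_cells_above hle, Nat.cast_add]

theorem content_extend {lam mu : YoungDiagram} {m : ℕ} (T : SSYT mu m)
    (h : ∀ i j, (i + 1, j) ∈ lam → (i, j) ∈ mu) (hle : mu ≤ lam) :
    content (T.extend h).1 =
      Function.update (content T.1) m ((rows lam).degree - (rows mu).degree) := by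
  have hsub := YoungDiagram.cells_subset_iff.2 hle
  funext a
  by_cases ha : a = m
  · subst ha
    rw [Function.update_self, degree_rows, degree_rows, YoungDiagram.card, YoungDiagram.card,
      ← card_sdiff_of_subset hsub, content]
    congr 1
    ext ⟨i, j⟩
    simp only [mem_filter, mem_sdiff, and_congr_right_iff]
    intro hc
    rw [T.extend_apply, if_pos ((YoungDiagram.mem_cells _).1 hc)]
    split_ifs with h1
    · have := T.2 _ _ h1
      simp only [YoungDiagram.mem_cells, h1, not_true, iff_false]
      omega
    · simpa using h1
  · rw [Function.update_of_ne ha, content, content]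
    congr 1
    ext ⟨i, j⟩
    simp only [mem_filter, T.extend_apply, YoungDiagram.mem_cells]
    constructor
    · rintro ⟨h1, h2⟩
      rw [if_pos h1] at h2
      split_ifs at h2 with h3
      · exact ⟨h3, h2⟩
      · exact absurd h2.symm ha
    · rintro ⟨h1, h2⟩
      have h3 : (i, j) ∈ lam := hsub h1
      exact ⟨h3, by rw [if_pos h3, if_pos h1, h2]⟩

/-- A signed sum over semistandard tableaux is a sum over chains of horizontal strips. -/
theorem sum_SSYT_eq_patternSum {M : Type*} [AddCommGroup M] (m : ℕ) (lam : YoungDiagram)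
    (f : (ℕ → ℕ) → M) :
    ∑ T : SSYT lam m, (-1 : ℤ) ^ inversions T.1 • f (content T.1) = patternSum m (rows lam) f := by
  induction m generalizing lam f with
  | zero =>
    rw [patternSum]
    split_ifs with h
    · rw [rows_eq_zero_iff] at h
      have hm : ∀ i j, (i, j) ∉ lam := fun i j hc => by
        rw [← YoungDiagram.mem_cells, h] at hc
        simp at hc
      let T0 : SSYT lam 0 :=
        ⟨SemistandardYoungTableau.highestWeight lam, fun i j hc => absurd hc (hm i j)⟩
      have hT : ∀ T : SSYT lam 0, T = T0 := fun T => Subtype.ext <|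
        SemistandardYoungTableau.ext fun i j => by rw [T.1.zeros (hm i j), T0.1.zeros (hm i j)]
      rw [Fintype.sum_eq_single T0 fun T hT' => absurd (hT T) hT']
      have h1 : inversions T0.1 = 0 := by simp [inversions, h]
      have h2 : content T0.1 = 0 := by funext a; simp [content, h]
      rw [h1, h2, pow_zero, one_smul]
    · refine sum_eq_zero fun T _ => ?_
      exfalso
      rw [rows_eq_zero_iff] at h
      obtain ⟨⟨i, j⟩, hc⟩ := nonempty_iff_ne_empty.2 h
      exact absurd (T.2 i j hc) (Nat.not_lt_zero _)
  | succ m ih =>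
    -- The tableaux are grouped by the shape of their entries below the largest letter; each fibre
    -- is in bijection with the tableaux of that shape by restriction and extension.
    rw [patternSum, ← sum_fiberwise_of_maps_to (s := univ) (t := Icc (tail (rows lam)) (rows lam))
      (g := fun T : SSYT lam (m + 1) => rows (shapeBelow T.1 m)) fun T _ => rows_shapeBelow_mem T]
    refine sum_congr rfl fun u hu => ?_
    rw [mem_Icc] at hu
    -- Interlacing with l alone forces u to be weakly decreasing: u (i + 1) ≤ l (i + 1) ≤ u i.
    have hanti : Antitone u := antitone_nat_of_succ_le fun i => (hu.2 (i + 1)).trans (hu.1 i)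
    obtain ⟨mu, rfl⟩ : ∃ mu, rows mu = u := ⟨ofRows u hanti, rows_ofRows u hanti⟩
    have hle : mu ≤ lam := rows_le_rows_iff.1 hu.2
    have hstrip : ∀ i j, (i + 1, j) ∈ lam → (i, j) ∈ mu := by
      intro i j hc
      rw [mem_iff_lt_rows] at hc ⊢
      exact hc.trans_le (hu.1 i)
    rw [← ih, smul_sum]
    have hmem : ∀ T : SSYT lam (m + 1), T ∈ univ.filter
        (fun T : SSYT lam (m + 1) => rows (shapeBelow T.1 m) = rows mu) →
        ∀ i j, (i, j) ∈ mu ↔ (i, j) ∈ lam ∧ T.1 i j < m := by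
      intro T hT i j
      rw [mem_filter] at hT
      rw [← rows_injective hT.2, mem_shapeBelow]
    refine sum_bij' (fun T hT => T.restrict mu m fun i j hc => (hmem T hT i j).1 hc)
      (fun T _ => T.extend hstrip) (fun _ _ => mem_univ _) ?_ ?_ ?_ ?_
    · intro T _
      rw [mem_filter]
      refine ⟨mem_univ _, congrArg rows ?_⟩
      apply YoungDiagram.ext
      ext ⟨i, j⟩
      rw [YoungDiagram.mem_cells, YoungDiagram.mem_cells, mem_shapeBelow, T.extend_apply]
      constructor
      · rintro ⟨h1, h2⟩
        rw [if_pos h1] at h2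
        by_contra h3
        rw [if_neg h3] at h2
        omega
      · intro h1
        have h3 : (i, j) ∈ lam := hle h1
        refine ⟨h3, ?_⟩
        rw [if_pos h3, if_pos h1]
        exact T.2 _ _ h1
    · intro T hT
      apply Subtype.ext
      apply SemistandardYoungTableau.ext
      intro i j
      rw [SSYT.extend_apply, SSYT.restrict_apply]
      have h1 := hmem T hT i j
      split_ifs with h2 h3
      · rfl
      · have := T.2 _ _ h2
        have h4 : ¬ T.1 i j < m := fun h4 => h3 (h1.2 ⟨h2, h4⟩)
        omega
      · exact (T.1.zeros h2).symm
    · intro T _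
      apply Subtype.ext
      apply SemistandardYoungTableau.ext
      intro i j
      rw [SSYT.restrict_apply, SSYT.extend_apply]
      split_ifs with h1 h2
      · rfl
      · exact absurd (hle h1) h2
      · exact (T.1.zeros h1).symm
    · intro T hT
      have h1 : (T.restrict mu m fun i j hc => (hmem T hT i j).1 hc).extend hstrip = T := by
        apply Subtype.ext
        apply SemistandardYoungTableau.ext
        intro i j
        rw [SSYT.extend_apply, SSYT.restrict_apply]
        have h1 := hmem T hT i j
        split_ifs with h2 h3
        · rfl
        · have := T.2 _ _ h2
          have h4 : ¬ T.1 i j < m := fun h4 => h3 (h1.2 ⟨h2, h4⟩)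
          omega
        · exact (T.1.zeros h2).symm
      conv_lhs => rw [← h1]
      rw [inversions_extend _ _ hle, content_extend _ _ hle, smul_smul]

/-! ### Signs of words -/

/-- The number of inversions of a word. -/
def wordInversions : List ℕ → ℕ
  | [] => 0
  | a :: w => w.countP (fun b => decide (b < a)) + wordInversions w

theorem wordInversions_append (u v : List ℕ) :
    wordInversions (u ++ v) = wordInversions u + wordInversions v +
      (u.map fun a => v.countP fun b => decide (b < a)).sum := by
  induction u with
  | nil => simp [wordInversions]
  | cons a u ih =>
    simp only [List.cons_append, wordInversions, ih, List.countP_append, List.map_cons,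
      List.sum_cons]
    omega

theorem wordInversions_eq_zero {w : List ℕ} (h : w.Pairwise (· ≤ ·)) : wordInversions w = 0 := by
  induction w with
  | nil => rfl
  | cons a w ih =>
    rw [List.pairwise_cons] at h
    rw [wordInversions, ih h.2, add_zero, List.countP_eq_zero]
    intro b hb
    have := h.1 b hb
    simpa using this

/-- The inverse of the sorting permutation sends a position to its place after sorting. Stability
keeps equal values in order, so it inverts exactly the pairs with a strict descent. -/
theorem sign_sort {n : ℕ} (f : Fin n → ℕ) :
    Equiv.Perm.sign (Tuple.sort f) = ∏ i, ∏ j ∈ Ioi i, if f j < f i then -1 else 1 := by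
  rw [← Equiv.Perm.sign_inv, Equiv.Perm.sign_eq_prod_prod_Ioi]
  refine prod_congr rfl fun i _ => prod_congr rfl fun j hj => ?_
  rw [mem_Ioi] at hj
  obtain ⟨h1, h2⟩ := (Tuple.eq_sort_iff (σ := Tuple.sort f)).1 rfl
  generalize Tuple.sort f = s at *
  obtain ⟨a, rfl⟩ := s.surjective i
  obtain ⟨b, rfl⟩ := s.surjective j
  have hs : ∀ c, s⁻¹ (s c) = c := s.symm_apply_apply
  simp only [hs]
  rcases lt_trichotomy a b with h | rfl | h
  · have := h1 h.le
    simp only [Function.comp_apply] at this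
    rw [if_pos h, if_neg (by omega)]
  · exact absurd hj (lt_irrefl _)
  · have h3 := h1 h.le
    simp only [Function.comp_apply] at h3
    rw [if_neg (by omega), if_pos]
    refine lt_of_le_of_ne h3 fun e => ?_
    exact absurd (h2 b a h e) (by omega)

theorem sign_sort_get (w : List ℕ) :
    (Equiv.Perm.sign (Tuple.sort w.get) : ℤ) = (-1) ^ wordInversions w := by
  rw [sign_sort]
  induction w with
  | nil => simp [wordInversions]
  | cons a w ih =>
    have h : ∀ w : List ℕ, ((∏ j : Fin w.length, if w.get j < a then -1 else 1 : ℤˣ) : ℤ) =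
        (-1) ^ w.countP (fun b => decide (b < a)) := by
      intro w
      induction w with
      | nil => simp
      | cons b w ih =>
        have e : (∏ j : Fin (b :: w).length, if (b :: w).get j < a then -1 else 1 : ℤˣ) =
            (if b < a then -1 else 1) * ∏ j : Fin w.length, if w.get j < a then -1 else 1 :=
          Fin.prod_univ_succ _
        rw [e, Units.val_mul, ih, List.countP_cons]
        by_cases hb : b < a <;> simp [hb, pow_succ]
    have e : (∏ i : Fin (a :: w).length, ∏ j ∈ Ioi i,
        if (a :: w).get j < (a :: w).get i then -1 else 1 : ℤˣ) =
        (∏ j : Fin w.length, if w.get j < a then -1 else 1) *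
        ∏ i : Fin w.length, ∏ j ∈ Ioi i, if w.get j < w.get i then -1 else 1 := by
      refine (Fin.prod_univ_succ (n := w.length) _).trans ?_
      congr 1
      · exact Fin.prod_Ioi_zero (fun j : Fin (w.length + 1) =>
          if (a :: w).get j < a then (-1 : ℤˣ) else 1)
      · refine prod_congr rfl fun i _ => ?_
        exact Fin.prod_Ioi_succ (fun j : Fin (w.length + 1) =>
          if (a :: w).get j < (a :: w).get i.succ then (-1 : ℤˣ) else 1) i
    rw [e, Units.val_mul, ih, h, wordInversions, pow_add]

theorem countP_map_range (P : ℕ → Bool) (f : ℕ → ℕ) (n : ℕ) :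
    ((List.range n).map f).countP P = ∑ j ∈ range n, if P (f j) then 1 else 0 := by
  induction n with
  | zero => simp
  | succ n ih =>
    rw [List.range_succ, List.map_append, List.countP_append, ih, sum_range_succ]
    simp [List.countP_cons]

theorem sum_map_range (f : ℕ → ℕ) (n : ℕ) : ((List.range n).map f).sum = ∑ j ∈ range n, f j := by
  induction n with
  | zero => simp
  | succ n ih => rw [List.range_succ, List.map_append, List.sum_append, ih, sum_range_succ]; simp

theorem flatMap_reverse_range_succ (F : ℕ → List ℕ) (L : ℕ) :
    (List.range (L + 1)).reverse.flatMap F = F L ++ (List.range L).reverse.flatMap F := by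
  rw [List.range_succ, List.reverse_append, List.reverse_singleton, List.flatMap_append,
    List.flatMap_singleton]

theorem countP_rows (P : ℕ → Bool) (T : ℕ → ℕ → ℕ) (r : ℕ → ℕ) (L : ℕ) :
    ((List.range L).reverse.flatMap fun i => (List.range (r i)).map (T i)).countP P =
      ∑ i ∈ range L, ∑ j ∈ range (r i), if P (T i j) then 1 else 0 := by
  induction L with
  | zero => simp
  | succ L ih =>
    rw [flatMap_reverse_range_succ, List.countP_append, ih, countP_map_range, sum_range_succ,
      add_comm]

/-- A weakly increasing row has no inversions of its own. Since the word runs from bottom to top,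
every inversion pairs an entry with a smaller one in a higher row. -/
theorem wordInversions_rows (T : ℕ → ℕ → ℕ) (r : ℕ → ℕ) (L : ℕ)
    (hT : ∀ i j j', j ≤ j' → j' < r i → T i j ≤ T i j') :
    wordInversions ((List.range L).reverse.flatMap fun i => (List.range (r i)).map (T i)) =
      ∑ i ∈ range L, ∑ j ∈ range (r i), ∑ i' ∈ range i, ∑ j' ∈ range (r i'),
        if T i' j' < T i j then 1 else 0 := by
  induction L with
  | zero => simp [wordInversions]
  | succ L ih =>
    have h0 : wordInversions ((List.range (r L)).map (T L)) = 0 := by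
      apply wordInversions_eq_zero
      rw [List.pairwise_map]
      refine List.pairwise_lt_range.imp_of_mem fun {a b} _ hb h => ?_
      exact hT L a b h.le (List.mem_range.1 hb)
    rw [flatMap_reverse_range_succ, wordInversions_append, ih, h0, zero_add, sum_range_succ,
      List.map_map, sum_map_range]
    congr 1
    refine sum_congr rfl fun j _ => ?_
    rw [Function.comp_apply, countP_rows]
    simp only [decide_eq_true_eq]

variable {lam : YoungDiagram}

theorem wordInversions_rowWord (T : SemistandardYoungTableau lam) :
    wordInversions (rowWord T) = inversions T := by
  rw [rowWord, wordInversions_rows, inversions]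
  · rw [sum_cells lam (fun i j => ∑ b ∈ lam.cells, if b.1 < i ∧ T b.1 b.2 < T i j then 1 else 0)
      le_rfl]
    refine sum_congr rfl fun i hi => sum_congr rfl fun j _ => ?_
    rw [sum_cells lam (fun i' j' => if i' < i ∧ T i' j' < T i j then 1 else 0) le_rfl]
    rw [mem_range] at hi
    have e : range i = (range (lam.colLen 0)).filter (· < i) := by
      ext a; simp only [mem_range, mem_filter]; omega
    rw [e, sum_filter]
    refine sum_congr rfl fun i' _ => ?_
    by_cases h : i' < i <;> simp [h]
  · intro i j j' h1 h2
    exact T.row_weak_of_le h1 (YoungDiagram.mem_iff_lt_rowLen.2 h2)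

theorem count_rowWord (T : SemistandardYoungTableau lam) (a : ℕ) :
    (rowWord T).count a = content T a := by
  rw [rowWord, List.count, countP_rows, content, card_filter,
    sum_cells lam (fun i j => if T i j = a then 1 else 0) le_rfl]
  simp only [beq_iff_eq]

theorem tabSign_eq (T : SemistandardYoungTableau lam) : tabSign T = (-1) ^ inversions T := by
  rw [tabSign, sign_sort_get, wordInversions_rowWord]

/-- Prepending a letter a to a sorted word moves it past the letters smaller than a, whose number is
that of the inversions it creates. -/
theorem prod_map_eq_monomial {R : Type*} [Ring R] {y : ℕ → R}
    (hy : ∀ a b, a ≠ b → y a * y b = -(y b * y a)) {m : ℕ} {w : List ℕ} (hw : ∀ a ∈ w, a < m) :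
    (w.map y).prod = (-1 : ℤ) ^ wordInversions w • monomial y m fun a => w.count a := by
  induction w with
  | nil =>
    have : ∀ m, monomial y m (fun _ => 0) = 1 := by
      intro m
      induction m with
      | zero => rfl
      | succ m ih => rw [monomial, ih, pow_zero, one_mul]
    simp [wordInversions, this]
  | cons a w ih =>
    rw [List.map_cons, List.prod_cons, ih fun b hb => hw b (List.mem_cons_of_mem a hb),
      mul_smul_comm, mul_monomial hy (hw a List.mem_cons_self), smul_smul, wordInversions, pow_add,
      mul_comm]
    have h1 : ∑ i ∈ range a, w.count i = w.countP fun b => decide (b < a) := by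
      clear ih hw
      induction w with
      | nil => simp
      | cons b w ih =>
        simp only [List.count_cons, sum_add_distrib, ih, List.countP_cons]
        simp
    have h2 : Function.update (fun i => w.count i) a (w.count a + 1) =
      fun i => (a :: w).count i := by
      funext i
      by_cases h : i = a
      · subst h; simp
      · rw [Function.update_of_ne h, List.count_cons_of_ne (Ne.symm h)]
    rw [h1, h2]

/-! ### The plactic Schur polynomials and the odd Kostka numbers -/

theorem xt_anticomm (n : ℕ) (a b : ℕ) (h : a ≠ b) : xt n a * xt n b = -(xt n b * xt n a) := by
  have h1 : x n a * x n b = -(x n b * x n a) := eq_neg_of_add_eq_zero_left (x_anticomm n h)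
  have h2 : ∀ c (r : OPol n), r * (-1) ^ c = (-1) ^ c * r := fun c r =>
    ((Commute.neg_one_right r).pow_right c).eq
  rw [xt, xt, mul_assoc, ← mul_assoc (x n a), h2 b (x n a), mul_assoc, mul_assoc, h1,
    ← mul_assoc (x n b), h2 a (x n b), mul_neg, mul_neg, mul_assoc ((-1) ^ a), ← mul_assoc,
    ← mul_assoc ((-1) ^ b), h2 b]

/-- A row word equals the tableau sign times the sorted monomial of its content, so the plactic sum
and the odd Kostka numbers are the same signed sum over chains, with different functions of the
content. -/
theorem sum_xtWord (n : ℕ) (lam : YoungDiagram) :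
    ∑ T : SSYT lam n, xtWord n (rowWord T.1) = tabPoly (xt n) n (rows lam) := by
  rw [tabPoly, ← sum_SSYT_eq_patternSum]
  refine sum_congr rfl fun T _ => ?_
  rw [xtWord, prod_map_eq_monomial (xt_anticomm n) (m := n), wordInversions_rowWord]
  · simp only [count_rowWord]
  · intro a ha
    rw [rowWord] at ha
    simp only [List.mem_flatMap, List.mem_reverse, List.mem_range, List.mem_map] at ha
    obtain ⟨i, _, j, hj, rfl⟩ := ha
    exact T.2 i j (YoungDiagram.mem_iff_lt_rowLen.2 hj)

theorem dN_eq_rowStat (lam : YoungDiagram) : dN lam = rowStat (rows lam) := by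
  rw [dN, rowStat_eq_sum_range (rows_bound le_rfl)]
  have h : ∀ c ∈ lam.cells, (lam.cells.filter fun b => b.1 < c.1 ∧ b.2 = c.2).card = c.1 := by
    rintro ⟨i, j⟩ hc
    have : (lam.cells.filter fun b => b.1 < i ∧ b.2 = j) = range i ×ˢ {j} := by
      ext ⟨i', j'⟩
      simp only [mem_filter, YoungDiagram.mem_cells, mem_product, mem_range, mem_singleton]
      refine ⟨fun h => h.2, fun h => ⟨?_, h⟩⟩
      rw [h.2]
      exact lam.up_left_mem h.1.le le_rfl ((YoungDiagram.mem_cells _).1 hc)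
    simp only [this]
    simp
  rw [sum_congr rfl h, sum_cells lam (fun i _ => i) le_rfl]
  refine sum_congr rfl fun i _ => ?_
  simp [mul_comm]

theorem inversions_highestWeight (lam : YoungDiagram) :
    inversions (SemistandardYoungTableau.highestWeight lam) = bigN lam := by
  rw [inversions, bigN]
  refine sum_congr rfl fun c hc => ?_
  rw [card_filter]
  refine sum_congr rfl fun b hb => ?_
  rw [SemistandardYoungTableau.highestWeight_apply, SemistandardYoungTableau.highestWeight_apply,
    if_pos ((YoungDiagram.mem_cells _).1 hb), if_pos ((YoungDiagram.mem_cells _).1 hc)]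
  simp only [and_self]

theorem schurP_eq (n : ℕ) (lam : YoungDiagram) :
    schurP n lam = (-1 : ℤ) ^ (rowStat (rows lam) + bigN lam) • tabPoly (xt n) n (rows lam) := by
  rw [schurP, sum_xtWord, dN_eq_rowStat, zsmul_eq_mul]
  simp

/-- The signed number of tableaux with prescribed multiplicities of the first `r` letters. -/
def signedKostka (r : ℕ) (l : ℕ →₀ ℕ) (c : ℕ → ℕ) : ℤ :=
  patternSum r l fun d => if ∀ i < r, d i = c i then 1 else 0

/-- With an alphabet of as many letters as mu has rows, prescribing the multiplicities of these
letters fixes the whole content, since no other letter occurs. -/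
theorem oddKostka_eq (lam mu : YoungDiagram) :
    oddKostka lam mu = (-1) ^ bigN lam * signedKostka (mu.colLen 0) (rows lam) mu.rowLen := by
  rw [oddKostka, tabSign_eq, inversions_highestWeight, signedKostka, ← sum_SSYT_eq_patternSum]
  congr 1
  simp only [smul_eq_mul, mul_ite, mul_one, mul_zero]
  rw [← sum_filter]
  have key : ∀ T : SSYTContent lam mu, ∀ i j, (i, j) ∈ lam → T.1 i j < mu.colLen 0 := by
    intro T i j hij
    rw [← YoungDiagram.mem_iff_lt_colLen, YoungDiagram.mem_iff_lt_rowLen, ← T.2, Finset.card_pos]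
    exact ⟨(i, j), by simp [hij]⟩
  have key2 : ∀ T : SSYT lam (mu.colLen 0), (∀ i < mu.colLen 0, content T.1 i = mu.rowLen i) →
      ∀ i, (lam.cells.filter fun c => T.1 c.1 c.2 = i).card = mu.rowLen i := by
    intro T hT i
    by_cases hi : i < mu.colLen 0
    · exact hT i hi
    · rw [rowLen_eq_zero_iff.2 (not_lt.1 hi), card_eq_zero, filter_eq_empty_iff]
      rintro ⟨a, b⟩ hc rfl
      exact hi (T.2 a b ((YoungDiagram.mem_cells _).1 hc))
  refine sum_bij' (fun T _ => (⟨T.1, key T⟩ : SSYT lam (mu.colLen 0)))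
    (fun T hT => (⟨T.1, key2 T (mem_filter.1 hT).2⟩ : SSYTContent lam mu)) ?_ ?_ ?_ ?_ ?_
  · intro T _
    exact mem_filter.2 ⟨mem_univ _, fun i _ => T.2 i⟩
  · intro T _
    exact mem_univ _
  · intro T _
    rfl
  · intro T _
    rfl
  · intro T _
    exact tabSign_eq T.1

/-! ### Complete polynomials as sums over weakly increasing sequences -/

-- The recursion of `complSym` splits the weakly increasing sequences according to whether the last
-- index is the largest one.
open Classical in
theorem sum_monotone_eq_complSym {R : Type*} [Ring R] (y : ℕ → R) (m k : ℕ) :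
    ∑ i ∈ (univ : Finset (Fin k → Fin m)).filter Monotone, (List.ofFn fun p => y (i p)).prod =
      complSym y m k := by
  induction m generalizing k with
  | zero =>
    cases k with
    | zero =>
      rw [complSym_zero_right, filter_true_of_mem fun i _ a => a.elim0]
      simp
    | succ k => rw [complSym, univ_eq_empty, filter_empty, sum_empty]
  | succ m ih =>
    induction k with
    | zero =>
      rw [complSym_zero_right, filter_true_of_mem fun i _ a => a.elim0]
      simp
    | succ k ihk =>
      rw [complSym, ← ihk, ← ih, ← sum_filter_add_sum_filter_not _
        (fun i : Fin (k + 1) → Fin (m + 1) => i (Fin.last k) = Fin.last m), add_comm]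
      congr 1
      · have hlt : ∀ i : Fin (k + 1) → Fin (m + 1), Monotone i → i (Fin.last k) ≠ Fin.last m →
            ∀ p, (i p : ℕ) < m := by
          intro i hi hl p
          have h1 : (i p : ℕ) ≤ i (Fin.last k) := hi (Fin.le_last p)
          have h2 : (i (Fin.last k) : ℕ) ≠ m := fun e => hl (Fin.ext e)
          omega
        refine sum_bij' (fun i hi p => ⟨i p, hlt i (mem_filter.1 (mem_filter.1 hi).1).2
          (mem_filter.1 hi).2 p⟩) (fun i _ p => (i p).castSucc) ?_ ?_ ?_ ?_ ?_
        · intro i hi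
          exact mem_filter.2 ⟨mem_univ _, fun p q h => (mem_filter.1 (mem_filter.1 hi).1).2 h⟩
        · intro i hi
          refine mem_filter.2 ⟨mem_filter.2 ⟨mem_univ _, fun p q h => (mem_filter.1 hi).2 h⟩, ?_⟩
          exact (Fin.castSucc_lt_last _).ne
        · intro i _; rfl
        · intro i _; rfl
        · intro i _; rfl
      · rw [sum_mul]
        refine sum_bij' (fun i _ p => i p.castSucc) (fun i _ =>
          Fin.snoc i (Fin.last m)) ?_ ?_ ?_ ?_ ?_
        · intro i hi
          exact mem_filter.2 ⟨mem_univ _, fun p q h =>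
            (mem_filter.1 (mem_filter.1 hi).1).2 (Fin.castSucc_le_castSucc_iff.2 h)⟩
        · intro i hi
          refine mem_filter.2 ⟨mem_filter.2 ⟨mem_univ _, ?_⟩, by simp⟩
          intro p q h
          induction q using Fin.lastCases with
          | last => rw [Fin.snoc_last]; exact Fin.le_last _
          | cast q =>
            induction p using Fin.lastCases with
            | last => exact absurd h (not_le.2 (Fin.castSucc_lt_last q))
            | cast p =>
              rw [Fin.snoc_castSucc, Fin.snoc_castSucc]
              exact (mem_filter.1 hi).2 (Fin.castSucc_le_castSucc_iff.1 h)
        · intro i hi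
          funext p
          induction p using Fin.lastCases with
          | last => rw [Fin.snoc_last, (mem_filter.1 hi).2]
          | cast p => rw [Fin.snoc_castSucc]
        · intro i _
          funext p
          rw [Fin.snoc_castSucc]
        · intro i hi
          rw [List.ofFn_succ', List.concat_eq_append, List.prod_append, (mem_filter.1 hi).2]
          simp

theorem hsym_eq (n k : ℕ) : hsym n k = complSym (xt n) n k := sum_monotone_eq_complSym (xt n) n k

/-! ### Products of complete polynomials -/

/-- The partitions of `k` as finitely supported sequences. -/
def parts (k : ℕ) : Finset (ℕ →₀ ℕ) := univ.image fun lam : Part k => rows lam.1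

theorem mem_parts {k : ℕ} {l : ℕ →₀ ℕ} : l ∈ parts k ↔ Antitone l ∧ l.degree = k := by
  simp only [parts, mem_image, mem_univ, true_and]
  constructor
  · rintro ⟨lam, rfl⟩
    exact ⟨rows_antitone _, by rw [degree_rows, lam.2]⟩
  · rintro ⟨h1, h2⟩
    exact ⟨⟨ofRows l h1, by rw [← degree_rows, rows_ofRows, h2]⟩, rows_ofRows l h1⟩

theorem sum_parts {M : Type*} [AddCommMonoid M] (k : ℕ) (f : (ℕ →₀ ℕ) → M) :
    ∑ l ∈ parts k, f l = ∑ lam : Part k, f (rows lam.1) :=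
  sum_image fun _ _ _ _ h => Subtype.ext (rows_injective h)

theorem signedKostka_succ (r : ℕ) (l : ℕ →₀ ℕ) (c : ℕ → ℕ) :
    signedKostka (r + 1) l c = ∑ u ∈ (Icc (tail l) l).filter fun u => l.degree = u.degree + c r,
      (-1) ^ crossings l u * signedKostka r u c := by
  rw [signedKostka, patternSum, sum_filter]
  refine sum_congr rfl fun u hu => ?_
  have hd := degree_le (mem_Icc.1 hu).2
  have h1 : ∀ d : ℕ → ℕ, (∀ i < r + 1, Function.update d r (l.degree - u.degree) i = c i) ↔
      l.degree = u.degree + c r ∧ ∀ i < r, d i = c i := by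
    intro d
    constructor
    · intro h
      refine ⟨?_, fun i hi => ?_⟩
      · have := h r (Nat.lt_succ_self r)
        rw [Function.update_self] at this
        omega
      · have := h i (by omega)
        rwa [Function.update_of_ne (by omega)] at this
    · rintro ⟨h1, h2⟩ i hi
      by_cases e : i = r
      · subst e
        rw [Function.update_self]
        omega
      · rw [Function.update_of_ne e]
        exact h2 i (by omega)
  simp only [h1]
  split_ifs with h2
  · simp only [h2, true_and, signedKostka, smul_eq_mul]
  · simp only [h2, false_and, if_false]
    rw [show (fun _ : ℕ → ℕ => (0 : ℤ)) = fun d => (0 : ℤ →+ ℤ) ((fun _ => 0) d) from rfl,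
      patternSum_map]
    simp

@[simp] theorem tabPoly_zero_shape {R : Type*} [Ring R] (y : ℕ → R) (m : ℕ) :
    tabPoly y m 0 = 1 := by
  induction m with
  | zero => rw [tabPoly_zero, if_pos rfl]
  | succ m ih =>
    have h1 : Icc (tail 0) (0 : ℕ →₀ ℕ) = {0} := by
      rw [show tail 0 = 0 by ext i; simp]
      exact Icc_self 0
    rw [tabPoly_succ, h1, sum_singleton, ih, crossings_self_zero]
    simp

/-- Repeated use of the Pieri rule builds up chains of horizontal strips of sizes c 0, …, c (r - 1),
which are the tableaux of content c. The `rowStat` part of the Pieri signs telescopes along a chain,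
leaving only that of the final shape. -/
theorem prod_complSym {R : Type*} [Ring R] {y : ℕ → R}
    (hy : ∀ a b, a ≠ b → y a * y b = -(y b * y a)) (m r : ℕ) (c : ℕ → ℕ) :
    ((List.range r).map fun i => complSym y m (c i)).prod =
      ∑ l ∈ parts (∑ i ∈ range r, c i),
        (signedKostka r l c * (-1) ^ rowStat l) • tabPoly y m l := by
  induction r with
  | zero =>
    rw [range_zero, sum_empty, sum_eq_single 0]
    · simp [signedKostka, patternSum, rowStat]
    · intro l hl hl'
      rw [mem_parts, Finsupp.degree_eq_zero_iff] at hl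
      exact absurd hl.2 hl'
    · intro h
      exact absurd (mem_parts.2 ⟨fun _ _ _ => le_rfl, by simp⟩) h
  | succ r ih =>
    rw [List.range_succ, List.map_append, List.prod_append, ih, List.map_singleton,
      List.prod_singleton, sum_mul, sum_range_succ]
    simp only [smul_mul_assoc, tabPoly_mul_complSym hy, smul_sum, smul_smul, signedKostka_succ,
      sum_mul, sum_smul]
    -- Both double sums run over pairs u ⊆ l of partitions whose difference is a horizontal strip of
    -- size c r; the summation over l is moved outside.
    rw [sum_comm' (t' := parts (∑ i ∈ range r, c i + c r))
      (s' := fun l => (Icc (tail l) l).filter fun u => l.degree = u.degree + c r)]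
    · refine sum_congr rfl fun l _ => sum_congr rfl fun u _ => ?_
      congr 1
      rw [pow_add, pow_add]
      linear_combination (signedKostka r u c * (-1) ^ crossings l u * (-1) ^ rowStat l) *
        neg_one_pow_mul_self (rowStat u)
    · intro u l
      simp only [mem_parts, mem_horizStrips, mem_filter, mem_Icc]
      constructor
      · rintro ⟨⟨h1, h2⟩, h3, h4, h5⟩
        exact ⟨⟨⟨h4, h3⟩, h5⟩, antitone_nat_of_succ_le fun i => (h4 i).trans (h3 i), by omega⟩
      · rintro ⟨⟨⟨h4, h3⟩, h5⟩, h1, h2⟩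
        exact ⟨⟨antitone_nat_of_succ_le fun i => (h3 (i + 1)).trans (h4 i), by omega⟩, h3, h4, h5⟩

/-- The plactic polynomials thus satisfy the relation defining the Kostka family: the sign with
exponent `bigN` occurs once in the Kostka number and once in the plactic normalization, and cancels.
-/
theorem hPart_eq_sum (n k : ℕ) (mu : Part k) :
    hPart (hsym n) mu.1 = ∑ lam : Part k, oddKostka lam.1 mu.1 • schurP n lam.1 := by
  have h1 : hPart (hsym n) mu.1 =
      ((List.range (mu.1.colLen 0)).map fun i => complSym (xt n) n (mu.1.rowLen i)).prod := by
    rw [hPart, YoungDiagram.rowLens, List.map_map]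
    congr 1
    exact List.map_congr_left fun i _ => hsym_eq n _
  have h2 : ∑ i ∈ range (mu.1.colLen 0), mu.1.rowLen i = k := by
    refine Eq.trans ?_ ((degree_rows mu.1).trans mu.2)
    rw [degree_eq_sum_range (rows_bound le_rfl)]
    rfl
  rw [h1, prod_complSym (xt_anticomm n), h2, sum_parts]
  refine sum_congr rfl fun lam _ => ?_
  rw [schurP_eq, smul_smul, oddKostka_eq, pow_add, mul_comm ((-1) ^ rowStat _) ((-1) ^ bigN _),
    mul_mul_mul_comm, neg_one_pow_mul_self, one_mul]

/-! ### Unimodularity of the odd Kostka matrix -/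

theorem row_le_entry {lam : YoungDiagram} (T : SemistandardYoungTableau lam) {i j : ℕ}
    (h : (i, j) ∈ lam) : i ≤ T i j := by
  induction i with
  | zero => exact Nat.zero_le _
  | succ i ih =>
    have h1 := ih (lam.up_left_mem (Nat.le_succ i) le_rfl h)
    have h2 := T.col_strict (Nat.lt_add_one i) h
    omega

/-- Columns increase strictly, so an entry is at least its row index, and the entries smaller than r
lie in the first r rows. -/
theorem sum_content_le {lam : YoungDiagram} (T : SemistandardYoungTableau lam) (r : ℕ) :
    ∑ i ∈ range r, content T i ≤ ∑ i ∈ range r, lam.rowLen i := by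
  have h1 : ∀ g : ℕ × ℕ → ℕ, ∑ i ∈ range r, (lam.cells.filter fun c => g c = i).card =
      ∑ c ∈ lam.cells, if g c < r then 1 else 0 := by
    intro g
    simp only [card_filter]
    rw [sum_comm]
    refine sum_congr rfl fun c _ => ?_
    rw [sum_ite_eq]
    simp only [mem_range]
  have h2 : ∑ i ∈ range r, lam.rowLen i = ∑ c ∈ lam.cells, if c.1 < r then 1 else 0 := by
    rw [← h1 Prod.fst]
    exact sum_congr rfl fun i _ => lam.rowLen_eq_card
  rw [h2]
  simp only [content]
  rw [h1 fun c => T c.1 c.2]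
  refine sum_le_sum fun c hc => ?_
  have := row_le_entry T ((YoungDiagram.mem_cells _).1 hc)
  split_ifs <;> omega

/-- Once the rows above row i are known to be constant, an entry i can only lie in row i; the
content requires as many entries i as row i has boxes, so they fill it. -/
theorem eq_highestWeight {lam : YoungDiagram} (T : SSYTContent lam lam) :
    T.1 = SemistandardYoungTableau.highestWeight lam := by
  have key : ∀ i j, (i, j) ∈ lam → T.1 i j = i := by
    intro i
    induction i using Nat.strong_induction_on with
    | _ i ih =>
      intro j hj
      have hsub : (lam.cells.filter fun c => T.1 c.1 c.2 = i) ⊆ lam.row i := by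
        rintro ⟨a, b⟩ hc
        rw [mem_filter] at hc
        have hc1 : (a, b) ∈ lam := hc.1
        rw [YoungDiagram.mem_row_iff]
        refine ⟨hc1, ?_⟩
        have h1 := row_le_entry T.1 hc1
        have h2 := hc.2
        simp only at h2 ⊢
        by_contra h3
        have h4 := ih a (by omega) b hc1
        omega
      have heq := eq_of_subset_of_card_le hsub (by rw [T.2, YoungDiagram.rowLen_eq_card])
      have h1 : (i, j) ∈ lam.row i := YoungDiagram.mem_row_iff.2 ⟨hj, rfl⟩
      rw [← heq, mem_filter] at h1
      exact h1.2
  apply SemistandardYoungTableau.ext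
  intro i j
  rw [SemistandardYoungTableau.highestWeight_apply]
  split_ifs with h
  · exact key i j h
  · exact T.1.zeros h

theorem oddKostka_self (lam : YoungDiagram) : oddKostka lam lam = 1 := by
  let T0 : SSYTContent lam lam := ⟨SemistandardYoungTableau.highestWeight lam, fun i => by
    rw [YoungDiagram.rowLen_eq_card, YoungDiagram.row]
    congr 1
    refine filter_congr fun c hc => ?_
    rw [SemistandardYoungTableau.highestWeight_apply, if_pos ((YoungDiagram.mem_cells _).1 hc)]⟩
  rw [oddKostka, Fintype.sum_eq_single T0 fun T hT =>
    absurd (Subtype.ext ((eq_highestWeight T).trans (eq_highestWeight T0).symm)) hT]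
  rw [tabSign_eq]
  exact neg_one_pow_mul_self _

/-- At the first row i where the shapes differ, mu prescribes more entries at most i than the first
i + 1 rows of lam can hold. -/
theorem oddKostka_eq_zero {lam mu : YoungDiagram} (h : toLex (rows lam) < toLex (rows mu)) :
    oddKostka lam mu = 0 := by
  have he : IsEmpty (SSYTContent lam mu) := by
    refine ⟨fun T => ?_⟩
    obtain ⟨i, h1, h2⟩ := Finsupp.lex_def.1 h
    have h3 := sum_content_le T.1 (i + 1)
    have h4 : ∀ j, content T.1 j = mu.rowLen j := T.2
    simp only [h4, sum_range_succ] at h3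
    have h5 : ∑ j ∈ range i, mu.rowLen j = ∑ j ∈ range i, lam.rowLen j :=
      sum_congr rfl fun j hj => (h1 j (mem_range.1 hj)).symm
    have h6 : lam.rowLen i < mu.rowLen i := h2
    omega
  rw [oddKostka, univ_eq_empty, sum_empty, mul_zero]

theorem isUnit_det_kostkaMatrix (k : ℕ) : IsUnit (kostkaMatrix k).det := by
  let f : Part k → Lex (ℕ →₀ ℕ) := fun lam => toLex (rows lam.1)
  have hf : Function.Injective f := fun a b h => Subtype.ext (rows_injective (toLex.injective h))
  -- The linear order needed for triangularity is the lexicographic order on row lengths, so the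
  -- matrix is reindexed by the image of the partitions there.
  let e : Part k ≃ Set.range f := Equiv.ofInjective f hf
  have he : ∀ a, toLex (rows (e.symm a).1) = a.1 := fun a => Equiv.apply_ofInjective_symm hf a
  let : Fintype (Set.range f) := Fintype.ofEquiv _ e
  have h : ((kostkaMatrix k).submatrix e.symm e.symm).IsLowerTriangular := fun a b hab => by
    refine oddKostka_eq_zero ?_
    rw [he, he]
    exact hab
  rw [← Matrix.det_submatrix_equiv_self e.symm, Matrix.det_of_isLowerTriangular _ h]
  have h1 : ∏ a, (kostkaMatrix k).submatrix e.symm e.symm a a = 1 :=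
    prod_eq_one fun a _ => oddKostka_self (e.symm a).1
  exact h1 ▸ isUnit_one

theorem schurK_eq_schurP (n : ℕ) (lam : YoungDiagram) : schurK n lam = schurP n lam :=
  ((kostkaSchur_unique (hsym n) lam.card (isUnit_det_kostkaMatrix _) fun mu => schurP n mu.1).1
    (hPart_eq_sum n lam.card) ⟨lam, rfl⟩).symm

/-! ### The Pieri rule for elementary polynomials -/

/-- Adding a box to each of the rows in `I`. -/
def addBoxes (l : ℕ →₀ ℕ) (I : Finset ℕ) : ℕ →₀ ℕ := l + Finsupp.indicator I fun _ _ => 1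

theorem addBoxes_apply (l : ℕ →₀ ℕ) (I : Finset ℕ) (i : ℕ) :
    addBoxes l I i = l i + if i ∈ I then 1 else 0 := by
  rw [addBoxes, Finsupp.add_apply, Finsupp.indicator_apply]
  split_ifs <;> rfl

theorem degree_addBoxes (l : ℕ →₀ ℕ) (I : Finset ℕ) :
    (addBoxes l I).degree = l.degree + I.card := by
  rw [addBoxes, map_add]
  congr 1
  rw [Finsupp.degree_apply, card_eq_sum_ones]
  refine (sum_subset (Finsupp.support_indicator_subset I _) fun i _ hi => ?_).trans ?_
  · simpa using hi
  · exact sum_congr rfl fun i hi => Finsupp.indicator_of_mem hi _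

/-- The exponent of the sign in the Pieri rule for elementary polynomials. -/
def pieriExp (l : ℕ →₀ ℕ) (I : Finset ℕ) : ℕ := ∑ i ∈ I, (i + ∑ j ∈ range i, l j)

theorem sum_range_mem {M : Type*} [AddCommMonoid M] {n : ℕ} {I : Finset ℕ} (hI : I ⊆ range n)
    (f : ℕ → M) : ∑ i ∈ range n, (if i ∈ I then f i else 0) = ∑ i ∈ I, f i := by
  rw [sum_ite_mem, inter_eq_right.2 hI]

theorem addBoxes_bound {l : ℕ →₀ ℕ} {n : ℕ} (hl : ∀ i, n ≤ i → l i = 0) {I : Finset ℕ}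
    (hI : I ⊆ range n) (i : ℕ) (hi : n ≤ i) : addBoxes l I i = 0 := by
  rw [addBoxes_apply, hl i hi, if_neg]
  intro h
  have := mem_range.1 (hI h)
  omega

theorem rowStat_addBoxes {l : ℕ →₀ ℕ} {n : ℕ} (hl : ∀ i, n ≤ i → l i = 0) {I : Finset ℕ}
    (hI : I ⊆ range n) : rowStat (addBoxes l I) = rowStat l + ∑ i ∈ I, i := by
  rw [rowStat_eq_sum_range hl, rowStat_eq_sum_range (addBoxes_bound hl hI), ← sum_range_mem hI,
    ← sum_add_distrib]
  refine sum_congr rfl fun i _ => ?_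
  rw [addBoxes_apply]
  split_ifs <;> ring

/-- All of I lies above row i0. Inserting i0 changes the cardinality by 1, the binomial by |I|,
`pieriExp` by i0 + s, `rowStat` by i0, and `crossings` by s + |I| modulo 2, where s is the sum of l
over the rows above i0; the total change is odd. Below i0, k and l agree, so `crossings` changes
there by the even number 2 l i. -/
theorem toggle_sign {l k : ℕ →₀ ℕ} {n i0 : ℕ} {I : Finset ℕ} (hl : ∀ i, n ≤ i → l i = 0)
    (hk : ∀ i, n ≤ i → k i = 0) (hi0 : i0 < n) (hI : I ⊆ range n) (h0 : i0 ∉ I)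
    (hkl : ∀ i, i0 < i → k i = l i) (hle : addBoxes l I ≤ k) :
    (-1 : ℤ) ^ ((insert i0 I).card + (insert i0 I).card.choose 2 + pieriExp l (insert i0 I) +
      (crossings k (addBoxes l (insert i0 I)) + rowStat k + rowStat (addBoxes l (insert i0 I)))) =
    -(-1) ^ (I.card + I.card.choose 2 + pieriExp l I +
      (crossings k (addBoxes l I) + rowStat k + rowStat (addBoxes l I))) := by
  have two : (2 : ZMod 2) = 0 := rfl
  have hI' : insert i0 I ⊆ range n := insert_subset (mem_range.2 hi0) hI
  have hlt : ∀ i ∈ I, i < i0 := by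
    intro i hi
    by_contra h
    have h1 : i ≠ i0 := fun e => h0 (e ▸ hi)
    have h2 := hle i
    rw [hkl i (by omega), addBoxes_apply, if_pos hi] at h2
    omega
  have hcross : (crossings k (addBoxes l (insert i0 I)) : ZMod 2) =
      crossings k (addBoxes l I) + ∑ j ∈ range i0, (l j : ZMod 2) + I.card := by
    rw [crossings_eq_sum_range hk (addBoxes_bound hl hI'),
      crossings_eq_sum_range hk (addBoxes_bound hl hI)]
    have hd : ∀ j, (addBoxes l (insert i0 I) j : ZMod 2) =
        addBoxes l I j + if i0 = j then 1 else 0 := by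
      intro j
      rw [addBoxes_apply, addBoxes_apply]
      by_cases hj : i0 = j
      · subst hj; simp [h0]
      · simp [hj, Ne.symm hj]
    have hS : ∀ i, (∑ j ∈ range i, (addBoxes l (insert i0 I) j : ZMod 2)) =
        ∑ j ∈ range i, (addBoxes l I j : ZMod 2) + if i0 < i then 1 else 0 := by
      intro i
      simp only [hd, sum_add_distrib, sum_ite_eq, mem_range]
    have hlast : (∑ j ∈ range i0, (addBoxes l I j : ZMod 2)) =
        ∑ j ∈ range i0, (l j : ZMod 2) + I.card := by
      simp only [addBoxes_apply, Nat.cast_add, sum_add_distrib]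
      congr 1
      rw [card_eq_sum_ones, Nat.cast_sum, ← sum_range_mem (fun i hi => mem_range.2 (hlt i hi))]
      refine sum_congr rfl fun i _ => ?_
      split_ifs <;> simp
    push_cast
    simp only [hS]
    simp only [hd]
    have e : ∀ i ∈ range n, ((k i : ZMod 2) + (addBoxes l I i + if i0 = i then 1 else 0)) *
        (∑ j ∈ range i, (addBoxes l I j : ZMod 2) + if i0 < i then 1 else 0) =
        ((k i : ZMod 2) + addBoxes l I i) * ∑ j ∈ range i, (addBoxes l I j : ZMod 2) +
        if i0 = i then ∑ j ∈ range i, (addBoxes l I j : ZMod 2) else 0 := by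
      intro i _
      rcases lt_trichotomy i0 i with h | rfl | h
      · have h1 : addBoxes l I i = l i := by
          rw [addBoxes_apply, if_neg, add_zero]
          intro hi
          have := hlt i hi
          omega
        rw [if_neg h.ne, if_pos h, if_neg h.ne, h1, hkl i h]
        linear_combination (l i : ZMod 2) * two
      · rw [if_pos rfl, if_neg (lt_irrefl _), if_pos rfl]
        ring
      · rw [if_neg h.ne', if_neg (by omega), if_neg h.ne']
        ring
    rw [sum_congr rfl e, sum_add_distrib, sum_ite_eq, if_pos (mem_range.2 hi0), hlast, add_assoc]
  have hc : (insert i0 I).card = I.card + 1 := card_insert_of_notMem h0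
  apply neg_one_pow_eq_of_natCast_eq_add_one
  rw [rowStat_addBoxes hl hI, rowStat_addBoxes hl hI', pieriExp, pieriExp, sum_insert h0,
    sum_insert h0, hc, Nat.choose_succ_succ' I.card 1, Nat.choose_one_right]
  push_cast
  rw [hcross]
  linear_combination (I.card + i0 + ∑ j ∈ range i0, (l j : ZMod 2)) * two

theorem sum_range_powersetCard {M : Type*} [AddCommMonoid M] (k : ℕ) (s : Finset ℕ)
    (f : Finset ℕ → M) :
    ∑ a ∈ range (k + 1), ∑ I ∈ powersetCard a s, f I =
      ∑ I ∈ s.powerset.filter fun I => I.card < k + 1, f I := by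
  rw [← sum_fiberwise_of_maps_to (t := range (k + 1)) (g := card) fun I hI => by
    simpa using (mem_filter.1 hI).2]
  refine sum_congr rfl fun a ha => sum_congr ?_ fun _ _ => rfl
  ext I
  simp only [mem_powersetCard, mem_filter, mem_powerset, mem_range] at ha ⊢
  constructor
  · rintro ⟨h1, rfl⟩; exact ⟨⟨h1, ha⟩, rfl⟩
  · rintro ⟨⟨h1, _⟩, h2⟩; exact ⟨h1, h2⟩

section

variable {R : Type*} [Ring R]

/-- A column cannot be longer than the alphabet: removing one letter takes a nonempty row i to a
nonempty row i - 1 of the smaller shape. -/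
theorem tabPoly_eq_zero (y : ℕ → R) {n i : ℕ} {l : ℕ →₀ ℕ} (hi : n ≤ i) (hl : l i ≠ 0) :
    tabPoly y n l = 0 := by
  induction n generalizing i l with
  | zero =>
    rw [tabPoly_zero, if_neg]
    rintro rfl
    simp at hl
  | succ n ih =>
    rw [tabPoly_succ]
    refine sum_eq_zero fun u hu => ?_
    obtain ⟨j, rfl⟩ : ∃ j, i = j + 1 := ⟨i - 1, by omega⟩
    have h1 := (mem_Icc.1 hu).1 j
    rw [tail_apply] at h1
    rw [ih (i := j) (by omega) (by omega), zero_mul, smul_zero]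

open Classical in
/-- The right-hand side of the Pieri rule for elementary polynomials. -/
def pieriSum (y : ℕ → R) (n : ℕ) (l : ℕ →₀ ℕ) (k : ℕ) : R :=
  ∑ I ∈ powersetCard k (range n), (-1 : ℤ) ^ pieriExp l I •
    if Antitone (addBoxes l I) then tabPoly y n (addBoxes l I) else 0

/-- The candidate products with elementary polynomials obey the same recursion against the complete
polynomials as the true ones. After expanding by the Pieri rule for the latter, the terms ending in
a fixed shape u cancel in pairs: a sign-reversing involution toggles one row in the set I. -/
theorem pieriSum_mul_complSym {y : ℕ → R} (hy : ∀ a b, a ≠ b → y a * y b = -(y b * y a)) {n : ℕ}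
    {l : ℕ →₀ ℕ} (hl : ∀ i, n ≤ i → l i = 0) (hanti : Antitone l) (k : ℕ) :
    ∑ p ∈ antidiagonal k, (-1 : ℤ) ^ (p.1 + p.1.choose 2) •
      (pieriSum y n l p.1 * complSym y n p.2) = if k = 0 then tabPoly y n l else 0 := by
  classical
  rcases Nat.eq_zero_or_pos k with rfl | hk
  · have h0 : addBoxes l ∅ = l := by ext i; rw [addBoxes_apply]; simp
    simp [pieriSum, h0, hanti, pieriExp]
  rw [if_neg hk.ne', Nat.sum_antidiagonal_eq_sum_range_succ_mk]
  have h1 : ∀ a ∈ range (k + 1), (-1 : ℤ) ^ (a + a.choose 2) •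
      (pieriSum y n l a * complSym y n (k - a)) =
      ∑ I ∈ powersetCard a (range n), ∑ u ∈ parts (l.degree + k),
        if addBoxes l I ≤ u ∧ tail u ≤ addBoxes l I then
          (-1 : ℤ) ^ (I.card + I.card.choose 2 + pieriExp l I +
            (crossings u (addBoxes l I) + rowStat u + rowStat (addBoxes l I))) • tabPoly y n u
        else 0 := by
    intro a ha
    rw [mem_range] at ha
    rw [pieriSum, sum_mul, smul_sum]
    refine sum_congr rfl fun I hI => ?_
    obtain ⟨-, rfl⟩ := mem_powersetCard.1 hI
    rw [smul_mul_assoc, smul_smul, ← pow_add, ← sum_filter]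
    have hd := degree_addBoxes l I
    split_ifs with h2
    · rw [tabPoly_mul_complSym hy, smul_sum]
      refine sum_congr ?_ fun u _ => ?_
      · ext u
        simp only [mem_filter, mem_horizStrips, mem_parts]
        constructor
        · rintro ⟨h3, h4, h5⟩
          exact ⟨⟨antitone_nat_of_succ_le fun i => (h4 i).trans (h3 i), by omega⟩, h3, h4⟩
        · rintro ⟨⟨_, h5⟩, h3, h4⟩
          exact ⟨h3, h4, by omega⟩
      · rw [smul_smul, ← pow_add]
    -- When adding the boxes does not give a partition, interlacing with it is impossible, so
    -- imposing the interlacing condition already discards the term.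
    · rw [zero_mul, smul_zero, filter_false_of_mem, sum_empty]
      rintro u - ⟨h3, h4⟩
      exact h2 (antitone_nat_of_succ_le fun i => (h3 (i + 1)).trans (h4 i))
  rw [sum_congr rfl h1, sum_range_powersetCard, sum_comm]
  refine sum_eq_zero fun u hu => ?_
  obtain ⟨hu1, hu2⟩ := mem_parts.1 hu
  by_cases hun : ∃ i, n ≤ i ∧ u i ≠ 0
  · obtain ⟨i, hi, hui⟩ := hun
    rw [tabPoly_eq_zero y hi hui]
    simp
  push Not at hun
  -- The row to toggle is the last one in which u is longer than l. There is room for its box in u,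
  -- and the box may be removed because u (i0 + 1) ≤ l (i0 + 1) ≤ l i0.
  obtain ⟨i0, hi0n, hi0, hlast⟩ : ∃ i0 < n, l i0 < u i0 ∧ ∀ i, i0 < i → u i ≤ l i := by
    have hne : ((range n).filter fun i => l i < u i).Nonempty := by
      by_contra h
      rw [not_nonempty_iff_eq_empty, filter_eq_empty_iff] at h
      have h3 : u ≤ l := fun i => by
        by_cases hi : i < n
        · exact not_lt.1 (h (mem_range.2 hi))
        · rw [hun i (by omega)]; exact Nat.zero_le _
      have := degree_le h3
      omega
    have h3 := mem_filter.1 (max'_mem _ hne)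
    refine ⟨_, mem_range.1 h3.1, h3.2, fun i hi => ?_⟩
    by_contra h4
    by_cases hin : i < n
    · have h5 := le_max' ((range n).filter fun i =>
        l i < u i) i (mem_filter.2 ⟨mem_range.2 hin, by omega⟩)
      omega
    · rw [hun i (by omega)] at h4
      omega
  have hins : ∀ I ⊆ range n, i0 ∉ I → addBoxes l I ≤ u ∧ tail u ≤ addBoxes l I →
      insert i0 I ⊆ range n ∧ addBoxes l (insert i0 I) ≤ u ∧ tail u ≤ addBoxes l (insert i0 I) := by
    rintro I hI h0 ⟨h3, h4⟩
    refine ⟨insert_subset (mem_range.2 hi0n) hI, fun i => ?_, fun i => (h4 i).trans ?_⟩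
    · by_cases hi : i = i0
      · subst hi
        rw [addBoxes_apply, if_pos (mem_insert_self _ _)]
        omega
      · refine le_trans (le_of_eq ?_) (h3 i)
        rw [addBoxes_apply, addBoxes_apply]
        simp [hi]
    · rw [addBoxes_apply, addBoxes_apply]
      by_cases hi : i ∈ I <;> simp [hi]
  have hera : ∀ I ⊆ range n, i0 ∈ I → addBoxes l I ≤ u ∧ tail u ≤ addBoxes l I →
      I.erase i0 ⊆ range n ∧ addBoxes l (I.erase i0) ≤ u ∧ tail u ≤ addBoxes l (I.erase i0) := by
    rintro I hI h0 ⟨h3, h4⟩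
    refine ⟨(erase_subset _ _).trans hI, fun i => le_trans ?_ (h3 i), fun i => ?_⟩
    · rw [addBoxes_apply, addBoxes_apply]
      by_cases hi : i ∈ I <;> simp [hi]
      split_ifs <;> omega
    · by_cases hi : i = i0
      · subst hi
        have h5 := hlast (i + 1) (Nat.lt_succ_self i)
        have h6 : l (i + 1) ≤ l i := hanti (Nat.le_succ i)
        rw [tail_apply, addBoxes_apply]
        omega
      · refine (h4 i).trans (le_of_eq ?_)
        rw [addBoxes_apply, addBoxes_apply]
        simp [hi]
  have hsign : ∀ I ⊆ range n, i0 ∉ I → addBoxes l I ≤ u → _ := fun I hI h0 h3 =>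
    toggle_sign hl hun hi0n hI h0 (fun i hi => le_antisymm (hlast i hi)
      (le_trans (by rw [addBoxes_apply]; omega) (h3 i))) h3
  -- The bound on the size of I follows from `addBoxes l I ≤ u` and |u| = |l| + k, so toggling
  -- cannot leave the index set.
  have hmem : ∀ I, I ∈ ((range n).powerset.filter fun I => I.card < k + 1).filter
      (fun I => addBoxes l I ≤ u ∧ tail u ≤ addBoxes l I) ↔
      I ⊆ range n ∧ addBoxes l I ≤ u ∧ tail u ≤ addBoxes l I := by
    intro I
    simp only [mem_filter, mem_powerset]
    refine ⟨fun h => ⟨h.1.1, h.2⟩, fun h => ⟨⟨h.1, ?_⟩, h.2⟩⟩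
    have h3 := degree_le h.2.1
    rw [degree_addBoxes] at h3
    omega
  rw [← sum_filter]
  refine sum_involution (fun I _ => if i0 ∈ I then I.erase i0 else insert i0 I) ?_ ?_ ?_ ?_
  · intro I hI
    rw [hmem] at hI
    split_ifs with h0
    · obtain ⟨h3, h4, h5⟩ := hera I hI.1 h0 hI.2
      have h6 := hsign _ h3 (notMem_erase i0 I) h4
      rw [insert_erase h0] at h6
      rw [h6, neg_smul, neg_add_cancel]
    · rw [hsign I hI.1 h0 hI.2.1, neg_smul, add_neg_cancel]
  · intro I _ _ h
    split_ifs at h with h0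
    · have h3 := notMem_erase i0 I
      rw [h] at h3
      exact h3 h0
    · exact h0 (h ▸ mem_insert_self i0 I)
  · intro I hI
    rw [hmem] at hI ⊢
    split_ifs with h0
    · exact hera I hI.1 h0 hI.2
    · exact hins I hI.1 h0 hI.2
  · intro I hI
    by_cases h0 : i0 ∈ I
    · simp [h0, insert_erase]
    · simp [h0]

/-- The Pieri rule for the elementary polynomials. -/
theorem tabPoly_mul_elemSym {y : ℕ → R} (hy : ∀ a b, a ≠ b → y a * y b = -(y b * y a)) {n : ℕ}
    {l : ℕ →₀ ℕ} (hl : ∀ i, n ≤ i → l i = 0) (hanti : Antitone l) (k : ℕ) :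
    tabPoly y n l * elemSym y n k = pieriSum y n l k := by
  -- The relation between elementary and complete polynomials, multiplied from the left by the
  -- tableau polynomial.
  have h1 : ∀ k, ∑ p ∈ antidiagonal k, (-1 : ℤ) ^ (p.1 + p.1.choose 2) •
      (tabPoly y n l * elemSym y n p.1 * complSym y n p.2) =
      if k = 0 then tabPoly y n l else 0 := by
    intro k
    have h := congrArg (tabPoly y n l * ·) (sum_elemSymRev_mul_complSym y n k)
    simp only [mul_sum, mul_ite, mul_one, mul_zero] at h
    rw [← h]
    refine sum_congr rfl fun p _ => ?_
    rw [elemSymRev_eq hy, smul_mul_assoc, smul_smul, mul_smul_comm, pow_add, mul_assoc]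
  induction k using Nat.strong_induction_on with
  | _ k ih =>
    have h2 := (h1 k).trans (pieriSum_mul_complSym hy hl hanti k).symm
    have h3 : ∀ f : ℕ × ℕ → R, ∑ p ∈ antidiagonal k, f p =
        ∑ a ∈ range k, f (a, k - a) + f (k, 0) := fun f => by
      rw [Nat.sum_antidiagonal_eq_sum_range_succ_mk, sum_range_succ, Nat.sub_self]
    -- By induction the two recursions agree in all terms but the one with complete factor of degree
    -- 0, whose coefficient is a sign and can be cancelled.
    rw [h3, h3, sum_congr rfl fun a ha => by rw [ih a (mem_range.1 ha)]] at h2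
    have h4 := add_left_cancel h2
    have h5 := congrArg ((-1 : ℤ) ^ (k + k.choose 2) • ·) h4
    simpa only [smul_smul, neg_one_pow_mul_self, one_smul, complSym_zero_right, mul_one] using h5

end

/-! ### The odd nilHecke relations -/

variable {n : ℕ}

/-- Monomials arise from 1 by left multiplications with variables. This reduces each relation
between divided differences to commuting it past one variable. -/
theorem end_eq_zero (B : Module.End ℤ (OPol n)) (h1 : B 1 = 0)
    (hX : ∀ i f, B f = 0 → B (X i * f) = 0) : B = 0 := by
  have key : ∀ g f, B f = 0 → B (g * f) = 0 := by
    intro g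
    obtain ⟨g, rfl⟩ := mkHom_surjective n g
    induction g using FreeAlgebra.induction with
    | grade0 c =>
      intro f hf
      have : mkHom n (algebraMap ℤ _ c) = (c : OPol n) := by simp
      rw [this, ← zsmul_eq_mul, map_zsmul, hf, smul_zero]
    | grade1 j => exact hX j
    | mul a b ha hb => intro f hf; rw [map_mul (mkHom n), mul_assoc]; exact ha _ (hb _ hf)
    | add a b ha hb => intro f hf; rw [map_add (mkHom n), add_mul, map_add B, ha _ hf, hb _ hf,
      add_zero]
  ext g
  have := key g 1 h1
  rwa [mul_one] at this

/-- The odd divided difference with a natural number index, zero when out of range. -/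
def divNat (n i : ℕ) : Module.End ℤ (OPol n) := if h : i < n - 1 then oddDiv ⟨i, h⟩ else 0

/-- The simple transposition with a natural number index, the identity when out of range. -/
def actNat (n i : ℕ) : OPol n →+* OPol n := if h : i < n - 1 then simpleAct ⟨i, h⟩ else RingHom.id _

theorem divNat_one (i : ℕ) : divNat n i 1 = 0 := by
  unfold divNat
  split_ifs with h
  · exact oddDiv_one _
  · rfl

theorem divNat_mul (i : ℕ) (f g : OPol n) :
    divNat n i (f * g) = divNat n i f * g + actNat n i f * divNat n i g := by
  unfold divNat actNat
  split_ifs with h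
  · exact oddDiv_mul _ f g
  · simp

theorem x_of_lt {a : ℕ} (h : a < n) : x n a = X ⟨a, h⟩ := dif_pos h

theorem divNat_x_self {i : ℕ} (h : i < n - 1) : divNat n i (x n i) = 1 := by
  rw [divNat, dif_pos h, x_of_lt (by omega), oddDiv_X]
  exact if_pos (Or.inl rfl)

theorem divNat_x_succ {i : ℕ} (h : i < n - 1) : divNat n i (x n (i + 1)) = 1 := by
  rw [divNat, dif_pos h, x_of_lt (by omega), oddDiv_X]
  exact if_pos (Or.inr rfl)

theorem divNat_x_of_ne {i a : ℕ} (h1 : a ≠ i) (h2 : a ≠ i + 1) : divNat n i (x n a) = 0 := by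
  unfold divNat
  split_ifs with h
  · by_cases ha : a < n
    · rw [x_of_lt ha, oddDiv_X, if_neg]
      simp [lo, hi, Fin.ext_iff, h1, h2]
    · rw [x, dif_neg ha, map_zero]
  · rfl

theorem actNat_x_self {i : ℕ} (h : i < n - 1) : actNat n i (x n i) = -x n (i + 1) := by
  rw [actNat, dif_pos h, x_of_lt (by omega), x_of_lt (by omega), simpleAct_X]
  congr 2
  exact Equiv.swap_apply_left _ _

theorem actNat_x_succ {i : ℕ} (h : i < n - 1) : actNat n i (x n (i + 1)) = -x n i := by
  rw [actNat, dif_pos h, x_of_lt (by omega), x_of_lt (by omega), simpleAct_X]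
  congr 2
  exact Equiv.swap_apply_right _ _

theorem actNat_x_of_ne {i a : ℕ} (h : i < n - 1) (h1 : a ≠ i) (h2 : a ≠ i + 1) :
    actNat n i (x n a) = -x n a := by
  rw [actNat, dif_pos h]
  by_cases ha : a < n
  · rw [x_of_lt ha, simpleAct_X, Equiv.swap_apply_of_ne_of_ne]
    · simpa [lo, Fin.ext_iff] using h1
    · simpa [hi, Fin.ext_iff] using h2
  · rw [x, dif_neg ha, map_zero, neg_zero]

theorem divNat_self_mul {i : ℕ} (h : i < n - 1) (f : OPol n) :
    divNat n i (x n i * f) = f - x n (i + 1) * divNat n i f := by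
  rw [divNat_mul, divNat_x_self h, actNat_x_self h]; noncomm_ring

theorem divNat_succ_mul {i : ℕ} (h : i < n - 1) (f : OPol n) :
    divNat n i (x n (i + 1) * f) = f - x n i * divNat n i f := by
  rw [divNat_mul, divNat_x_succ h, actNat_x_succ h]; noncomm_ring

theorem divNat_mul_of_ne {i a : ℕ} (h : i < n - 1) (h1 : a ≠ i) (h2 : a ≠ i + 1) (f : OPol n) :
    divNat n i (x n a * f) = -(x n a * divNat n i f) := by
  rw [divNat_mul, divNat_x_of_ne h1 h2, actNat_x_of_ne h h1 h2]; noncomm_ring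

/-- Two applications of the Leibniz rule cancel the terms with a single ∂_i; for instance ∂_i ∂_i
(x_i f) = x_i ∂_i ∂_i f. -/
theorem divNat_divNat (i : ℕ) (f : OPol n) : divNat n i (divNat n i f) = 0 := by
  by_cases h : i < n - 1
  · have : divNat n i * divNat n i = 0 := by
      apply end_eq_zero
      · rw [Module.End.mul_apply, divNat_one, map_zero]
      · intro a f hf
        rw [Module.End.mul_apply] at hf ⊢
        have e : X a = x n a := (x_of_lt a.2).symm
        rw [e]
        by_cases h1 : (a : ℕ) = i
        · rw [h1, divNat_self_mul h, map_sub, divNat_succ_mul h, hf]; simp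
        · by_cases h2 : (a : ℕ) = i + 1
          · rw [h2, divNat_succ_mul h, map_sub, divNat_self_mul h, hf]; simp
          · rw [divNat_mul_of_ne h h1 h2, map_neg, divNat_mul_of_ne h h1 h2, hf]; simp
    exact LinearMap.congr_fun this f
  · rw [divNat, dif_neg h]; rfl

theorem divNat_anticomm {i j : ℕ} (hij : i + 1 < j) (f : OPol n) :
    divNat n i (divNat n j f) = -divNat n j (divNat n i f) := by
  by_cases hj : j < n - 1
  · have hi : i < n - 1 := by omega
    have : divNat n i * divNat n j + divNat n j * divNat n i = 0 := by
      apply end_eq_zero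
      · simp [divNat_one]
      · intro a f hf
        simp only [LinearMap.add_apply, Module.End.mul_apply] at hf ⊢
        have hf' := eq_neg_of_add_eq_zero_left hf
        have e : X a = x n a := (x_of_lt a.2).symm
        rw [e]
        by_cases h1 : (a : ℕ) = i
        · rw [h1, divNat_self_mul hi, divNat_mul_of_ne hj (by omega) (by omega), map_neg, map_sub,
            divNat_mul_of_ne hj (by omega) (by omega), divNat_self_mul hi, hf']; noncomm_ring
        by_cases h2 : (a : ℕ) = i + 1
        · rw [h2, divNat_succ_mul hi, divNat_mul_of_ne hj (by omega) (by omega), map_neg, map_sub,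
            divNat_mul_of_ne hj (by omega) (by omega), divNat_succ_mul hi, hf']; noncomm_ring
        by_cases h3 : (a : ℕ) = j
        · rw [h3, divNat_self_mul hj, divNat_mul_of_ne hi (by omega) (by omega), map_neg, map_sub,
            divNat_mul_of_ne hi (by omega) (by omega), divNat_self_mul hj, hf']; noncomm_ring
        by_cases h4 : (a : ℕ) = j + 1
        · rw [h4, divNat_succ_mul hj, divNat_mul_of_ne hi (by omega) (by omega), map_neg, map_sub,
            divNat_mul_of_ne hi (by omega) (by omega), divNat_succ_mul hj, hf']; noncomm_ring
        · rw [divNat_mul_of_ne hj h3 h4, divNat_mul_of_ne hi h1 h2, map_neg, map_neg,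
            divNat_mul_of_ne hj h3 h4, divNat_mul_of_ne hi h1 h2, hf']; noncomm_ring
    exact eq_neg_of_add_eq_zero_left (LinearMap.congr_fun this f)
  · simp [divNat, hj]

/-- Only left multiplication by x_i, x_{i+1} and x_{i+2} needs the full Leibniz rule; every other
variable anticommutes with both operators. -/
theorem divNat_braid (i : ℕ) (f : OPol n) :
    divNat n i (divNat n (i + 1) (divNat n i f)) =
      divNat n (i + 1) (divNat n i (divNat n (i + 1) f)) := by
  by_cases hj : i + 1 < n - 1
  · have hi : i < n - 1 := by omega
    have : divNat n i * divNat n (i + 1) * divNat n i -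
        divNat n (i + 1) * divNat n i * divNat n (i + 1) = 0 := by
      apply end_eq_zero
      · simp [divNat_one]
      · intro a f hf
        simp only [LinearMap.sub_apply, Module.End.mul_apply] at hf ⊢
        have hf' := sub_eq_zero.1 hf
        have e : X a = x n a := (x_of_lt a.2).symm
        have l1 := fun f : OPol n => divNat_self_mul hi f
        have l2 := fun f : OPol n => divNat_succ_mul hi f
        have l3 := fun f : OPol n => divNat_self_mul hj f
        have l4 := fun f : OPol n => divNat_succ_mul hj f
        have l5 := fun f : OPol n =>
          divNat_mul_of_ne (a := i + 1 + 1) hi (by omega) (by omega) f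
        have l6 := fun f : OPol n => divNat_mul_of_ne (a := i) hj (by omega) (by omega) f
        rw [e]
        by_cases h1 : (a : ℕ) = i
        · rw [h1]
          simp only [l1, l3, l5, l6, map_sub, map_neg, divNat_divNat, hf']; noncomm_ring
        by_cases h2 : (a : ℕ) = i + 1
        · rw [h2]
          simp only [l1, l2, l3, l4, l5, l6, map_sub, map_neg, hf']; noncomm_ring
        by_cases h3 : (a : ℕ) = i + 1 + 1
        · rw [h3]
          simp only [l2, l4, l5, l6, map_sub, map_neg, divNat_divNat, hf']; noncomm_ring
        · have l7 := fun f : OPol n => divNat_mul_of_ne (a := a) hi h1 h2 f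
          have l8 := fun f : OPol n => divNat_mul_of_ne (a := a) hj h2 h3 f
          simp only [l7, l8, map_neg, hf']; noncomm_ring
    exact sub_eq_zero.1 (LinearMap.congr_fun this f)
  · simp [divNat, hj]

/-! ### The longest divided difference operator -/

/-- The operator `∂_{m-1} ⋯ ∂_0`. -/
def divCycle (n : ℕ) : ℕ → Module.End ℤ (OPol n)
  | 0 => 1
  | m + 1 => divNat n m * divCycle n m

/-- The longest operator in `∂_0, …, ∂_{m-1}`. -/
def divLong (n : ℕ) : ℕ → Module.End ℤ (OPol n)
  | 0 => 1
  | m + 1 => divLong n m * divCycle n (m + 1)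

theorem divCycle_eq (m : ℕ) :
    divCycle n m = ((List.range m).reverse.map (divNat n)).prod := by
  induction m with
  | zero => rfl
  | succ m ih =>
    rw [divCycle, ih, List.range_succ, List.reverse_append, List.map_append, List.prod_append]
    simp

theorem divLong_eq (m : ℕ) :
    divLong n m = ((List.range m).map fun k => divCycle n (k + 1)).prod := by
  induction m with
  | zero => rfl
  | succ m ih =>
    rw [divLong, ih, List.range_succ, List.map_append, List.prod_append]
    simp

theorem filter_range_le {k N : ℕ} (h : k < N) :
    (List.range N).filter (fun i => decide (i ≤ k)) = List.range (k + 1) := by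
  induction N with
  | zero => omega
  | succ N ih =>
    rcases Nat.lt_succ_iff_lt_or_eq.1 h with h1 | rfl
    · rw [List.range_succ, List.filter_append, ih h1]
      simp [h1]
    · rw [List.filter_eq_self]
      intro a ha
      have := List.mem_range.1 ha
      simpa using (by omega : a ≤ k)

theorem oddDivLongest_eq (n : ℕ) : oddDivLongest n = divLong n (n - 1) := by
  rw [divLong_eq, oddDivLongest, List.map_flatMap, List.flatMap, List.prod_flatten, List.map_map,
    ← List.map_coe_finRange_eq_range, List.map_map]
  congr 1
  refine List.map_congr_left fun k _ => ?_
  simp only [Function.comp_apply]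
  rw [divCycle_eq]
  have h1 : ((List.finRange (n - 1)).filter fun i => decide (i ≤ k)).map Fin.val =
      List.range (k + 1) := by
    have h2 : (fun i : Fin (n - 1) => decide (i ≤ k)) =
      (fun i : ℕ => decide (i ≤ k)) ∘ Fin.val := by
      funext i; simp
    rw [h2, ← List.filter_map, List.map_coe_finRange_eq_range]
    exact filter_range_le k.2
  rw [← h1, ← List.map_reverse, List.map_map]
  congr 1
  refine List.map_congr_left fun i _ => ?_
  rw [Function.comp_apply, divNat, dif_pos i.2]

/-- The operators in the cycle have indices at most p - 1 ≤ a - 2, so ∂_a anticommutes with each of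
them. -/
theorem divNat_divCycle_of_lt {a p : ℕ} (h : p < a) {f : OPol n} (hf : divNat n a f = 0) :
    divNat n a (divCycle n p f) = 0 := by
  induction p with
  | zero => exact hf
  | succ p ih =>
    have := divNat_anticomm (n := n) (i := p) (j := a) (by omega) (divCycle n p f)
    rw [ih (by omega), map_zero] at this
    exact neg_eq_zero.1 this.symm

theorem divCycle_eq_zero {m : ℕ} {f : OPol n} (hf : divNat n 0 f = 0) :
    divCycle n (m + 1) f = 0 := by
  induction m with
  | zero => exact hf
  | succ m ih => rw [divCycle, Module.End.mul_apply, ih, map_zero]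

/-- Up to sign, ∂_p followed rightwards through the cycle becomes ∂_{p+1}: it anticommutes with the
operators of index above p + 1, the braid relation turns ∂_p ∂_{p+1} ∂_p into ∂_{p+1} ∂_p ∂_{p+1},
and ∂_{p+1} then anticommutes with the rest. -/
theorem divNat_divCycle {p m : ℕ} (h : p + 1 < m) {f : OPol n} (hf : divNat n (p + 1) f = 0) :
    divNat n p (divCycle n m f) = 0 := by
  induction m with
  | zero => omega
  | succ m ih =>
    rw [divCycle, Module.End.mul_apply]
    by_cases hm : m = p + 1
    · subst hm
      rw [divCycle, Module.End.mul_apply, divNat_braid,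
        divNat_divCycle_of_lt (Nat.lt_succ_self p) hf,
        map_zero, map_zero]
    · rw [divNat_anticomm (by omega), ih (by omega), map_zero, neg_zero]

/-- The first cycle applied kills f if i = 0, because it begins with ∂_0. Otherwise it turns
vanishing under ∂_i into vanishing under ∂_{i-1}, and the shorter longest operator takes over. -/
theorem divLong_eq_zero {i m : ℕ} (h : i < m) {f : OPol n} (hf : divNat n i f = 0) :
    divLong n m f = 0 := by
  induction m generalizing i f with
  | zero => omega
  | succ m ih =>
    rw [divLong, Module.End.mul_apply]
    cases i with
    | zero => rw [divCycle_eq_zero hf, map_zero]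
    | succ p => exact ih (i := p) (by omega) (divNat_divCycle h hf)

/-- Right linearity over odd symmetric polynomials: if ∂_i g = 0, the Leibniz rule reduces to ∂_i (f
g) = ∂_i (f) g. -/
theorem divLong_mul (m : ℕ) (f : OPol n) {g : OPol n} (hg : ∀ i, divNat n i g = 0) :
    divLong n m (f * g) = divLong n m f * g := by
  have h : ∀ m f, divCycle n m (f * g) = divCycle n m f * g := by
    intro m
    induction m with
    | zero => intro f; rfl
    | succ m ih =>
      intro f
      rw [divCycle, Module.End.mul_apply, ih, divNat_mul, hg, mul_zero, add_zero]
      rfl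
  induction m generalizing f with
  | zero => rfl
  | succ m ih => rw [divLong, Module.End.mul_apply, h, ih]; rfl

/-! ### The kernels of the divided differences -/

/-- The kernel of a divided difference is a subring. -/
def divKer (n i : ℕ) : Subring (OPol n) where
  carrier := {f | divNat n i f = 0}
  mul_mem' {f g} hf hg := by
    simp only [Set.mem_ofPred_eq] at *
    rw [divNat_mul, hf, hg]; simp
  one_mem' := divNat_one i
  add_mem' {f g} hf hg := by
    simp only [Set.mem_ofPred_eq] at *
    rw [map_add, hf, hg, add_zero]
  zero_mem' := map_zero _
  neg_mem' {f} hf := by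
    simp only [Set.mem_ofPred_eq] at *
    rw [map_neg, hf, neg_zero]

theorem mem_divKer {i : ℕ} {f : OPol n} : f ∈ divKer n i ↔ divNat n i f = 0 := Iff.rfl

theorem mem_OddSym_iff {f : OPol n} : f ∈ OddSym n ↔ ∀ i, f ∈ divKer n i := by
  constructor
  · intro h i
    rw [mem_divKer, divNat]
    split_ifs with hi
    · exact h ⟨i, hi⟩
    · rfl
  · intro h i
    have := h i
    rwa [mem_divKer, divNat, dif_pos i.2] at this

theorem neg_one_pow_mem (S : Subring (OPol n)) (a : ℕ) : (-1 : OPol n) ^ a ∈ S :=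
  pow_mem (neg_mem (one_mem S)) a

theorem xt_mem_divKer {i a : ℕ} (h1 : a ≠ i) (h2 : a ≠ i + 1) : xt n a ∈ divKer n i :=
  mul_mem (neg_one_pow_mem _ a) (divNat_x_of_ne h1 h2)

theorem xt_eq_zsmul (n a : ℕ) : xt n a = (-1 : ℤ) ^ a • x n a := by
  rw [xt, zsmul_eq_mul]
  simp

/-- This is where the alternating signs of the variables matter: ∂_i takes the value 1 on both x_i
and x_{i+1}. -/
theorem xt_add_xt_mem_divKer {i : ℕ} (h : i < n - 1) : xt n i + xt n (i + 1) ∈ divKer n i := by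
  rw [mem_divKer, xt_eq_zsmul, xt_eq_zsmul, map_add, map_zsmul, map_zsmul, divNat_x_self h,
    divNat_x_succ h, ← add_smul]
  simp [pow_succ]

theorem xt_mul_xt_mem_divKer {i : ℕ} (h : i < n - 1) : xt n i * xt n (i + 1) ∈ divKer n i := by
  rw [mem_divKer, xt_eq_zsmul, xt_eq_zsmul, smul_mul_smul_comm, map_zsmul, divNat_self_mul h,
    divNat_x_succ h, mul_one, sub_self, smul_zero]

/-- By anticommutation this is, up to sign, a power of the product of the two variables, which lies
in the kernel. -/
theorem xt_pow_mul_xt_pow_mem_divKer {i : ℕ} (h : i < n - 1) (a : ℕ) :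
    xt n i ^ a * xt n (i + 1) ^ a ∈ divKer n i := by
  induction a with
  | zero => simp
  | succ a ih =>
    have e : xt n i ^ a * (xt n i * xt n (i + 1)) =
        (-1 : ℤ) ^ a • (xt n i * xt n (i + 1) * xt n i ^ a) := by
      clear ih
      induction a with
      | zero => simp
      | succ a ih =>
        have h1 : xt n i * (xt n i * xt n (i + 1)) = -(xt n i * xt n (i + 1) * xt n i) := by
          rw [mul_assoc (xt n i) (xt n (i + 1)), xt_anticomm n (i + 1) i (by omega), mul_neg,
            neg_neg]
        rw [pow_succ, mul_assoc, h1, mul_neg, ← mul_assoc, ih, smul_mul_assoc, mul_assoc,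
          ← pow_succ,
          pow_succ (-1 : ℤ) a, mul_neg_one, neg_smul]
    rw [pow_succ, pow_succ', mul_assoc, ← mul_assoc (xt n i), ← mul_assoc, e, smul_mul_assoc,
      mul_assoc]
    exact zsmul_mem (mul_mem (xt_mul_xt_mem_divKer h) ih) _

/-- The two variables moved by s_i enter only through an equal-power product, and the others are
killed by ∂_i. This makes the symmetrization of such a monomial vanish. -/
theorem monomial_mem_divKer {i : ℕ} (h : i < n - 1) {c : ℕ → ℕ} (hc : c i = c (i + 1)) {m : ℕ}
    (hm : m ≤ i ∨ i + 2 ≤ m) : monomial (xt n) m c ∈ divKer n i := by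
  induction m with
  | zero => exact one_mem _
  | succ m ih =>
    by_cases h1 : m = i + 1
    · subst h1
      have h2 : ∀ m ≤ i, monomial (xt n) m c ∈ divKer n i := by
        intro m hm
        induction m with
        | zero => exact one_mem _
        | succ m ih =>
          exact mul_mem (ih (by omega)) (pow_mem (xt_mem_divKer (by omega) (by omega)) _)
      rw [monomial, monomial, mul_assoc, ← hc]
      exact mul_mem (h2 i le_rfl) (xt_pow_mul_xt_pow_mem_divKer h _)
    · exact mul_mem (ih (by omega)) (pow_mem (xt_mem_divKer (by omega) (by omega)) _)

/-- The variables with indices i and i + 1 enter an elementary polynomial only through their sum and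
their ordered product, both killed by ∂_i. -/
theorem elemSym_mem_divKer {i : ℕ} (h : i < n - 1) {m : ℕ} (hm : m ≤ i ∨ i + 2 ≤ m) (k : ℕ) :
    elemSym (xt n) m k ∈ divKer n i := by
  induction m generalizing k with
  | zero =>
    cases k with
    | zero => exact one_mem _
    | succ k => exact zero_mem _
  | succ m ih =>
    by_cases h1 : m = i + 1
    · subst h1
      have h2 : ∀ m ≤ i, ∀ k, elemSym (xt n) m k ∈ divKer n i := by
        intro m hm
        induction m with
        | zero =>
          intro k
          cases k with
          | zero => exact one_mem _
          | succ k => exact zero_mem _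
        | succ m ih =>
          intro k
          cases k with
          | zero => exact one_mem _
          | succ k =>
            exact add_mem (ih (by omega) _)
              (mul_mem (ih (by omega) _) (xt_mem_divKer (by omega) (by omega)))
      match k with
      | 0 => exact one_mem _
      | 1 =>
        have e : elemSym (xt n) (i + 1 + 1) 1 = elemSym (xt n) i 1 + (xt n i + xt n (i + 1)) := by
          simp only [elemSym, elemSym_zero_right, one_mul, add_assoc]
        rw [e]
        exact add_mem (h2 i le_rfl 1) (xt_add_xt_mem_divKer h)
      | k + 2 =>
        have e : elemSym (xt n) (i + 1 + 1) (k + 2) = elemSym (xt n) i (k + 2) +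
            elemSym (xt n) i (k + 1) * (xt n i + xt n (i + 1)) +
            elemSym (xt n) i k * (xt n i * xt n (i + 1)) := by
          simp only [elemSym]
          noncomm_ring
        rw [e]
        exact add_mem (add_mem (h2 i le_rfl _) (mul_mem (h2 i le_rfl _) (xt_add_xt_mem_divKer h)))
          (mul_mem (h2 i le_rfl _) (xt_mul_xt_mem_divKer h))
    · cases k with
      | zero => exact one_mem _
      | succ k =>
        exact add_mem (ih (by omega) _)
          (mul_mem (ih (by omega) _) (xt_mem_divKer (by omega) (by omega)))

theorem elemSym_mem_OddSym (k : ℕ) : elemSym (xt n) n k ∈ OddSym n := by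
  rw [mem_OddSym_iff]
  intro i
  by_cases h : i < n - 1
  · exact elemSym_mem_divKer h (by omega) k
  · rw [mem_divKer, divNat, dif_neg h]; rfl

/-- The relation with the elementary polynomials expresses each complete polynomial through
elementary ones and complete ones of lower degree. -/
theorem complSym_mem_OddSym (k : ℕ) : complSym (xt n) n k ∈ OddSym n := by
  induction k using Nat.strong_induction_on with
  | _ k ih =>
    have h := sum_elemSymRev_mul_complSym (xt n) n k
    cases k with
    | zero => rw [complSym_zero_right]; exact one_mem _
    | succ k =>
      rw [Nat.sum_antidiagonal_succ, if_neg (by omega)] at h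
      simp only [elemSymRev_zero_right, one_mul, pow_zero, one_smul] at h
      rw [eq_neg_of_add_eq_zero_left h]
      refine neg_mem (sum_mem fun p hp => zsmul_mem (mul_mem ?_ (ih _ ?_)) _)
      · rw [elemSymRev_eq (xt_anticomm n)]
        exact zsmul_mem (elemSym_mem_OddSym _) _
      · have := HasAntidiagonal.mem_antidiagonal.1 hp
        omega

/-! ### Odd symmetry of products of complete polynomials and of the Kostka Schur functions -/

theorem hsym_mem_OddSym (k : ℕ) : hsym n k ∈ OddSym n := by
  rw [hsym_eq]
  exact complSym_mem_OddSym k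

theorem hPart_mem {R : Type} [Ring R] (S : Subring R) {h : ℕ → R} (hh : ∀ k, h k ∈ S)
    (mu : YoungDiagram) : hPart h mu ∈ S :=
  list_prod_mem fun r hr => by
    obtain ⟨k, _, rfl⟩ := List.mem_map.1 hr
    exact hh k

theorem kostkaSchur_mem {R : Type} [Ring R] (S : Subring R) {h : ℕ → R} (hh : ∀ k, h k ∈ S)
    (lam : YoungDiagram) : kostkaSchur h lam ∈ S :=
  sum_mem fun mu _ => zsmul_mem (hPart_mem S hh mu.1) _

/-! ### Divided differences of monomials -/

section

variable {R : Type*} [Ring R] {y : ℕ → R}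

/-- The letters of a strictly increasing word are moved into the monomial one after another. Letters
inserted earlier have smaller index, so y_i only passes the original powers of the later variables.
-/
theorem monomial_mul_elemSym (hy : ∀ a b, a ≠ b → y a * y b = -(y b * y a)) {N m : ℕ} (hm : m ≤ N)
    (c : ℕ → ℕ) (k : ℕ) :
    monomial y N c * elemSym y m k = ∑ I ∈ powersetCard k (range m),
      (-1 : ℤ) ^ (∑ i ∈ I, ∑ j ∈ Ico (i + 1) N, c j) •
        monomial y N fun i => c i + if i ∈ I then 1 else 0 := by
  induction m generalizing k with
  | zero =>
    cases k with
    | zero => simp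
    | succ k =>
      rw [range_zero, powersetCard_eq_empty.2 (by simp), sum_empty]
      simp [elemSym]
  | succ m ih =>
    cases k with
    | zero => simp
    | succ k =>
      have hnot : m ∉ range m := by simp
      rw [elemSym, mul_add, ih (by omega), ← mul_assoc, ih (by omega), range_add_one,
        powersetCard_succ_insert hnot, sum_union, sum_image]
      · congr 1
        rw [sum_mul]
        refine sum_congr rfl fun I hI => ?_
        have hI' := (mem_powersetCard.1 hI).1
        have hmI : m ∉ I := fun h => hnot (hI' h)
        rw [smul_mul_assoc, monomial_mul hy (by omega), smul_smul, sum_insert hmI, pow_add,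
          mul_comm ((-1 : ℤ) ^ _)]
        congr 2
        · congr 1
          refine sum_congr rfl fun j hj => ?_
          rw [if_neg, add_zero]
          intro h
          have h1 := mem_range.1 (hI' h)
          have h2 := mem_Ico.1 hj
          omega
        · funext i
          by_cases hi : i = m
          · subst hi; simp [hmI]
          · simp [hi]
      · intro I hI J hJ e
        have h1 : m ∉ I := fun h => hnot ((mem_powersetCard.1 hI).1 h)
        have h2 : m ∉ J := fun h => hnot ((mem_powersetCard.1 hJ).1 h)
        rw [← erase_insert h1, ← erase_insert h2, e]
      · rw [disjoint_left]
        intro I hI hI'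
        obtain ⟨J, _, rfl⟩ := mem_image.1 hI'
        exact hnot ((mem_powersetCard.1 hI).1 (mem_insert_self m J))

theorem monomial_mul_pow (hy : ∀ a b, a ≠ b → y a * y b = -(y b * y a)) (m : ℕ) (c : ℕ → ℕ)
    (e : ℕ) : y m ^ e * monomial y m c = (-1 : ℤ) ^ (e * ∑ i ∈ range m, c i) •
      (monomial y m c * y m ^ e) := by
  induction e with
  | zero => simp
  | succ e ih =>
    have h := monomial_mul_of_anticomm (y := y) (a := y m) (m := m)
      (fun i hi => hy _ _ (by omega)) c
    have h2 : y m * monomial y m c = (-1 : ℤ) ^ (∑ i ∈ range m, c i) • (monomial y m c * y m) := by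
      rw [h, smul_smul, neg_one_pow_mul_self, one_smul]
    rw [pow_succ, mul_assoc, h2, mul_smul_comm, ← mul_assoc, ih, smul_mul_assoc, smul_smul,
      mul_assoc, ← pow_succ, ← pow_add]
    congr 2
    ring

theorem monomial_mul_monomial (hy : ∀ a b, a ≠ b → y a * y b = -(y b * y a)) (m : ℕ)
    (c d : ℕ → ℕ) :
    monomial y m c * monomial y m d = (-1 : ℤ) ^ (∑ i ∈ range m, c i * ∑ j ∈ range i, d j) •
      monomial y m fun i => c i + d i := by
  induction m with
  | zero => simp [monomial]
  | succ m ih =>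
    rw [monomial, monomial, monomial, mul_assoc, ← mul_assoc (y m ^ c m), monomial_mul_pow hy,
      smul_mul_assoc, mul_smul_comm, mul_assoc (monomial y m d), ← pow_add, ← mul_assoc, ih,
      smul_mul_assoc, smul_smul, sum_range_succ, ← pow_add, add_comm]

theorem monomial_zsmul (e : ℕ → ℕ) (m : ℕ) (c : ℕ → ℕ) :
    monomial (fun a => (-1 : ℤ) ^ e a • y a) m c =
      (-1 : ℤ) ^ (∑ i ∈ range m, e i * c i) • monomial y m c := by
  induction m with
  | zero => simp [monomial]
  | succ m ih =>
    rw [monomial, monomial, ih, smul_pow, smul_mul_smul_comm, sum_range_succ, pow_add,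
      pow_mul _ (e m)]

/-! ### Elementary and complete polynomials under homomorphisms, rescaling and reversal of the
variables -/

theorem map_elemSym {S : Type*} [Ring S] (f : R →+* S) (m k : ℕ) :
    f (elemSym y m k) = elemSym (fun a => f (y a)) m k := by
  induction m generalizing k with
  | zero => cases k <;> simp [elemSym]
  | succ m ih => cases k <;> simp [elemSym, ih]

theorem map_complSym {S : Type*} [Ring S] (f : R →+* S) (m k : ℕ) :
    f (complSym y m k) = complSym (fun a => f (y a)) m k := by
  induction m generalizing k with
  | zero => cases k <;> simp [complSym]
  | succ m ih =>
    induction k with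
    | zero => simp
    | succ k ihk => simp [complSym, ih, ihk]

theorem elemSym_congr {z : ℕ → R} {m : ℕ} (h : ∀ a < m, y a = z a) (k : ℕ) :
    elemSym y m k = elemSym z m k := by
  induction m generalizing k with
  | zero => cases k <;> rfl
  | succ m ih =>
    cases k with
    | zero => rfl
    | succ k =>
      rw [elemSym, elemSym, ih fun a ha => h a (by omega), ih fun a ha => h a (by omega),
        h m (by omega)]

theorem elemSym_zsmul (c : ℤ) (m k : ℕ) :
    elemSym (fun a => c • y a) m k = c ^ k • elemSym y m k := by
  induction m generalizing k with
  | zero => cases k <;> simp [elemSym]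
  | succ m ih =>
    cases k with
    | zero => simp
    | succ k =>
      rw [elemSym, elemSym, ih, ih, smul_add, smul_mul_smul_comm, pow_succ]

theorem elemSym_succ_left (y : ℕ → R) (m k : ℕ) :
    elemSym y (m + 1) (k + 1) =
      elemSym (fun a => y (a + 1)) m (k + 1) + y 0 * elemSym (fun a => y (a + 1)) m k := by
  induction m generalizing k with
  | zero => cases k <;> simp [elemSym]
  | succ m ih =>
    rw [elemSym, ih, elemSym]
    cases k with
    | zero => simp [add_right_comm]
    | succ k =>
      rw [ih]
      simp only [elemSym]
      noncomm_ring

theorem elemSym_reverse (y : ℕ → R) (m k : ℕ) :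
    elemSym (fun a => y (m - 1 - a)) m k = elemSymRev y m k := by
  induction m generalizing k with
  | zero => cases k <;> rfl
  | succ m ih =>
    cases k with
    | zero => rfl
    | succ k =>
      have h : ∀ k, elemSym (fun a => y (m + 1 - 1 - (a + 1))) m k = elemSymRev y m k := by
        intro k
        rw [← ih]
        refine elemSym_congr (fun a _ => ?_) k
        congr 1
        omega
      rw [elemSym_succ_left, h, h, elemSymRev]
      simp

end

/-! ### Two families of polynomials with the same Pieri rule -/

theorem sign_revPerm (n : ℕ) :
    (Equiv.Perm.sign (Fin.revPerm : Equiv.Perm (Fin n)) : ℤ) = (-1) ^ ∑ j ∈ range n, j := by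
  rw [Equiv.Perm.sign_eq_prod_prod_Iio, ← prod_pow_eq_pow_sum,
    ← Fin.prod_univ_eq_prod_range (fun j => (-1 : ℤ) ^ j), Units.coe_prod]
  refine prod_congr rfl fun j _ => ?_
  rw [Units.coe_prod, ← Fin.card_Iio j, ← prod_const]
  refine prod_congr rfl fun i hi => ?_
  rw [if_neg]
  · rfl
  · rw [Fin.revPerm_apply, Fin.revPerm_apply, Fin.rev_lt_rev]
    exact not_lt.2 (mem_Iio.1 hi).le

/-- The sign does not depend on a: replacing (-1)^a by (-1)^(n-1-a) costs (-1)^(n-1), and the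
permutation itself contributes its sign. -/
theorem permAct_revPerm_xt {a : ℕ} (ha : a < n) :
    permAct Fin.revPerm (xt n a) =
      (-1 : ℤ) ^ (∑ j ∈ range n, j + (n - 1)) • xt n (n - 1 - a) := by
  have e : (Fin.revPerm ⟨a, ha⟩ : Fin n) = ⟨n - 1 - a, by omega⟩ := by
    ext; simp [Fin.rev]; omega
  rw [xt_eq_zsmul, xt_eq_zsmul, x_of_lt ha, map_zsmul, permAct_X, sign_revPerm, e,
    x_of_lt (by omega : n - 1 - a < n), smul_smul, smul_smul, ← pow_add, ← pow_add]
  congr 1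
  have h : ∀ b, n - 1 = a + b →
      (-1 : ℤ) ^ (a + ∑ j ∈ range n, j) = (-1) ^ (∑ j ∈ range n, j + (n - 1) + b) := by
    intro b hb
    rw [hb]
    apply neg_one_pow_eq_of_natCast_eq
    have two : (2 : ZMod 2) = 0 := rfl
    push_cast
    linear_combination -(b : ZMod 2) * two
  exact h _ (by omega)

/-- The longest permutation reverses the order of the signed variables up to a common sign, so it
sends increasing words to decreasing ones, and reordering these gives back the elementary
polynomial. -/
theorem permAct_revPerm_elemSym (n k : ℕ) :
    permAct Fin.revPerm (elemSym (xt n) n k) =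
      (-1 : ℤ) ^ ((∑ j ∈ range n, j + (n - 1)) * k + k.choose 2) • elemSym (xt n) n k := by
  rw [map_elemSym, elemSym_congr fun a ha => permAct_revPerm_xt ha, elemSym_zsmul, elemSym_reverse,
    elemSymRev_eq (xt_anticomm n), smul_smul, ← pow_mul, ← pow_add]

/-- The odd symmetrization of a monomial. -/
def symmetrize (n : ℕ) (c : ℕ → ℕ) : OPol n :=
  permAct Fin.revPerm (divLong n (n - 1) (monomial (xt n) n c))

theorem symmetrize_eq_zero {c : ℕ → ℕ} {i : ℕ} (hi : i + 1 < n) (hc : c i = c (i + 1)) :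
    symmetrize n c = 0 := by
  rw [symmetrize, divLong_eq_zero (i := i) (by omega), map_zero]
  exact monomial_mem_divKer (by omega) hc (by omega)

/-- Up to a sign the elementary polynomial is fixed by the longest permutation, and it is odd
symmetric. It therefore passes under the permutation and the longest divided difference, and the
product becomes one with a monomial. -/
theorem symmetrize_mul_elemSym (n : ℕ) (c : ℕ → ℕ) (k : ℕ) :
    symmetrize n c * elemSym (xt n) n k = ∑ I ∈ powersetCard k (range n),
      (-1 : ℤ) ^ ((∑ j ∈ range n, j + (n - 1)) * k + k.choose 2 +
        ∑ i ∈ I, ∑ j ∈ Ico (i + 1) n, c j) •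
        symmetrize n fun i => c i + if i ∈ I then 1 else 0 := by
  have h : elemSym (xt n) n k = (-1 : ℤ) ^ ((∑ j ∈ range n, j + (n - 1)) * k + k.choose 2) •
      permAct Fin.revPerm (elemSym (xt n) n k) := by
    rw [permAct_revPerm_elemSym, smul_smul, neg_one_pow_mul_self, one_smul]
  rw [h, symmetrize, mul_smul_comm, ← map_mul, ← divLong_mul,
    monomial_mul_elemSym (xt_anticomm n) le_rfl,
    map_sum, map_sum, smul_sum]
  · refine sum_congr rfl fun I _ => ?_
    rw [map_zsmul, map_zsmul, smul_smul, ← pow_add, symmetrize]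
  · exact fun i => mem_divKer.1 (mem_OddSym_iff.1 (elemSym_mem_OddSym k) i)

/-- The exponent of the sign of the odd symmetrized Schur polynomials, in terms of the signed
variables. -/
def symmExp (n : ℕ) (l : ℕ → ℕ) : ℕ :=
  n.choose 3 + ∑ i ∈ range n, (l i * ∑ j ∈ range i, (n - 1 - j) + i * (l i + (n - 1 - i)))

/-- The odd symmetrized Schur polynomial of a sequence. -/
def symmPoly (n : ℕ) (l : ℕ →₀ ℕ) : OPol n :=
  (-1 : ℤ) ^ symmExp n l • symmetrize n fun i => l i + (n - 1 - i)

theorem prod_ofFn_X_pow (n : ℕ) (c : ℕ → ℕ) :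
    (List.ofFn fun i : Fin n => X i ^ c i).prod = monomial (x n) n c := by
  have h : ∀ m, (List.ofFn fun i : Fin m => x n i ^ c i).prod = monomial (x n) m c := by
    intro m
    induction m with
    | zero => rfl
    | succ m ih =>
      rw [List.ofFn_succ', List.prod_concat, monomial, ← ih]
      rfl
  rw [← h]
  congr 2
  funext i
  rw [x_of_lt i.2]

theorem monomial_x_eq (n m : ℕ) (c : ℕ → ℕ) :
    monomial (x n) m c = (-1 : ℤ) ^ (∑ i ∈ range m, i * c i) • monomial (xt n) m c := by
  have h : (xt n) = fun a => (-1 : ℤ) ^ a • x n a := funext fun a => xt_eq_zsmul n a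
  rw [h, monomial_zsmul, smul_smul, neg_one_pow_mul_self, one_smul]

/-- In `symmExp`, the binomial is the normalization in the definition, the terms l i * ∑ come from
merging the monomial of lam with the staircase monomial, and the terms i * (…) from passing to
signed variables. -/
theorem schurS_eq (n : ℕ) (lam : YoungDiagram) : schurS n lam = symmPoly n (rows lam) := by
  have h0 : (List.ofFn fun i : Fin n => (X i : OPol n) ^ lam.rowLen i).prod =
      monomial (x n) n (rows lam) := prod_ofFn_X_pow n lam.rowLen
  have h1 := prod_ofFn_X_pow n fun i => n - 1 - i
  have h2 : ∀ (a : ℕ) (r : OPol n), (-1 : OPol n) ^ a * r = (-1 : ℤ) ^ a • r := fun a r => by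
    rw [zsmul_eq_mul]; simp
  rw [schurS, h0, h1, monomial_mul_monomial fun a b h =>
    eq_neg_of_add_eq_zero_left (x_anticomm n h), monomial_x_eq, smul_smul, ← pow_add,
    ← sum_add_distrib, map_zsmul, map_zsmul, h2, smul_smul, ← pow_add, oddDivLongest_eq]
  rfl

/-! ### The Pieri rule for the odd symmetrized polynomials -/

theorem sum_range_add_sum_Ico {M : Type*} [AddCommMonoid M] (f : ℕ → M) {i : ℕ} (hi : i < n) :
    ∑ j ∈ range n, f j = ∑ j ∈ range i, f j + f i + ∑ j ∈ Ico (i + 1) n, f j := by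
  rw [← sum_range_succ, range_eq_Ico, range_eq_Ico,
    sum_Ico_consecutive _ (Nat.zero_le _) (by omega)]

/-- Adding at most one box per row breaks monotonicity only at two equal rows of which just the
lower one grows. The exponents shifted by the staircase then coincide, so the symmetrization
vanishes. -/
theorem exists_of_not_antitone_addBoxes {l : ℕ →₀ ℕ} (hanti : Antitone l)
    {I : Finset ℕ} (hI : I ⊆ range n) (h : ¬Antitone (addBoxes l I)) :
    ∃ i, i + 1 < n ∧ l i = l (i + 1) ∧ i ∉ I ∧ i + 1 ∈ I := by
  by_contra hc
  push Not at hc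
  refine h (antitone_nat_of_succ_le fun i => ?_)
  have h1 : l (i + 1) ≤ l i := hanti (Nat.le_succ i)
  rw [addBoxes_apply, addBoxes_apply]
  by_cases h2 : i + 1 ∈ I
  · have h3 := hc i (mem_range.1 (hI h2))
    by_cases h4 : i ∈ I
    · simp only [h2, h4, if_true]; omega
    · have h5 : l i ≠ l (i + 1) := fun e => h3 e h4 h2
      simp only [h2, h4, if_true, if_false]; omega
  · simp only [h2, if_false]; omega

/-- The exponent of the sign in the Pieri rule for elementary polynomials, after normalization. -/
def pieriExpNormalized (n : ℕ) (l : ℕ → ℕ) (I : Finset ℕ) : ℕ :=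
  I.card.choose 2 + ∑ i ∈ I, ∑ j ∈ Ico (i + 1) n, l j

/-- For each i in I the staircase contributes its sum over the rows below i and over the rows above
i, plus i. Modulo 2 this is the whole staircase sum plus (n - 1 - i) + i, independent of i, and it
cancels the sign from the longest permutation. -/
theorem symmPoly_sign (l : ℕ →₀ ℕ) {I : Finset ℕ} (hI : I ⊆ range n) :
    (-1 : ℤ) ^ (symmExp n l + ((∑ j ∈ range n, j + (n - 1)) * I.card + I.card.choose 2 +
      ∑ i ∈ I, ∑ j ∈ Ico (i + 1) n, (l j + (n - 1 - j)))) =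
    (-1) ^ (pieriExpNormalized n l I + symmExp n (addBoxes l I)) := by
  have two : (2 : ZMod 2) = 0 := rfl
  apply neg_one_pow_eq_of_natCast_eq
  have h1 : symmExp n (addBoxes l I) =
      symmExp n l + ∑ i ∈ I, (∑ j ∈ range i, (n - 1 - j) + i) := by
    rw [symmExp, symmExp, add_assoc, ← sum_range_mem hI, ← sum_add_distrib]
    congr 1
    refine sum_congr rfl fun i _ => ?_
    rw [addBoxes_apply]
    split_ifs <;> ring
  have h2 : ((∑ i ∈ I, ∑ j ∈ Ico (i + 1) n, (n - 1 - j) : ℕ) : ZMod 2) +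
      (∑ i ∈ I, (∑ j ∈ range i, (n - 1 - j) + i) : ℕ) =
      ((∑ j ∈ range n, j + (n - 1)) * I.card : ℕ) := by
    have h3 : ∀ i ∈ I, ((∑ j ∈ Ico (i + 1) n, (n - 1 - j) : ℕ) : ZMod 2) +
        (∑ j ∈ range i, (n - 1 - j) + i : ℕ) = (∑ j ∈ range n, j + (n - 1) : ℕ) := by
      intro i hi
      have hin := mem_range.1 (hI hi)
      have h4 := sum_range_add_sum_Ico (fun j => n - 1 - j) hin
      have h5 : ∑ j ∈ range n, (n - 1 - j) = ∑ j ∈ range n, j := sum_range_reflect (fun j => j) n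
      rw [h5] at h4
      have h6 : n - 1 = (n - 1 - i) + i := by omega
      generalize hb : n - 1 - i = b at h4 h6
      rw [h4]
      have h7 : ((n - 1 : ℕ) : ZMod 2) = b + i := by rw [h6]; push_cast; rfl
      rw [Nat.cast_add _ (n - 1), h7]
      push_cast
      linear_combination -(b : ZMod 2) * two
    rw [Nat.cast_sum, Nat.cast_sum, ← sum_add_distrib, sum_congr rfl h3, sum_const, nsmul_eq_mul,
      Nat.cast_mul, mul_comm]
  rw [h1, pieriExpNormalized]
  simp only [sum_add_distrib (f := fun j => l j)]
  rw [sum_add_distrib]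
  simp only [Nat.cast_add _ (∑ i ∈ I, (∑ j ∈ range i, (n - 1 - j) + i)), Nat.cast_add (symmExp n l),
    Nat.cast_add _ (∑ i ∈ I, ∑ j ∈ Ico (i + 1) n, (n - 1 - j)), Nat.cast_add _ (I.card.choose 2),
    Nat.cast_add (I.card.choose 2), Nat.cast_add _ (symmExp n l + _),
    Nat.cast_add _ (_ + ∑ i ∈ I, ∑ j ∈ Ico (i + 1) n, (n - 1 - j))]
  linear_combination -h2 + ((∑ i ∈ I, ∑ j ∈ Ico (i + 1) n, (n - 1 - j) : ℕ) : ZMod 2) * two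

open Classical in
/-- A family of polynomials satisfies the normalized Pieri rule for elementary polynomials. -/
def PieriRule (n : ℕ) (T : (ℕ →₀ ℕ) → OPol n) : Prop :=
  ∀ l : ℕ →₀ ℕ, (∀ i, n ≤ i → l i = 0) → Antitone l → ∀ k,
    T l * elemSym (xt n) n k = ∑ I ∈ powersetCard k (range n),
      (-1 : ℤ) ^ pieriExpNormalized n l I • if Antitone (addBoxes l I) then T (addBoxes l I) else 0

theorem pieriRule_symmPoly (n : ℕ) : PieriRule n (symmPoly n) := by
  intro l hl hanti k
  rw [symmPoly, smul_mul_assoc, symmetrize_mul_elemSym, smul_sum]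
  refine sum_congr rfl fun I hI => ?_
  obtain ⟨hI', rfl⟩ := mem_powersetCard.1 hI
  clear hI
  rw [smul_smul, ← pow_add, symmPoly_sign l hI', pow_add, mul_smul]
  congr 1
  have h : (fun i => l i + (n - 1 - i) + if i ∈ I then 1 else 0) =
      fun i => addBoxes l I i + (n - 1 - i) := by
    funext i
    rw [addBoxes_apply, add_right_comm]
  rw [h]
  split_ifs with h1
  · rfl
  -- The terms that are not partitions vanish on both sides: here two adjacent exponents are equal.
  · obtain ⟨i, hi, h2, h3, h4⟩ := exists_of_not_antitone_addBoxes hanti hI' h1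
    rw [symmetrize_eq_zero hi, smul_zero]
    rw [addBoxes_apply, addBoxes_apply, if_neg h3, if_pos h4, h2]
    omega

/-! ### The Pieri rule for the plactic polynomials -/

theorem sum_card_filter_lt (I : Finset ℕ) :
    ∑ i ∈ I, (I.filter fun j => j < i).card = I.card.choose 2 := by
  induction I using Finset.induction_on_max with
  | empty => rfl
  | insert a s ha ih =>
    have h0 : a ∉ s := fun h => lt_irrefl _ (ha a h)
    rw [sum_insert h0, card_insert_of_notMem h0, Nat.choose_succ_succ' s.card 1,
      Nat.choose_one_right,
      ← ih, filter_insert, if_neg (lt_irrefl _), filter_true_of_mem ha]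
    congr 1
    refine sum_congr rfl fun i hi => ?_
    rw [filter_insert, if_neg (ha i hi).not_gt]

/-- The number of pairs of a box and a box in a higher row. -/
def rowPairs (n : ℕ) (l : ℕ → ℕ) : ℕ := ∑ i ∈ range n, l i * ∑ j ∈ range i, l j

/-- A new box in row i pairs with the old boxes above it and with those below it, and the new boxes
pair among themselves. Consequently, normalizing by `rowPairs` replaces the count of boxes above in
the Pieri sign by `pieriExpNormalized`, which counts boxes below and pairs of new boxes. -/
theorem rowPairs_addBoxes (l : ℕ →₀ ℕ) {I : Finset ℕ} (hI : I ⊆ range n) :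
    rowPairs n (addBoxes l I) = rowPairs n l + ∑ i ∈ I, ∑ j ∈ range i, l j +
      pieriExpNormalized n l I := by
  have h1 : ∀ i, ∑ j ∈ range i, addBoxes l I j =
      ∑ j ∈ range i, l j + (I.filter fun j => j < i).card := by
    intro i
    simp only [addBoxes_apply, sum_add_distrib]
    congr 1
    rw [sum_boole, Nat.cast_id]
    congr 1
    ext j
    simp [and_comm]
  have h2 : ∑ i ∈ range n, l i * (I.filter fun j => j < i).card =
      ∑ i ∈ I, ∑ j ∈ Ico (i + 1) n, l j := by
    have h3 : ∀ i ∈ I, ∑ j ∈ Ico (i + 1) n, l j = ∑ j ∈ range n, if i < j then l j else 0 := by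
      intro i _
      rw [← sum_filter]
      refine sum_congr ?_ fun _ _ => rfl
      ext j
      simp only [mem_Ico, mem_filter, mem_range]
      omega
    rw [sum_congr rfl h3, sum_comm]
    refine sum_congr rfl fun i _ => ?_
    rw [← sum_filter, sum_const, smul_eq_mul, mul_comm]
  rw [rowPairs, rowPairs, pieriExpNormalized, ← sum_card_filter_lt, ← h2, ← sum_range_mem hI,
    ← sum_range_mem hI fun i => (I.filter fun j => j < i).card, ← sum_add_distrib,
    ← sum_add_distrib, ← sum_add_distrib]
  refine sum_congr rfl fun i _ => ?_
  rw [h1, addBoxes_apply]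
  split_ifs <;> ring

/-- The plactic odd Schur polynomial of a sequence. -/
def placticPoly (n : ℕ) (l : ℕ →₀ ℕ) : OPol n :=
  (-1 : ℤ) ^ (rowStat l + rowPairs n l) • tabPoly (xt n) n l

theorem pieriRule_placticPoly (n : ℕ) : PieriRule n (placticPoly n) := by
  intro l hl hanti k
  rw [placticPoly, smul_mul_assoc, tabPoly_mul_elemSym (xt_anticomm n) hl hanti, pieriSum, smul_sum]
  refine sum_congr rfl fun I hI => ?_
  obtain ⟨hI', rfl⟩ := mem_powersetCard.1 hI
  clear hI
  split_ifs
  · rw [placticPoly, smul_smul, smul_smul, ← pow_add, ← pow_add]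
    congr 1
    apply neg_one_pow_eq_of_natCast_eq
    rw [rowPairs_addBoxes l hI', rowStat_addBoxes hl hI', pieriExp, sum_add_distrib]
    have two : (2 : ZMod 2) = 0 := rfl
    push_cast
    linear_combination -(pieriExpNormalized n l I : ZMod 2) * two
  · simp only [smul_zero]

theorem bigN_eq_rowPairs {lam : YoungDiagram} (h : lam.colLen 0 ≤ n) :
    bigN lam = rowPairs n (rows lam) := by
  have h1 : ∀ c ∈ lam.cells, (lam.cells.filter fun b => b.1 < c.1).card =
      ∑ i ∈ range c.1, lam.rowLen i := by
    intro c hc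
    have hc1 : c.1 < n := by
      have h2 := YoungDiagram.mem_iff_lt_colLen.1 ((YoungDiagram.mem_cells _).1 hc)
      have h3 := lam.colLen_anti 0 c.2 (Nat.zero_le _)
      omega
    rw [card_filter, sum_cells lam (fun i _ => if i < c.1 then 1 else 0) h]
    simp only [sum_const, card_range, smul_eq_mul, mul_ite, mul_one, mul_zero]
    rw [← sum_filter]
    refine sum_congr ?_ fun _ _ => rfl
    ext i
    simp only [mem_filter, mem_range]
    omega
  rw [bigN, sum_congr rfl h1, sum_cells lam (fun i _ => ∑ j ∈ range i, lam.rowLen j) h, rowPairs]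
  simp only [sum_const, card_range, smul_eq_mul]
  rfl

theorem schurP_eq_placticPoly {lam : YoungDiagram} (h : lam.colLen 0 ≤ n) :
    schurP n lam = placticPoly n (rows lam) := by
  rw [schurP_eq, bigN_eq_rowPairs h, placticPoly]

/-! ### Uniqueness of solutions of the Pieri rule -/

theorem exists_support_eq_range {l : ℕ →₀ ℕ} (hanti : Antitone l) : ∃ r, l.support = range r := by
  classical
  have h : ∃ r, l r = 0 := by
    obtain ⟨L, hL⟩ := exists_bound l
    exact ⟨L, hL L le_rfl⟩
  refine ⟨Nat.find h, ?_⟩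
  ext i
  rw [Finsupp.mem_support_iff, mem_range, Nat.lt_find_iff]
  refine ⟨fun h1 m hm h2 => h1 ?_, fun h1 => h1 i le_rfl⟩
  have h3 := hanti hm
  omega

/-- Remove the first column of l, of height r, and apply the rule with k = r to the remaining shape.
The term that restores the column is l up to sign; every other term has the same size and more rows.
The induction is therefore on the size, and within one size on decreasing number of rows; the weight
n + 1 makes the size dominate. -/
theorem PieriRule.unique {T T' : (ℕ →₀ ℕ) → OPol n} (hT : PieriRule n T) (hT' : PieriRule n T')
    (h0 : T 0 = T' 0) (l : ℕ →₀ ℕ) (hl : ∀ i, n ≤ i → l i = 0) (hanti : Antitone l) :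
    T l = T' l := by
  classical
  induction h : l.degree * (n + 1) + (n - l.support.card) using Nat.strong_induction_on
    generalizing l with
  | _ N ih =>
    subst h
    obtain ⟨r, hr⟩ := exists_support_eq_range hanti
    have hr' : ∀ i, l i ≠ 0 ↔ i < r := fun i => by
      rw [← Finsupp.mem_support_iff, hr, mem_range]
    rcases Nat.eq_zero_or_pos r with rfl | hr0
    · rw [range_zero, Finsupp.support_eq_empty] at hr
      rw [hr, h0]
    have hrn : r ≤ n := by
      by_contra h1
      exact (hr' n).2 (by omega) (hl n le_rfl)
    -- Truncated subtraction removes exactly the first column, leaving the zero rows at zero.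
    let l' : ℕ →₀ ℕ := l.mapRange (· - 1) rfl
    have hl'_apply : ∀ i, l' i = l i - 1 := fun i => rfl
    have hl' : ∀ i, n ≤ i → l' i = 0 := fun i hi => by rw [hl'_apply, hl i hi]
    have hanti' : Antitone l' := fun i j hij => Nat.sub_le_sub_right (hanti hij) 1
    have hadd : addBoxes l' (range r) = l := by
      ext i
      rw [addBoxes_apply, hl'_apply]
      have := hr' i
      by_cases hi : i < r
      · rw [if_pos (mem_range.2 hi)]; omega
      · rw [if_neg (by simpa using hi)]; omega
    have hdeg : l.degree = l'.degree + r := by rw [← hadd, degree_addBoxes, card_range]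
    have hlt : l'.degree * (n + 1) + (n - l'.support.card) <
        l.degree * (n + 1) + (n - l.support.card) := by
      rw [hdeg, add_mul]
      have : n + 1 ≤ r * (n + 1) := Nat.le_mul_of_pos_left _ hr0
      omega
    have e1 := ih _ hlt l' hl' hanti' rfl
    have hmem : range r ∈ powersetCard r (range n) :=
      mem_powersetCard.2 ⟨range_subset_range.2 hrn, card_range r⟩
    have e2 := hT l' hl' hanti' r
    have e3 := hT' l' hl' hanti' r
    rw [← add_sum_erase _ _ hmem, hadd, if_pos hanti] at e2 e3
    have e4 : ∀ I ∈ (powersetCard r (range n)).erase (range r),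
        (-1 : ℤ) ^ pieriExpNormalized n l' I •
          (if Antitone (addBoxes l' I) then T (addBoxes l' I) else 0) =
        (-1 : ℤ) ^ pieriExpNormalized n l' I •
          (if Antitone (addBoxes l' I) then T' (addBoxes l' I) else 0) := by
      intro I hI
      obtain ⟨hne, hI⟩ := mem_erase.1 hI
      obtain ⟨hIn, hIc⟩ := mem_powersetCard.1 hI
      split_ifs with h1
      · congr 1
        refine ih _ ?_ _ (addBoxes_bound hl' hIn) h1 rfl
        have hd : (addBoxes l' I).degree = l.degree := by rw [degree_addBoxes, hIc, hdeg]
        obtain ⟨s, hs⟩ := exists_support_eq_range h1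
        have hsn : s ≤ n := by
          by_contra h2
          have h3 : n ∈ (addBoxes l' I).support := by rw [hs, mem_range]; omega
          exact Finsupp.mem_support_iff.1 h3 (addBoxes_bound hl' hIn n le_rfl)
        -- A set of r rows different from the first r contains a row of index at least r, so the new
        -- shape has more than r rows.
        have hrs : r < s := by
          by_contra h2
          refine hne (eq_of_subset_of_card_le (fun i hi => ?_) (by rw [hIc, card_range]))
          have h3 : i ∈ (addBoxes l' I).support := by
            rw [Finsupp.mem_support_iff, addBoxes_apply, if_pos hi]; omega
          rw [hs, mem_range] at h3
          exact mem_range.2 (by omega)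
        rw [hd, hs, hr, card_range, card_range]
        omega
      · rfl
    rw [e1, e3, sum_congr rfl e4] at e2
    have e5 := congrArg ((-1 : ℤ) ^ pieriExpNormalized n l' (range r) • ·) (add_right_cancel e2)
    simpa only [smul_smul, neg_one_pow_mul_self, one_smul] using e5.symm

/-! ### The constant terms -/

theorem x_pow_mul_x_pow_mem_divKer {i : ℕ} (h : i < n - 1) (a : ℕ) :
    x n i ^ a * x n (i + 1) ^ a ∈ divKer n i := by
  have h1 : ∀ j, x n j = (-1 : ℤ) ^ j • xt n j := fun j => by
    rw [xt_eq_zsmul, smul_smul, neg_one_pow_mul_self, one_smul]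
  rw [h1, h1 (i + 1), smul_pow, smul_pow, smul_mul_smul_comm]
  exact zsmul_mem (xt_pow_mul_xt_pow_mem_divKer h a) _

theorem actNat_monomial {i m : ℕ} (h : i < n - 1) (hm : m ≤ i) (c : ℕ → ℕ) :
    actNat n i (monomial (x n) m c) = (-1 : ℤ) ^ (∑ j ∈ range m, c j) • monomial (x n) m c := by
  induction m with
  | zero => simp [monomial]
  | succ m ih =>
    have h1 : (-x n m) ^ c m = (-1 : ℤ) ^ c m • x n m ^ c m := by
      rw [neg_pow, zsmul_eq_mul]
      simp
    rw [monomial, map_mul, map_pow, ih (by omega), actNat_x_of_ne h (by omega) (by omega), h1,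
      sum_range_succ, pow_add, smul_mul_smul_comm]

theorem x_mem_divKer {i a : ℕ} (h1 : a ≠ i) (h2 : a ≠ i + 1) : x n a ∈ divKer n i :=
  divNat_x_of_ne h1 h2

/-- One factor x_p is split off from an equal-power product in x_p and x_{p+1}. The product is
killed by ∂_p, so the Leibniz rule removes just this factor; the sign comes from s_p acting on the
variables before x_p. -/
theorem divNat_monomial {p N : ℕ} (h : p < n - 1) (hN : p + 2 ≤ N) {c : ℕ → ℕ}
    (hc : c p = c (p + 1) + 1) :
    divNat n p (monomial (x n) N c) =
      (-1 : ℤ) ^ (∑ i ∈ range p, c i) • monomial (x n) N (Function.update c p (c (p + 1))) := by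
  induction N, hN using Nat.le_induction with
  | base =>
    have h1 : ∀ m ≤ p, monomial (x n) m c ∈ divKer n p := by
      intro m hm
      induction m with
      | zero => exact one_mem _
      | succ m ih =>
        exact mul_mem (ih (by omega)) (pow_mem (x_mem_divKer (by omega) (by omega)) _)
    have h2 : monomial (x n) p (Function.update c p (c (p + 1))) = monomial (x n) p c :=
      monomial_congr _ fun i hi => Function.update_of_ne (by omega) _ _
    have h3 := mem_divKer.1 (x_pow_mul_x_pow_mem_divKer h (c (p + 1)))
    rw [monomial, monomial, monomial, monomial, h2, Function.update_self,
      Function.update_of_ne (by omega), mul_assoc, divNat_mul, mem_divKer.1 (h1 p le_rfl), zero_mul,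
      zero_add, actNat_monomial h le_rfl, hc, pow_succ', mul_assoc (x n p), divNat_self_mul h, h3,
      mul_zero, sub_zero, smul_mul_assoc, mul_assoc]
  | succ N hN ih =>
    rw [monomial, monomial, divNat_mul, ih,
      mem_divKer.1 (pow_mem (x_mem_divKer (by omega) (by omega)) _), mul_zero, add_zero,
      Function.update_of_ne (by omega), smul_mul_assoc]

/-- When ∂_p is applied, the exponents of x_p and x_{p+1} still differ by one, since the earlier
operators only lowered exponents before p. -/
theorem divCycle_monomial {m p : ℕ} (hm : m < n) (hp : p ≤ m) :
    divCycle n p (monomial (x n) (m + 1) fun i => m - i) =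
      (-1 : ℤ) ^ (∑ q ∈ range p, ∑ i ∈ range q, (m - 1 - i)) •
        monomial (x n) (m + 1) fun i => if i < p then m - 1 - i else m - i := by
  induction p with
  | zero => simp [divCycle]
  | succ p ih =>
    rw [divCycle, Module.End.mul_apply, ih (by omega), map_zsmul,
      divNat_monomial (by omega) (by omega),
      smul_smul, ← pow_add, sum_range_succ]
    · congr 1
      · congr 2
        refine sum_congr rfl fun i hi => ?_
        rw [if_pos (mem_range.1 hi)]
      · refine monomial_congr _ fun i _ => ?_
        by_cases h1 : i = p
        · subst h1
          rw [Function.update_self, if_neg (by omega), if_pos (by omega)]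
          omega
        · rw [Function.update_of_ne h1]
          by_cases h2 : i < p
          · rw [if_pos h2, if_pos (by omega)]
          · rw [if_neg h2, if_neg (by omega)]
    · simp only [lt_irrefl, if_false, if_neg (show ¬p + 1 < p by omega)]
      omega

theorem divCycle_sign (m : ℕ) :
    (-1 : ℤ) ^ (∑ q ∈ range m, ∑ i ∈ range q, (m - 1 - i)) = (-1) ^ m.choose 2 := by
  apply neg_one_pow_eq_of_natCast_eq
  induction m with
  | zero => rfl
  | succ m ih =>
    have h : ∑ q ∈ range (m + 1), ∑ i ∈ range q, (m + 1 - 1 - i) =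
        ∑ q ∈ range m, ∑ i ∈ range q, (m - 1 - i) + m * m := by
      rw [sum_range_succ', range_zero, sum_empty, add_zero]
      have h1 : ∀ q ∈ range m, ∑ i ∈ range (q + 1), (m + 1 - 1 - i) =
          ∑ i ∈ range q, (m - 1 - i) + m := by
        intro q _
        rw [sum_range_succ']
        congr 1
        exact sum_congr rfl fun i _ => by omega
      rw [sum_congr rfl h1, sum_add_distrib, sum_const, card_range, smul_eq_mul]
    have h2 : ∀ a : ZMod 2, a * a = a := by decide
    rw [h, Nat.cast_add, ih, Nat.choose_succ_succ' m 1, Nat.choose_one_right, Nat.cast_mul, h2,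
      Nat.cast_add, add_comm]

/-- Each cycle turns a staircase into the next smaller one at the cost of a sign with binomial
exponent. By Pascal's rule these exponents add up to the binomial that normalizes the symmetrized
Schur polynomials. -/
theorem divLong_monomial {m : ℕ} (hm : m < n) :
    divLong n m (monomial (x n) (m + 1) fun i => m - i) = (-1 : ℤ) ^ ((m + 1).choose 3) • 1 := by
  induction m with
  | zero => simp [divLong, monomial, Nat.choose]
  | succ m ih =>
    have h : monomial (x n) (m + 1 + 1) (fun i => if i < m + 1 then m + 1 - 1 - i else m + 1 - i) =
        monomial (x n) (m + 1) fun i => m - i := by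
      rw [monomial, if_neg (lt_irrefl _), Nat.sub_self, pow_zero, mul_one]
      refine monomial_congr _ fun i hi => ?_
      rw [if_pos hi]
      rfl
    rw [divLong, Module.End.mul_apply, divCycle_monomial hm le_rfl, map_zsmul, h, ih (by omega),
      divCycle_sign, smul_smul, ← pow_add, Nat.choose_succ_succ' (m + 1) 2]

theorem symmPoly_zero (n : ℕ) : symmPoly n 0 = 1 := by
  have h1 : divLong n (n - 1) (monomial (x n) n fun i => n - 1 - i) =
      (-1 : ℤ) ^ n.choose 3 • 1 := by
    cases n with
    | zero => simp [divLong, monomial]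
    | succ m => exact divLong_monomial (Nat.lt_succ_self m)
  rw [monomial_x_eq, map_zsmul] at h1
  have h2 := congrArg (fun f => (-1 : ℤ) ^ n.choose 3 • permAct Fin.revPerm f) h1
  simp only [map_zsmul, smul_smul, neg_one_pow_mul_self, map_one, one_smul] at h2
  rw [← h2, symmPoly, symmExp, symmetrize, pow_add]
  simp

theorem placticPoly_zero (n : ℕ) : placticPoly n 0 = 1 := by
  rw [placticPoly, tabPoly_zero_shape]
  simp [rowStat, rowPairs]

/-- The plactic and the odd symmetrized Schur polynomials coincide. -/
theorem schurP_eq_schurS {lam : YoungDiagram} (h : lam.colLen 0 ≤ n) :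
    schurP n lam = schurS n lam := by
  rw [schurP_eq_placticPoly h, schurS_eq]
  exact (pieriRule_placticPoly n).unique (pieriRule_symmPoly n)
    ((placticPoly_zero n).trans (symmPoly_zero n).symm) _ (rows_bound h) (rows_antitone lam)

/-! ### Odd symmetric functions -/

theorem map_hPart {R S : Type} [Ring R] [Ring S] (f : R →+* S) (h : ℕ → R) (mu : YoungDiagram) :
    f (hPart h mu) = hPart (fun k => f (h k)) mu := by
  rw [hPart, map_list_prod, List.map_map]
  rfl

theorem map_kostkaSchur {R S : Type} [Ring R] [Ring S] (f : R →+* S) (h : ℕ → R)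
    (lam : YoungDiagram) : f (kostkaSchur h lam) = kostkaSchur (fun k => f (h k)) lam := by
  simp only [kostkaSchur, map_sum, map_zsmul, map_hPart]

theorem x_eq_zero {a : ℕ} (h : n ≤ a) : x n a = 0 := dif_neg (not_lt.2 h)

theorem trunc_x {N a : ℕ} (h : n ≤ N) : trunc N n (x N a) = x n a := by
  by_cases ha : a < N
  · rw [x_of_lt ha, trunc, lift_X]
  · rw [x_eq_zero (by omega), x_eq_zero (by omega), map_zero]

theorem trunc_xt {N a : ℕ} (h : n ≤ N) : trunc N n (xt N a) = xt n a := by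
  rw [xt_eq_zsmul, xt_eq_zsmul, map_zsmul, trunc_x h]

theorem trunc_hsym {N : ℕ} (h : n ≤ N) (k : ℕ) : trunc N n (hsym N k) = hsym n k := by
  simp only [hsym_eq, map_complSym, trunc_xt h]
  induction N, h using Nat.le_induction with
  | base => rfl
  | succ N hN ih =>
    cases k with
    | zero => simp
    | succ k => rw [complSym, xt, x_eq_zero hN, mul_zero, mul_zero, add_zero, ih]

/-- The coefficients over products of complete polynomials do not depend on the number of variables,
so compatibility with truncation passes from the complete polynomials to the Kostka version. -/
theorem trunc_schurK {N : ℕ} (h : n ≤ N) (lam : YoungDiagram) :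
    trunc N n (schurK N lam) = schurK n lam := by
  simp only [schurK, map_kostkaSchur, trunc_hsym h]

theorem xt_mem_degLE (n a : ℕ) : xt n a ∈ degLE n 1 := by
  rw [xt_eq_zsmul]
  refine zsmul_mem ?_ _
  by_cases h : a < n
  · rw [x_of_lt h]
    exact Submodule.subset_span ⟨[⟨a, h⟩], by simp, by simp⟩
  · rw [x_eq_zero (not_lt.1 h)]
    exact zero_mem _

theorem hsym_mem_degLE (n k : ℕ) : hsym n k ∈ degLE n k := by
  have h : ∀ m k, complSym (xt n) m k ∈ degLE n k := by
    intro m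
    induction m with
    | zero =>
      intro k
      cases k with
      | zero => rw [complSym]; exact degLE_one n
      | succ k => rw [complSym]; exact zero_mem _
    | succ m ih =>
      intro k
      induction k with
      | zero => rw [complSym]; exact degLE_one n
      | succ k ihk => rw [complSym]; exact add_mem (ih _) (degLE_mul ihk (xt_mem_degLE n m))
  rw [hsym_eq]
  exact h n k

theorem hsymFun_mem (k : ℕ) : hsymFun k ∈ OddSymFun :=
  ⟨fun _ => hsym_mem_OddSym k, fun n => trunc_hsym (Nat.le_succ n) k, k,
    fun n => hsym_mem_degLE n k⟩

theorem schurKFun_apply (lam : YoungDiagram) (n : ℕ) : schurKFun lam n = schurK n lam :=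
  map_kostkaSchur (Pi.evalRingHom OPol n) hsymFun lam

theorem schurPFun_eq_schurSFun (lam : YoungDiagram) : schurPFun lam = schurSFun lam := by
  funext n
  rw [schurPFun, schurSFun]
  split_ifs with h
  · exact schurP_eq_schurS h
  -- With fewer variables than rows, the comparison goes through the Kostka version, for which
  -- truncation is already understood.
  · rw [← schurP_eq_schurS le_rfl, ← schurK_eq_schurP, ← schurK_eq_schurP,
      trunc_schurK (not_le.1 h).le]

end OddSchur

end

/-! ### The main theorem -/

theorem mainTheorem1 (lam : YoungDiagram) :
    -- the change of basis relation that defines the Kostka odd Schur functions is unimodular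
    IsUnit (OddSchur.kostkaMatrix lam.card).det ∧
    -- odd symmetric polynomials in `n` variables
    (∀ n : ℕ,
      OddSchur.schurK n lam ∈ OddSchur.OddSym n ∧
      OddSchur.schurK n lam = OddSchur.schurP n lam ∧
      (lam.colLen 0 ≤ n → OddSchur.schurP n lam = OddSchur.schurS n lam)) ∧
    -- odd symmetric functions
    (OddSchur.schurKFun lam ∈ OddSchur.OddSymFun ∧
      OddSchur.schurKFun lam = OddSchur.schurPFun lam ∧
      OddSchur.schurPFun lam = OddSchur.schurSFun lam) :=
  ⟨OddSchur.isUnit_det_kostkaMatrix _,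
    fun n => ⟨OddSchur.kostkaSchur_mem _ OddSchur.hsym_mem_OddSym lam,
      OddSchur.schurK_eq_schurP n lam, OddSchur.schurP_eq_schurS⟩,
    OddSchur.kostkaSchur_mem _ OddSchur.hsymFun_mem lam,
    funext fun n => (OddSchur.schurKFun_apply lam n).trans (OddSchur.schurK_eq_schurP n lam),
    OddSchur.schurPFun_eq_schurSFun lam⟩
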